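/- Let $k$ be an infinite field and let $S=\bigoplus_{n\ge 0}S_n$ be a standard graded $k$-algebra (that is, $S$ is commutative, $S_0=k$, and $S$ is generated as a $k$-algebra by the finite-dimensional space $S_1$) of Krull dimension $d>0$. Put $\mathfrak n=S_+=\bigoplus_{n>0}S_n$ and $R=S_{\mathfrak n}$, with maximal ideal $\mathfrak m$. Let $r>0$ be an integer, let $J$ be an ideal of $S$ generated by homogeneous elements of degree $r$, and put $I=JR$. Suppose that 1. $\ell(I)=d$, where $\ell(I)=\dim\bigl(\mathrm{gr}_I(R)/\mathfrak m\,\mathrm{gr}_I(R)\bigr)$ is the analytic spread of $I$, with $\mathrm{gr}_I(R)=\bigoplus_{n\ge0}I^n/I^{n+1}$; and 2. $J$ satisfies $G_d$, i.e. for every prime ideal $P\supseteq J$ of $S$ with $\mathrm{ht}\,P<d$, the ideal $JS_P$ can be generated by at most $\mathrm{ht}\,P$ elements. Then for general homogeneous elements $f_1,\dots,f_{d-1}\in J$ of degree $r$ (that is, for all tuples $(f_1,\dots,f_{d-1})$ in some nonempty Zariski-open subset of the finite-dimensional $k$-vector space $(J\cap S_r)^{d-1}$) one has $$ j(I)\;=\;r\cdot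 e\bigl(S/((f_1,\dots,f_{d-1}):_S J)\bigr). $$ Here $$ j(I)=\lim_{n\to\infty}\frac{(d-1)!}{n^{d-1}}\;\mathrm{length}_R\,H^0_{\mathfrak m}\bigl(I^n/I^{n+1}\bigr) $$ is the j-multiplicity of $I$, with $H^0_{\mathfrak m}(N)=\{x\in N:\mathfrak m^t x=0\text{ for some }t\}$, and for a finitely generated graded $S$-module $M\neq 0$ of dimension $\delta$, $$ e(M)=\lim_{n\to\infty}\frac{\delta!}{n^{\delta}}\;\mathrm{length}_S\,(M/\mathfrak n^nM) $$ is its multiplicity with respect to $\mathfrak n$. Both limits exist, and $e\bigl(S/((f_1,\dots,f_{d-1}):_S J)\bigr)$ is a nonnegative integer. -/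

import Mathlib

open Filter Topology
open scoped ENNReal Nat

/-- `S = ⨁ Sₙ` is a standard graded algebra over the field `S₀ = k`: the structure map identifies
`k` with `S₀`, and `S` is generated as a `k`-algebra by the finite-dimensional space `S₁`. -/
class IsStandardGraded {k S : Type*} [Field k] [CommRing S] [Algebra k S]
    (𝒜 : ℕ → Submodule k S) [GradedAlgebra 𝒜] : Prop where
  injective_algebraMap : Function.Injective (algebraMap k S)
  degree_zero : 𝒜 0 = LinearMap.range (Algebra.linearMap k S)
  finite_degree_one : Module.Finite k (𝒜 1)
  adjoin_degree_one : Algebra.adjoin k (𝒜 1 : Set S) = ⊤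

/-- The irrelevant ideal `S₊` of a standard graded algebra over a field is prime
(indeed maximal), so that one may localize at it. -/
instance IsStandardGraded.isPrime_irrelevant {k S : Type*} [Field k] [CommRing S] [Algebra k S]
    (𝒜 : ℕ → Submodule k S) [GradedAlgebra 𝒜] [h : IsStandardGraded 𝒜] :
    (HomogeneousIdeal.irrelevant 𝒜).toIdeal.IsPrime := by
  have hmem : ∀ x : S, x ∈ (HomogeneousIdeal.irrelevant 𝒜).toIdeal ↔
      GradedRing.projZeroRingHom 𝒜 x = 0 := fun x => Iff.rfl
  have hdeg : ∀ x : S, ∃ c : k, algebraMap k S c = GradedRing.projZeroRingHom 𝒜 x := by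
    intro x
    have : GradedRing.projZeroRingHom 𝒜 x ∈ 𝒜 0 := SetLike.coe_mem _
    rw [h.degree_zero] at this
    obtain ⟨c, hc⟩ := this
    exact ⟨c, hc⟩
  have hinj := h.injective_algebraMap
  refine ⟨?_, ?_⟩
  · intro htop
    have h1 := (hmem 1).1 (htop ▸ Submodule.mem_top)
    rw [map_one, ← map_one (algebraMap k S), ← map_zero (algebraMap k S)] at h1
    exact one_ne_zero (hinj h1)
  · intro x y hxy
    obtain ⟨a, ha⟩ := hdeg x
    obtain ⟨b, hb⟩ := hdeg y
    have h0 := (hmem _).1 hxy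
    rw [map_mul, ← ha, ← hb, ← map_mul, ← map_zero (algebraMap k S)] at h0
    rcases mul_eq_zero.1 (hinj h0) with h1 | h1
    · exact Or.inl ((hmem x).2 (by rw [← ha, h1, map_zero]))
    · exact Or.inr ((hmem y).2 (by rw [← hb, h1, map_zero]))

/-- The local ring `S_𝔫` of a standard graded algebra `S` at `𝔫 = S₊`. -/
abbrev LocalizationAtIrrelevant {k S : Type*} [Field k] [CommRing S] [Algebra k S]
    (𝒜 : ℕ → Submodule k S) [GradedAlgebra 𝒜] [IsStandardGraded 𝒜] : Type _ :=
  Localization.AtPrime (HomogeneousIdeal.irrelevant 𝒜).toIdeal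

/-- The zeroth local cohomology module `H⁰_𝔞(M)`: the elements of `M` killed by a power of `𝔞`. -/
def zerothLocalCohomology {R : Type*} [CommRing R] (𝔞 : Ideal R)
    (M : Type*) [AddCommGroup M] [Module R M] : Submodule R M where
  carrier := {x | ∃ t : ℕ, ∀ a ∈ 𝔞 ^ t, a • x = 0}
  zero_mem' := ⟨0, fun a _ => smul_zero a⟩
  add_mem' := by
    rintro x y ⟨s, hs⟩ ⟨t, ht⟩
    refine ⟨s + t, fun a ha => ?_⟩
    rw [smul_add, hs a (Ideal.pow_le_pow_right (Nat.le_add_right s t) ha),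
      ht a (Ideal.pow_le_pow_right (Nat.le_add_left t s) ha), add_zero]
  smul_mem' := by
    rintro c x ⟨t, ht⟩
    exact ⟨t, fun a ha => by rw [smul_comm, ht a ha, smul_zero]⟩

/-- `j` is the j-multiplicity `j(I)` of the ideal `I` of the local ring `(R, 𝔪)`, that is,
`R` has finite dimension `d > 0` and
`j = lim_{n → ∞} (d - 1)! / n ^ (d - 1) · length_R H⁰_𝔪(Iⁿ / Iⁿ⁺¹)`, the limit being taken
in `[0, ∞]`. -/
def HasJMultiplicity {R : Type*} [CommRing R] [IsLocalRing R] (I : Ideal R) (j : ℝ≥0∞) : Prop :=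
  ∃ d : ℕ, 0 < d ∧ ringKrullDim R = d ∧
    Tendsto (fun n : ℕ => ((d - 1)! : ℝ≥0∞) / (n : ℝ≥0∞) ^ (d - 1) *
      ((Module.length R (zerothLocalCohomology (IsLocalRing.maximalIdeal R)
        (↥(I ^ n) ⧸ (I ^ (n + 1)).submoduleOf (I ^ n))) : ℕ∞) : ℝ≥0∞)) atTop (𝓝 j)

/-- `e` is the multiplicity of the `R`-module `M` with respect to the ideal `𝔞`, that is,
`M` has finite dimension `δ` and `e = lim_{n → ∞} δ! / n ^ δ · length_R (M / 𝔞ⁿ M)`, the limit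
being taken in `[0, ∞]`. -/
def HasMultiplicity {R : Type*} [CommRing R] (𝔞 : Ideal R)
    (M : Type*) [AddCommGroup M] [Module R M] (e : ℝ≥0∞) : Prop :=
  ∃ δ : ℕ, Module.supportDim R M = δ ∧
    Tendsto (fun n : ℕ => (δ ! : ℝ≥0∞) / (n : ℝ≥0∞) ^ δ *
      ((Module.length R (M ⧸ (𝔞 ^ n • ⊤ : Submodule R M)) : ℕ∞) : ℝ≥0∞)) atTop (𝓝 e)

/-- The associated graded ring `gr_I(R) = ⨁ Iⁿ / Iⁿ⁺¹`, as the quotient `R[It] / I R[It]` of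
the Rees algebra. -/
def AssociatedGradedRing {R : Type*} [CommRing R] (I : Ideal R) : Type _ :=
  reesAlgebra I ⧸ I.map (algebraMap R (reesAlgebra I))

noncomputable instance AssociatedGradedRing.instCommRing {R : Type*} [CommRing R] (I : Ideal R) :
    CommRing (AssociatedGradedRing I) :=
  inferInstanceAs (CommRing (reesAlgebra I ⧸ I.map (algebraMap R (reesAlgebra I))))

noncomputable instance AssociatedGradedRing.instAlgebra {R : Type*} [CommRing R] (I : Ideal R) :
    Algebra R (AssociatedGradedRing I) :=
  inferInstanceAs (Algebra R (reesAlgebra I ⧸ I.map (algebraMap R (reesAlgebra I))))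

/-- The analytic spread `ℓ(I)` of an ideal `I` of a local ring `(R, 𝔪)`: the Krull dimension
of `gr_I(R) / 𝔪 gr_I(R)`. -/
noncomputable def analyticSpread {R : Type*} [CommRing R] [IsLocalRing R] (I : Ideal R) :
    WithBot ℕ∞ :=
  ringKrullDim (AssociatedGradedRing I ⧸
    (IsLocalRing.maximalIdeal R).map (algebraMap R (AssociatedGradedRing I)))

/-- The condition `G_s`: for every prime `P ⊇ J` of height less than `s`, the ideal `J S_P` has
a generating set with at most `height P` elements. -/
def SatisfiesG {S : Type*} [CommRing S] (J : Ideal S) (s : ℕ) : Prop :=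
  ∀ (P : Ideal S) [P.IsPrime], J ≤ P → P.height < s →
    Cardinal.toENat (J.map (algebraMap S (Localization.AtPrime P))).spanRank ≤ P.height

/-- Zariski-open subsets of a vector space: complements of the common zero loci of families of
polynomial functions (polynomials in linear forms). -/
def IsZariskiOpen {k V : Type*} [Field k] [AddCommGroup V] [Module k V] (U : Set V) : Prop :=
  ∃ F : Set (MvPolynomial (Module.Dual k V) k),
    U = {v | ∃ p ∈ F, MvPolynomial.eval (fun l : Module.Dual k V => l v) p ≠ 0}

/-- `Q v` holds for general `v ∈ V`: it holds on a nonempty Zariski-open subset of `V`. -/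
def HoldsForGeneral (k : Type*) {V : Type*} [Field k] [AddCommGroup V] [Module k V]
    (Q : V → Prop) : Prop :=
  ∃ U : Set V, IsZariskiOpen (k := k) U ∧ U.Nonempty ∧ ∀ v ∈ U, Q v

/-- The `k`-vector space of homogeneous elements of degree `r` in the ideal `J`. -/
abbrev degreePart {k S : Type*} [Field k] [CommRing S] [Algebra k S]
    (𝒜 : ℕ → Submodule k S) (J : Ideal S) (r : ℕ) : Submodule k S :=
  J.restrictScalars k ⊓ 𝒜 r

/-! Write d = δ + 1. Both sides are governed by one integer q, read off from the bigraded Hilbert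
function `reductionHilbert` of Jⁿ⁺¹ / 𝔣Jⁿ in degree r(n+1) + m.

Existence of q. General elements F₀, …, F_δ of degree r in J are filter-regular
(`exists_finset_isFilterRegularOn`), so adjoining one of them to 𝔣 takes a difference in n. After d
steps the function vanishes for large n, since otherwise dim Jⁿ⁺¹ in degree r(n+1) would outgrow the
Hilbert function of S, which is O(nᵟ). Hence with δ elements it is eventually a constant c(m), and
dim (Jⁿ⁺¹) in degree r(n+1) + m is asymptotic to c(m) nᵟ / δ!. The c(m) are bounded, and
multiplication by a general linear form makes them increase for large m, so c(m) = q for large m.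

The j-multiplicity. Let Γₙ ⊆ Jⁿ be the preimage of the 𝔫-torsion of Jⁿ / Jⁿ⁺¹ (`saturatedPower`). In
degree rn + m it is asymptotically as large as Jⁿ, and it agrees with Jⁿ⁺¹ from degree rn + M on,
with M independent of n. Since Jⁿ starts in degree rn and Jⁿ⁺¹ only in degree rn + r, comparing
dimensions up to a common cutoff leaves r surplus values of c(m), all equal to q. So j(I) = rq
(`tendsto_finrank_torsion`).

The multiplicity. By G_d and prime avoidance, J + (𝔣 : J) is 𝔫-primary for general 𝔣 with δ
generators (`exists_finset_hasResidualHeight`, `exists_irrelevant_pow_le_colon_sup`). If moreover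
Jⁿ⁺¹ = (𝔣, g)Jⁿ, multiplication by gⁿ⁺¹ identifies S / (𝔣 : J) with Jⁿ⁺¹ / 𝔣Jⁿ in large degrees
(`exists_degreePart_colon`). To reach a Zariski-open set of 𝔣, everything needed about F₀, …,
F_{δ-1} is reduced to four spanning conditions in single degrees, which are determinantal. These
bound the Hilbert function above by q, while the asymptotics of Jⁿ bound it below by q for every
such 𝔣 (`exists_holdsForGeneral_finrank_colon`). So S / (𝔣 : J) has eventual Hilbert function q,
dimension one and multiplicity q, provided q > 0.

Positivity. If q = 0, the determinant trick makes the fiber ring integral over δ elements, so ℓ(I) ≤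
δ, contrary to ℓ(I) = d (`analyticSpread_le_of_reductionHilbert_eq_zero`). -/

set_option linter.unusedSectionVars false

/-! ### Homogeneous components of ideals -/

section GradedIdeals

variable {k S : Type*} [Field k] [CommRing S] [Algebra k S]
  (𝒜 : ℕ → Submodule k S) [GradedAlgebra 𝒜]

/-- `J` is generated by homogeneous elements of degree `a`. -/
def GeneratedInDegree (J : Ideal S) (a : ℕ) : Prop :=
  ∃ X : Set S, X ⊆ (𝒜 a : Set S) ∧ J = Ideal.span X

variable {𝒜}

theorem mem_degreePart {J : Ideal S} {a : ℕ} {x : S} :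
    x ∈ degreePart 𝒜 J a ↔ x ∈ J ∧ x ∈ 𝒜 a := Iff.rfl

theorem degreePart_mono {I J : Ideal S} (h : I ≤ J) (a : ℕ) :
    degreePart 𝒜 I a ≤ degreePart 𝒜 J a := fun _ hx => ⟨h hx.1, hx.2⟩

theorem degreePart_le (J : Ideal S) (a : ℕ) : degreePart 𝒜 J a ≤ 𝒜 a := inf_le_right

theorem degreePart_top (a : ℕ) : degreePart 𝒜 ⊤ a = 𝒜 a := by
  ext x; simp

theorem degreePart_bot (a : ℕ) : degreePart 𝒜 ⊥ a = ⊥ := by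
  ext x
  simp only [mem_degreePart, Submodule.mem_bot]
  exact ⟨fun h => h.1, fun h => by simp [h]⟩

theorem coe_decompose_of_mem {a : ℕ} {x : S} (hx : x ∈ 𝒜 a) :
    (DirectSum.decompose 𝒜 x a : S) = x := DirectSum.decompose_of_mem_same 𝒜 hx

theorem decompose_mem_degreePart {J : Ideal S} (hJ : J.IsHomogeneous 𝒜) {x : S} (hx : x ∈ J)
    (a : ℕ) : (DirectSum.decompose 𝒜 x a : S) ∈ degreePart 𝒜 J a :=
  ⟨hJ a hx, SetLike.coe_mem _⟩

theorem GeneratedInDegree.isHomogeneous {J : Ideal S} {a : ℕ} (h : GeneratedInDegree 𝒜 J a) :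
    J.IsHomogeneous 𝒜 := by
  obtain ⟨X, hX, rfl⟩ := h
  exact Ideal.homogeneous_span 𝒜 X fun x hx => ⟨a, hX hx⟩

theorem GeneratedInDegree.span_degreePart {J : Ideal S} {a : ℕ} (h : GeneratedInDegree 𝒜 J a) :
    Ideal.span (degreePart 𝒜 J a : Set S) = J := by
  refine le_antisymm (Ideal.span_le.2 fun x hx => hx.1) ?_
  obtain ⟨X, hX, rfl⟩ := h
  exact Ideal.span_mono fun x hx => ⟨Ideal.subset_span hx, hX hx⟩

open scoped Pointwise in
theorem GeneratedInDegree.mul {I J : Ideal S} {a b : ℕ} (hI : GeneratedInDegree 𝒜 I a)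
    (hJ : GeneratedInDegree 𝒜 J b) : GeneratedInDegree 𝒜 (I * J) (a + b) := by
  obtain ⟨X, hX, rfl⟩ := hI
  obtain ⟨Y, hY, rfl⟩ := hJ
  refine ⟨X * Y, ?_, Ideal.span_mul_span' X Y⟩
  rintro _ ⟨x, hx, y, hy, rfl⟩
  exact SetLike.mul_mem_graded (hX hx) (hY hy)

theorem generatedInDegree_top : GeneratedInDegree 𝒜 (⊤ : Ideal S) 0 :=
  ⟨{1}, by simpa using SetLike.GradedOne.one_mem, by simp⟩

theorem GeneratedInDegree.pow {J : Ideal S} {a : ℕ} (hJ : GeneratedInDegree 𝒜 J a) (n : ℕ) :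
    GeneratedInDegree 𝒜 (J ^ n) (a * n) := by
  induction n with
  | zero => simpa using generatedInDegree_top (𝒜 := 𝒜)
  | succ n ih => rw [pow_succ, mul_add, mul_one]; exact ih.mul hJ

theorem mul_degreePart_le {I J : Ideal S} {a b : ℕ} :
    degreePart 𝒜 I a * degreePart 𝒜 J b ≤ degreePart 𝒜 (I * J) (a + b) :=
  Submodule.mul_le.2 fun _ hx _ hy =>
    ⟨Ideal.mul_mem_mul hx.1 hy.1, SetLike.mul_mem_graded hx.2 hy.2⟩

/-- In a product of an element of I and one of J, coefficients of the degree-a generators of I can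
be moved into the factor from J; then only the degree-b component of that factor contributes. -/
theorem GeneratedInDegree.degreePart_mul {I J : Ideal S} {a : ℕ} (hI : GeneratedInDegree 𝒜 I a)
    (hJ : J.IsHomogeneous 𝒜) (b : ℕ) :
    degreePart 𝒜 (I * J) (a + b) = degreePart 𝒜 I a * degreePart 𝒜 J b := by
  refine le_antisymm ?_ mul_degreePart_le
  have key : ∀ x ∈ I * J, (DirectSum.decompose 𝒜 x (a + b) : S) ∈
      degreePart 𝒜 I a * degreePart 𝒜 J b := by
    intro x hx
    refine Submodule.mul_induction_on hx ?_ ?_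
    · intro u hu w hw
      have hu' := hu
      rw [← hI.span_degreePart] at hu'
      revert w
      refine Submodule.span_induction ?_ ?_ ?_ ?_ hu'
      · intro x hx w hw
        rw [DirectSum.coe_decompose_mul_add_of_left_mem 𝒜 hx.2]
        exact Submodule.mul_mem_mul hx (decompose_mem_degreePart hJ hw b)
      · intro w _; simp
      · intro x y _ _ hx hy w hw
        rw [add_mul, DirectSum.decompose_add]
        exact add_mem (hx w hw) (hy w hw)
      · intro s x _ hx w hw
        rw [smul_eq_mul, mul_comm s, mul_assoc]
        exact hx _ (J.mul_mem_left s hw)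
    · intro x y hx hy
      rw [DirectSum.decompose_add]
      exact add_mem hx hy
  intro x hx
  rw [← coe_decompose_of_mem hx.2]
  exact key x hx.1

theorem GeneratedInDegree.degreePart_add {I : Ideal S} {a : ℕ} (hI : GeneratedInDegree 𝒜 I a)
    (b : ℕ) : degreePart 𝒜 I (a + b) = degreePart 𝒜 I a * 𝒜 b := by
  have := hI.degreePart_mul (Ideal.IsHomogeneous.top 𝒜) b
  rwa [Ideal.mul_top, degreePart_top] at this

theorem GeneratedInDegree.degreePart_eq_bot {I : Ideal S} {a : ℕ} (hI : GeneratedInDegree 𝒜 I a)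
    {e : ℕ} (he : e < a) : degreePart 𝒜 I e = ⊥ := by
  rw [eq_bot_iff]
  have key : ∀ x ∈ I, (DirectSum.decompose 𝒜 x e : S) = 0 := by
    intro x hx
    rw [← hI.span_degreePart] at hx
    refine Submodule.closure_induction ?_ ?_ ?_ hx
    · simp
    · intro x y _ _ hx hy
      rw [DirectSum.decompose_add, DirectSum.add_apply, Submodule.coe_add, hx, hy, add_zero]
    · intro s x hx
      rw [smul_eq_mul, mul_comm,
        DirectSum.coe_decompose_mul_of_left_mem_of_not_le 𝒜 hx.2 (not_le.2 he)]
  intro x hx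
  rw [← coe_decompose_of_mem hx.2, key x hx.1]
  exact Submodule.zero_mem _

theorem exists_add_mul_of_mem_sup {𝔲 𝔶 : Ideal S} (hu : 𝔲.IsHomogeneous 𝒜)
    (hy : 𝔶.IsHomogeneous 𝒜) {f : S} {r e : ℕ} (hf : f ∈ 𝒜 r) {x : S}
    (hx : x ∈ 𝔲 ⊔ Ideal.span {f} * 𝔶) (hxe : x ∈ 𝒜 (r + e)) :
    ∃ u ∈ degreePart 𝒜 𝔲 (r + e), ∃ y ∈ degreePart 𝒜 𝔶 e, x = u + f * y := by
  obtain ⟨u, hu', v, hv, rfl⟩ := Submodule.mem_sup.1 hx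
  obtain ⟨y, hy', rfl⟩ := Ideal.mem_span_singleton_mul.1 hv
  refine ⟨_, decompose_mem_degreePart hu hu' (r + e), _, decompose_mem_degreePart hy hy' e, ?_⟩
  rw [← DirectSum.coe_decompose_mul_add_of_left_mem 𝒜 hf, ← coe_decompose_of_mem hxe,
    DirectSum.decompose_add]
  simp

/-- The elements of large degree of a homogeneous ideal of a Noetherian graded ring are linear
combinations of generators with coefficients of large degree. -/
theorem exists_degreePart_le_mul [IsNoetherianRing S] {L : Ideal S} {𝔮 : Ideal S} {t : ℕ}
    (h𝔮 : ∀ m, t ≤ m → ∀ x ∈ 𝒜 m, x ∈ 𝔮) :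
    ∃ D, ∀ m, D ≤ m → ∀ x ∈ degreePart 𝒜 L m, x ∈ 𝔮 * L := by
  -- The ideals generated by the components of L of degree at most D stabilize. Beyond the stable D,
  -- every element of degree at least D + t has coefficients of degree at least t, hence in 𝔮.
  let F : ℕ →o Ideal S :=
    ⟨fun D => Ideal.span {x | ∃ e ≤ D, x ∈ degreePart 𝒜 L e}, fun D D' h =>
      Ideal.span_mono fun x ⟨e, he, hx⟩ => ⟨e, he.trans h, hx⟩⟩
  obtain ⟨D, hD⟩ := WellFoundedGT.monotone_chain_condition F
  have key : ∀ x ∈ F D, ∀ m, D + t ≤ m → (DirectSum.decompose 𝒜 x m : S) ∈ 𝔮 * L := by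
    intro x hx m hm
    refine Submodule.closure_induction ?_ ?_ ?_ hx
    · simp
    · intro x y _ _ hx hy
      rw [DirectSum.decompose_add]
      exact add_mem hx hy
    · rintro s x ⟨e, he, hx⟩
      rw [smul_eq_mul, DirectSum.coe_decompose_mul_of_right_mem_of_le 𝒜 hx.2 (by omega)]
      exact Ideal.mul_mem_mul (h𝔮 _ (by omega) _ (SetLike.coe_mem _)) hx.1
  refine ⟨D + t, fun m hm x hx => ?_⟩
  rw [← coe_decompose_of_mem hx.2]
  refine key x ?_ m hm
  rw [hD (max D m) (le_max_left _ _)]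
  exact Ideal.subset_span ⟨m, le_max_right _ _, hx⟩

/-- The colon can be tested on generators of degree a, and multiplication by these shifts components
by a. -/
theorem isHomogeneous_colon {I J : Ideal S} (hI : I.IsHomogeneous 𝒜) {a : ℕ}
    (hJ : GeneratedInDegree 𝒜 J a) : (I.colon (J : Set S)).IsHomogeneous 𝒜 := by
  obtain ⟨X, hX, rfl⟩ := hJ
  rw [Ideal.colon_span]
  intro i x hx
  rw [Submodule.mem_colon] at hx ⊢
  intro y hy
  have h := hI (i + a) (hx y hy)
  rwa [smul_eq_mul, DirectSum.coe_decompose_mul_add_of_right_mem 𝒜 (hX hy)] at h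

end GradedIdeals

/-! ### Graded pieces of a standard graded algebra -/

section StandardGraded

variable {k S : Type*} [Field k] [CommRing S] [Algebra k S]
  (𝒜 : ℕ → Submodule k S) [GradedAlgebra 𝒜] [IsStandardGraded 𝒜]

theorem pow_degree_le (n : ℕ) : (𝒜 1) ^ n ≤ 𝒜 n := by
  induction n with
  | zero =>
    rw [pow_zero, Submodule.one_le]
    exact SetLike.GradedOne.one_mem
  | succ n ih =>
    rw [pow_succ]
    exact Submodule.mul_le.2 fun x hx y hy => SetLike.mul_mem_graded (ih hx) hy

theorem degree_eq_pow (n : ℕ) : 𝒜 n = (𝒜 1) ^ n := by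
  refine le_antisymm ?_ (pow_degree_le 𝒜 n)
  have key : ∀ x : S, (DirectSum.decompose 𝒜 x n : S) ∈ (𝒜 1) ^ n := by
    intro x
    have hx : x ∈ Subalgebra.toSubmodule (Algebra.adjoin k (𝒜 1 : Set S)) := by
      rw [IsStandardGraded.adjoin_degree_one]; trivial
    rw [Algebra.adjoin_eq_span] at hx
    refine Submodule.span_induction ?_ ?_ ?_ ?_ hx
    · intro x hx
      have : ∃ i, x ∈ (𝒜 1) ^ i := by
        refine Submonoid.closure_induction ?_ ?_ ?_ hx
        · intro x hx; exact ⟨1, by simpa using hx⟩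
        · exact ⟨0, by rw [pow_zero]; exact Submodule.one_le.1 le_rfl⟩
        · rintro x y _ _ ⟨i, hi⟩ ⟨j, hj⟩
          exact ⟨i + j, by rw [pow_add]; exact Submodule.mul_mem_mul hi hj⟩
      obtain ⟨i, hi⟩ := this
      by_cases h : i = n
      · subst h; rwa [coe_decompose_of_mem (pow_degree_le 𝒜 _ hi)]
      · rw [DirectSum.decompose_of_mem_ne 𝒜 (pow_degree_le 𝒜 _ hi) h]; exact zero_mem _
    · simp
    · intro x y _ _ hx hy
      rw [DirectSum.decompose_add]; exact add_mem hx hy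
    · intro c x _ hx
      rw [DirectSum.decompose_smul]; exact Submodule.smul_mem _ c hx
  intro x hx
  rw [← coe_decompose_of_mem hx]
  exact key x

theorem degree_add (m n : ℕ) : 𝒜 (m + n) = 𝒜 m * 𝒜 n := by
  rw [degree_eq_pow 𝒜 (m + n), pow_add, ← degree_eq_pow, ← degree_eq_pow]

instance finite_degree (n : ℕ) : Module.Finite k (𝒜 n) := by
  rw [degree_eq_pow 𝒜, Module.Finite.iff_fg]
  exact Submodule.FG.pow (Module.Finite.iff_fg.1 IsStandardGraded.finite_degree_one) n

instance finite_degreePart (J : Ideal S) (n : ℕ) : Module.Finite k (degreePart 𝒜 J n) :=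
  Submodule.finiteDimensional_of_le (degreePart_le J n)

theorem finiteType_of_isStandardGraded (𝒜 : ℕ → Submodule k S) [GradedAlgebra 𝒜]
    [IsStandardGraded 𝒜] : Algebra.FiniteType k S := by
  obtain ⟨s, hs⟩ := Module.Finite.iff_fg.1 (IsStandardGraded.finite_degree_one (𝒜 := 𝒜))
  refine ⟨⟨s, ?_⟩⟩
  rw [eq_top_iff, ← IsStandardGraded.adjoin_degree_one (𝒜 := 𝒜), ← hs]
  exact Algebra.adjoin_le (Algebra.span_le_adjoin k _)

end StandardGraded

/-! ### Hilbert functions of Jⁿ⁺¹ / 𝔣Jⁿ -/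

section MulFinrank

variable {k S : Type*} [Field k] [CommRing S] [Algebra k S]

/-- Multiplication by `f` maps `H` onto `D' / D` with kernel `{x ∈ H | f x ∈ D}`. -/
theorem finrank_add_finrank_eq_of_eq_sup_mul {H C D D' : Submodule k S} [Module.Finite k H]
    [Module.Finite k D'] {f : S} (hD : D ≤ D') (hD' : D' ≤ D ⊔ H.map (LinearMap.mulLeft k f))
    (hH : H.map (LinearMap.mulLeft k f) ≤ D') (hC : C = H ⊓ D.comap (LinearMap.mulLeft k f)) :
    Module.finrank k D' + Module.finrank k C = Module.finrank k D + Module.finrank k H := by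
  have hDf : Module.Finite k D := Submodule.finiteDimensional_of_le hD
  let mulMap : H →ₗ[k] D' := (LinearMap.mulLeft k f).restrict fun x hx => hH ⟨x, hx, rfl⟩
  let quotMap : H →ₗ[k] D' ⧸ D.submoduleOf D' := (D.submoduleOf D').mkQ.comp mulMap
  have hsurj : LinearMap.range quotMap = ⊤ := by
    rw [LinearMap.range_eq_top]
    intro q
    obtain ⟨⟨y, hy⟩, rfl⟩ := Submodule.mkQ_surjective _ q
    obtain ⟨u, hu, _, ⟨x, hx, rfl⟩, rfl⟩ := Submodule.mem_sup.1 (hD' hy)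
    refine ⟨⟨x, hx⟩, ?_⟩
    rw [← sub_eq_zero]
    change (D.submoduleOf D').mkQ _ - (D.submoduleOf D').mkQ _ = 0
    rw [← map_sub, Submodule.mkQ_apply, Submodule.Quotient.mk_eq_zero]
    change f * x - (u + f * x) ∈ D
    simpa using hu
  have hker : LinearMap.ker quotMap = C.submoduleOf H := by
    ext ⟨x, hx⟩
    rw [LinearMap.mem_ker]
    change (D.submoduleOf D').mkQ _ = 0 ↔ x ∈ C
    rw [Submodule.mkQ_apply, Submodule.Quotient.mk_eq_zero, hC]
    change f * x ∈ D ↔ _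
    simp [hx]
  have h1 := LinearMap.finrank_range_add_finrank_ker quotMap
  rw [hsurj, finrank_top, hker] at h1
  have h2 := Submodule.finrank_quotient_add_finrank (D.submoduleOf D')
  have h3 : Module.finrank k (D.submoduleOf D') = Module.finrank k D :=
    (Submodule.submoduleOfEquivOfLe hD).finrank_eq
  have h4 : Module.finrank k (C.submoduleOf H) = Module.finrank k C :=
    (Submodule.submoduleOfEquivOfLe (hC ▸ inf_le_left)).finrank_eq
  omega

end MulFinrank

section ReductionHilbert

variable {k S : Type*} [Field k] [CommRing S] [Algebra k S]
  (𝒜 : ℕ → Submodule k S) [GradedAlgebra 𝒜]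

/-- The Hilbert function of `Jⁿ⁺¹ / 𝔣 Jⁿ`, for `J` generated in degree `r`. -/
noncomputable def reductionHilbert (J : Ideal S) (r : ℕ) (𝔣 : Ideal S) (m n : ℕ) : ℕ :=
  Module.finrank k (degreePart 𝒜 (J ^ (n + 1)) (r * (n + 1) + m)) -
    Module.finrank k (degreePart 𝒜 (𝔣 * J ^ n) (r * (n + 1) + m))

/-- Multiplication by `f` on `⨁ Jⁿ⁺¹ / 𝔣 Jⁿ` is injective in large degrees. -/
def IsFilterRegularOn (J 𝔣 : Ideal S) (f : S) : Prop :=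
  ∃ n₀, ∀ n, n₀ ≤ n → ∀ x ∈ J ^ (n + 1), f * x ∈ 𝔣 * J ^ (n + 1) → x ∈ 𝔣 * J ^ n

variable [IsStandardGraded 𝒜] {J 𝔣 : Ideal S} {r : ℕ}

theorem finrank_degreePart_mono {I J : Ideal S} (h : I ≤ J) (e : ℕ) :
    Module.finrank k (degreePart 𝒜 I e) ≤ Module.finrank k (degreePart 𝒜 J e) :=
  Submodule.finrank_mono (degreePart_mono h e)

theorem mul_pow_le_pow_succ (h : 𝔣 ≤ J) (n : ℕ) : 𝔣 * J ^ n ≤ J ^ (n + 1) := by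
  rw [pow_succ']; exact Ideal.mul_mono_left h

theorem reductionHilbert_add (h : 𝔣 ≤ J) (m n : ℕ) :
    reductionHilbert 𝒜 J r 𝔣 m n +
      Module.finrank k (degreePart 𝒜 (𝔣 * J ^ n) (r * (n + 1) + m)) =
    Module.finrank k (degreePart 𝒜 (J ^ (n + 1)) (r * (n + 1) + m)) :=
  Nat.sub_add_cancel (finrank_degreePart_mono 𝒜 (mul_pow_le_pow_succ h n) _)

/-- Multiplication by f maps Jⁿ⁺¹ onto (𝔣, f)Jⁿ⁺¹ / 𝔣Jⁿ⁺¹; the intersection with the comap is its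
kernel. -/
theorem finrank_sup_span_mul (hJ : GeneratedInDegree 𝒜 J r) (h𝔣 : 𝔣.IsHomogeneous 𝒜)
    {f : S} (hf : f ∈ degreePart 𝒜 J r) (m n : ℕ) :
    Module.finrank k (degreePart 𝒜 ((𝔣 ⊔ Ideal.span {f}) * J ^ (n + 1)) (r * (n + 1 + 1) + m)) +
      Module.finrank k (degreePart 𝒜 (J ^ (n + 1)) (r * (n + 1) + m) ⊓
        (degreePart 𝒜 (𝔣 * J ^ (n + 1)) (r * (n + 1 + 1) + m)).comap (LinearMap.mulLeft k f) :
          Submodule k S) =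
    Module.finrank k (degreePart 𝒜 (𝔣 * J ^ (n + 1)) (r * (n + 1 + 1) + m)) +
      Module.finrank k (degreePart 𝒜 (J ^ (n + 1)) (r * (n + 1) + m)) := by
  have hdeg : r * (n + 1 + 1) + m = r + (r * (n + 1) + m) := by ring
  refine finrank_add_finrank_eq_of_eq_sup_mul (f := f) ?_ ?_ ?_ rfl
  · exact degreePart_mono (Ideal.mul_mono_left le_sup_left) _
  · rintro x ⟨hx, hxe⟩
    rw [Ideal.sup_mul] at hx
    rw [hdeg] at hxe ⊢
    obtain ⟨u, hu, y, hy, rfl⟩ := exists_add_mul_of_mem_sup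
      (h𝔣.mul (hJ.pow (n + 1)).isHomogeneous) (hJ.pow (n + 1)).isHomogeneous hf.2 hx hxe
    exact add_mem (Submodule.mem_sup_left hu) (Submodule.mem_sup_right ⟨y, hy, rfl⟩)
  · rintro _ ⟨y, hy, rfl⟩
    refine ⟨Ideal.mul_mem_mul (Ideal.mem_sup_right (Ideal.mem_span_singleton_self f)) hy.1, ?_⟩
    rw [hdeg]
    exact SetLike.mul_mem_graded hf.2 hy.2

theorem mul_mem_degreePart_succ {f : S} (hf : f ∈ degreePart 𝒜 J r) {m n : ℕ} {x : S}
    (hx : x ∈ degreePart 𝒜 (𝔣 * J ^ n) (r * (n + 1) + m)) :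
    f * x ∈ degreePart 𝒜 (𝔣 * J ^ (n + 1)) (r * (n + 1 + 1) + m) := by
  constructor
  · have := Ideal.mul_mem_mul hf.1 hx.1
    rwa [mul_left_comm, ← pow_succ'] at this
  · have := SetLike.mul_mem_graded hf.2 hx.2
    have e : r * (n + 1 + 1) + m = r + (r * (n + 1) + m) := by ring
    rwa [e]

/-- The kernel of multiplication by f from Jⁿ⁺¹ to Jⁿ⁺² / 𝔣Jⁿ⁺¹ always contains 𝔣Jⁿ, which gives the
inequality for an arbitrary f. Equality needs the two to coincide, which is filter-regularity. -/
theorem reductionHilbert_succ_le (hJ : GeneratedInDegree 𝒜 J r) (h𝔣 : 𝔣.IsHomogeneous 𝒜)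
    (h : 𝔣 ≤ J) {f : S} (hf : f ∈ degreePart 𝒜 J r) (m n : ℕ) :
    reductionHilbert 𝒜 J r 𝔣 m (n + 1) ≤
      reductionHilbert 𝒜 J r (𝔣 ⊔ Ideal.span {f}) m (n + 1) + reductionHilbert 𝒜 J r 𝔣 m n := by
  have hle : 𝔣 ⊔ Ideal.span {f} ≤ J := sup_le h ((Ideal.span_singleton_le_iff_mem _).2 hf.1)
  have h1 := reductionHilbert_add 𝒜 (r := r) h m n
  have h2 := reductionHilbert_add 𝒜 (r := r) h m (n + 1)
  have h3 := reductionHilbert_add 𝒜 (r := r) hle m (n + 1)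
  have h4 := finrank_sup_span_mul 𝒜 hJ h𝔣 hf m n
  have h5 : Module.finrank k (degreePart 𝒜 (𝔣 * J ^ n) (r * (n + 1) + m)) ≤
      Module.finrank k (degreePart 𝒜 (J ^ (n + 1)) (r * (n + 1) + m) ⊓
        (degreePart 𝒜 (𝔣 * J ^ (n + 1)) (r * (n + 1 + 1) + m)).comap (LinearMap.mulLeft k f) :
          Submodule k S) := by
    have : Module.Finite k (degreePart 𝒜 (J ^ (n + 1)) (r * (n + 1) + m) ⊓
        (degreePart 𝒜 (𝔣 * J ^ (n + 1)) (r * (n + 1 + 1) + m)).comap (LinearMap.mulLeft k f) :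
          Submodule k S) := Submodule.finiteDimensional_of_le inf_le_left
    refine Submodule.finrank_mono (le_inf (degreePart_mono (mul_pow_le_pow_succ h n) _) ?_)
    exact fun x hx => mul_mem_degreePart_succ 𝒜 hf hx
  omega

theorem reductionHilbert_succ_eq (hJ : GeneratedInDegree 𝒜 J r) (h𝔣 : 𝔣.IsHomogeneous 𝒜)
    (h : 𝔣 ≤ J) {f : S} (hf : f ∈ degreePart 𝒜 J r) {n : ℕ}
    (hreg : ∀ x ∈ J ^ (n + 1), f * x ∈ 𝔣 * J ^ (n + 1) → x ∈ 𝔣 * J ^ n) (m : ℕ) :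
    reductionHilbert 𝒜 J r 𝔣 m (n + 1) =
      reductionHilbert 𝒜 J r (𝔣 ⊔ Ideal.span {f}) m (n + 1) + reductionHilbert 𝒜 J r 𝔣 m n := by
  have hle : 𝔣 ⊔ Ideal.span {f} ≤ J := sup_le h ((Ideal.span_singleton_le_iff_mem _).2 hf.1)
  have h1 := reductionHilbert_add 𝒜 (r := r) h m n
  have h2 := reductionHilbert_add 𝒜 (r := r) h m (n + 1)
  have h3 := reductionHilbert_add 𝒜 (r := r) hle m (n + 1)
  have h4 := finrank_sup_span_mul 𝒜 hJ h𝔣 hf m n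
  have h5 : degreePart 𝒜 (J ^ (n + 1)) (r * (n + 1) + m) ⊓
        (degreePart 𝒜 (𝔣 * J ^ (n + 1)) (r * (n + 1 + 1) + m)).comap (LinearMap.mulLeft k f) =
      degreePart 𝒜 (𝔣 * J ^ n) (r * (n + 1) + m) := by
    refine le_antisymm ?_ (le_inf (degreePart_mono (mul_pow_le_pow_succ h n) _)
      fun x hx => mul_mem_degreePart_succ 𝒜 hf hx)
    rintro x ⟨hx, hfx⟩
    exact ⟨hreg x hx.1 hfx.1, hx.2⟩
  rw [h5] at h4
  omega

end ReductionHilbert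

/-! ### Iterated differences and polynomial growth -/

section DifferenceChains

theorem sum_range_choose_succ (n j : ℕ) :
    ∑ i ∈ Finset.range n, i.choose j = n.choose (j + 1) := by
  induction n with
  | zero => simp
  | succ n ih => rw [Finset.sum_range_succ, ih, Nat.choose_succ_succ', add_comm]

theorem sum_choose_weights_succ (q s n : ℕ) (w : ℕ → ℕ) (b : ℕ) :
    b + ∑ i ∈ Finset.range n, (q * i.choose s + ∑ j ∈ Finset.range s, w j * i.choose j) =
      q * n.choose (s + 1) +
        ∑ j ∈ Finset.range (s + 1), (if j = 0 then b else w (j - 1)) * n.choose j := by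
  rw [Finset.sum_add_distrib, ← Finset.mul_sum, sum_range_choose_succ, Finset.sum_comm,
    Finset.sum_range_succ' _ s]
  simp only [← Finset.mul_sum, sum_range_choose_succ]
  simp
  ring

/-- Repeated summation: each function in the chain is at most its initial value plus the sum of the
next one. The weights w collect the initial values and affect only terms of lower order. -/
theorem le_choose_of_succ_le {s q : ℕ} {a : ℕ → ℕ → ℕ} {n₁ : ℕ}
    (h : ∀ i < s, ∀ n, n₁ ≤ n → a i (n + 1) ≤ a (i + 1) (n + 1) + a i n)
    (hs : ∀ n, n₁ ≤ n → a s n ≤ q) :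
    ∃ w : ℕ → ℕ, ∀ n, a 0 (n₁ + n) ≤ q * n.choose s +
      ∑ j ∈ Finset.range s, w j * n.choose j := by
  induction s generalizing a n₁ with
  | zero => exact ⟨0, fun n => by simpa using hs _ (Nat.le_add_right _ _)⟩
  | succ s ih =>
    obtain ⟨w, hw⟩ := ih (a := fun i => a (i + 1)) (n₁ := n₁ + 1)
      (fun i hi n hn => h (i + 1) (by omega) n (by omega)) (fun n hn => hs n (by omega))
    refine ⟨fun j => if j = 0 then a 0 n₁ else w (j - 1), fun n => ?_⟩
    rw [← sum_choose_weights_succ]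
    induction n with
    | zero => simp
    | succ n ihn =>
      rw [Finset.sum_range_succ]
      have h1 := h 0 (by omega) (n₁ + n) (by omega)
      have h2 := hw n
      rw [show n₁ + 1 + n = n₁ + n + 1 by ring] at h2
      simp only [zero_add] at h1 h2
      rw [← add_assoc n₁]
      omega

/-- The summation argument in the other direction; the initial values are nonnegative and are simply
dropped. -/
theorem choose_le_of_le_succ {s q : ℕ} {a : ℕ → ℕ → ℕ} {n₁ : ℕ}
    (h : ∀ i < s, ∀ n, n₁ ≤ n → a (i + 1) (n + 1) + a i n ≤ a i (n + 1))
    (hs : ∀ n, n₁ ≤ n → q ≤ a s n) (n : ℕ) : q * n.choose s ≤ a 0 (n₁ + n) := by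
  induction s generalizing a n₁ n with
  | zero => simpa using hs _ (Nat.le_add_right _ _)
  | succ s ih =>
    have hw := ih (a := fun i => a (i + 1)) (n₁ := n₁ + 1)
      (fun i hi n hn => h (i + 1) (by omega) n (by omega)) (fun n hn => hs n (by omega))
    induction n with
    | zero => simp
    | succ n ihn =>
      have h1 := h 0 (by omega) (n₁ + n) (by omega)
      have h2 := hw n
      rw [show n₁ + 1 + n = n₁ + n + 1 by ring] at h2
      simp only [zero_add] at h1 h2
      rw [← add_assoc n₁, Nat.choose_succ_succ', mul_add]
      omega

theorem tendsto_choose_div_pow (s : ℕ) :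
    Tendsto (fun n : ℕ => (n.choose s : ℝ) / (n : ℝ) ^ s) atTop (𝓝 (1 / (s ! : ℝ))) := by
  have h := (Asymptotics.isEquivalent_iff_tendsto_one ?_).1 (isEquivalent_choose s)
  · have h2 := h.mul_const (1 / (s ! : ℝ))
    rw [one_mul] at h2
    refine h2.congr fun n => ?_
    have : (s ! : ℝ) ≠ 0 := by positivity
    simp only [Pi.div_apply]
    field_simp
  · filter_upwards [eventually_gt_atTop 0] with n hn
    positivity

theorem tendsto_choose_div_pow_of_lt {j s : ℕ} (hjs : j < s) :
    Tendsto (fun n : ℕ => (n.choose j : ℝ) / (n : ℝ) ^ s) atTop (𝓝 0) := by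
  have h := (tendsto_choose_div_pow j).mul
    ((tendsto_pow_atTop (α := ℝ) (n := s - j) (by omega)).comp
      tendsto_natCast_atTop_atTop).inv_tendsto_atTop
  rw [mul_zero] at h
  refine h.congr' ?_
  filter_upwards [eventually_gt_atTop 0] with n hn
  have hn' : (n : ℝ) ≠ 0 := by positivity
  simp only [Pi.inv_apply, Function.comp_apply]
  rw [← div_eq_mul_inv, div_div, ← pow_add, Nat.add_sub_cancel' hjs.le]

theorem tendsto_add_pow_div_pow (n₁ s : ℕ) :
    Tendsto (fun n : ℕ => (n : ℝ) ^ s / ((n₁ + n : ℕ) : ℝ) ^ s) atTop (𝓝 1) := by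
  have h := (tendsto_natCast_div_add_atTop (n₁ : ℝ)).pow s
  rw [one_pow] at h
  refine h.congr fun n => ?_
  push_cast
  rw [div_pow, add_comm]

theorem tendsto_choose_sum_div_pow (q s n₁ : ℕ) (w : ℕ → ℕ) :
    Tendsto (fun n : ℕ => ((q * n.choose s + ∑ j ∈ Finset.range s, w j * n.choose j : ℕ) : ℝ) /
      ((n₁ + n : ℕ) : ℝ) ^ s) atTop (𝓝 (q / (s ! : ℝ))) := by
  have h1 : Tendsto (fun n : ℕ => (q : ℝ) * ((n.choose s : ℝ) / (n : ℝ) ^ s) +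
      ∑ j ∈ Finset.range s, (w j : ℝ) * ((n.choose j : ℝ) / (n : ℝ) ^ s)) atTop
      (𝓝 ((q : ℝ) * (1 / (s ! : ℝ)) + ∑ j ∈ Finset.range s, (w j : ℝ) * 0)) :=
    ((tendsto_choose_div_pow s).const_mul _).add (tendsto_finsetSum _ fun j hj =>
      (tendsto_choose_div_pow_of_lt (Finset.mem_range.1 hj)).const_mul _)
  have h2 := h1.mul (tendsto_add_pow_div_pow n₁ s)
  simp only [mul_zero, Finset.sum_const_zero, add_zero, mul_one, mul_one_div] at h2
  refine h2.congr' ?_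
  filter_upwards [eventually_gt_atTop 0] with n hn
  have hn' : (n : ℝ) ^ s ≠ 0 := by positivity
  have hn'' : ((n₁ + n : ℕ) : ℝ) ^ s ≠ 0 := by positivity
  push_cast
  simp only [mul_div_assoc', ← Finset.sum_div, ← add_div]
  field_simp

theorem tendsto_div_pow_of_choose_bounds {s q n₁ n₂ : ℕ} {a w : ℕ → ℕ}
    (hu : ∀ n, a (n₁ + n) ≤ q * n.choose s + ∑ j ∈ Finset.range s, w j * n.choose j)
    (hl : ∀ n, q * n.choose s ≤ a (n₂ + n)) :
    Tendsto (fun n : ℕ => (a n : ℝ) / (n : ℝ) ^ s) atTop (𝓝 (q / (s ! : ℝ))) := by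
  have shift : ∀ (N : ℕ) (u : ℕ → ℝ) (l : ℝ), Tendsto (fun n => u (N + n)) atTop (𝓝 l) →
      Tendsto u atTop (𝓝 l) := fun N u l h => by
    rw [← tendsto_add_atTop_iff_nat N]
    exact h.congr fun n => by rw [add_comm]
  have hU := shift n₁ (fun n => ((q * (n - n₁).choose s +
    ∑ j ∈ Finset.range s, w j * (n - n₁).choose j : ℕ) : ℝ) / (n : ℝ) ^ s) _ (by
      simpa only [Nat.add_sub_cancel_left] using tendsto_choose_sum_div_pow q s n₁ w)
  have hL := shift n₂ (fun n => ((q * (n - n₂).choose s +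
    ∑ j ∈ Finset.range s, (0 : ℕ → ℕ) j * (n - n₂).choose j : ℕ) : ℝ) / (n : ℝ) ^ s) _ (by
      simpa only [Nat.add_sub_cancel_left] using tendsto_choose_sum_div_pow q s n₂ 0)
  refine tendsto_of_tendsto_of_tendsto_of_le_of_le' hL hU ?_ ?_
  · filter_upwards [eventually_ge_atTop n₂] with n hn
    have := hl (n - n₂)
    rw [Nat.add_sub_cancel' hn] at this
    simp only [Pi.zero_apply, zero_mul, Finset.sum_const_zero, add_zero]
    gcongr
  · filter_upwards [eventually_ge_atTop n₁] with n hn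
    have := hu (n - n₁)
    rw [Nat.add_sub_cancel' hn] at this
    gcongr

theorem le_of_tendsto_div_pow_of_le_choose {s q c n₁ : ℕ} {a w : ℕ → ℕ}
    (hu : ∀ n, a (n₁ + n) ≤ q * n.choose s + ∑ j ∈ Finset.range s, w j * n.choose j)
    (hc : Tendsto (fun n : ℕ => (a n : ℝ) / (n : ℝ) ^ s) atTop (𝓝 (c / (s ! : ℝ)))) : c ≤ q := by
  have h1 := (tendsto_add_atTop_iff_nat n₁).2 hc
  have h2 := le_of_tendsto_of_tendsto' h1 (tendsto_choose_sum_div_pow q s n₁ w) fun n => by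
    rw [add_comm n n₁]
    have := hu n
    gcongr
  have : (0 : ℝ) < s ! := by positivity
  exact_mod_cast (div_le_div_iff_of_pos_right this).1 h2

theorem choose_sum_le_pow (q s : ℕ) (w : ℕ → ℕ) (n : ℕ) :
    q * n.choose s + ∑ j ∈ Finset.range s, w j * n.choose j ≤
      (q + ∑ j ∈ Finset.range s, w j) * (n + 1) ^ s := by
  rw [add_mul, Finset.sum_mul]
  refine add_le_add (Nat.mul_le_mul_left _ ?_) (Finset.sum_le_sum fun j hj =>
    Nat.mul_le_mul_left _ ?_)
  · exact (Nat.choose_le_pow n s).trans (Nat.pow_le_pow_left (by omega) s)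
  · exact (Nat.choose_le_pow n j).trans ((Nat.pow_le_pow_left (by omega) j).trans
      (Nat.pow_le_pow_right (by omega) (Finset.mem_range.1 hj).le))

end DifferenceChains

/-! ### General elements and filter-regularity -/

section GeneralElements

variable {k : Type*} [Field k]

/-- An element outside finitely many proper subspaces is a nonzerodivisor up to torsion. -/
theorem exists_finset_torsion_of_smul_eq_zero {B M E : Type*} [CommRing B] [IsNoetherianRing B]
    [Algebra k B] [AddCommGroup M] [Module B M] [Module.Finite B M] [AddCommGroup E] [Module k E]
    (τ : E →ₗ[k] B) :
    ∃ s : Finset (Submodule k E), ⊤ ∉ s ∧ ∀ v, (∀ p ∈ s, v ∉ p) → ∀ z : M, τ v • z = 0 →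
      ∃ N, ∀ b ∈ Ideal.span (Set.range τ) ^ N, b • z = 0 := by
  classical
  have hfin : (associatedPrimes B M).Finite := associatedPrimes.finite B M
  refine ⟨(hfin.toFinset.image fun 𝔭 => (𝔭.restrictScalars k).comap τ).filter (· ≠ ⊤), by simp,
    fun v hv z hz => ?_⟩
  let A := Module.annihilator B (Submodule.span B {z})
  have hA : ∀ b, b ∈ A ↔ b • z = 0 := fun b => by
    simp [A]
  -- A minimal prime 𝔭 of the annihilator of z is associated to M and contains τ v. As v avoids
  -- every proper preimage τ⁻¹(𝔭), this preimage is everything, so 𝔭 contains the whole image of τ.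
  have hrad : Ideal.span (Set.range τ) ≤ A.radical := by
    rw [← Ideal.sInf_minimalPrimes]
    refine le_sInf fun 𝔭 h𝔭 => ?_
    have h1 : 𝔭 ∈ associatedPrimes B (Submodule.span B {z}) :=
      Module.associatedPrimes.minimalPrimes_annihilator_subset_associatedPrimes B _ h𝔭
    have h2 : 𝔭 ∈ associatedPrimes B M :=
      associatedPrimes.subset_of_injective (f := (Submodule.span B {z}).subtype)
        Subtype.val_injective h1
    have h3 : v ∈ (𝔭.restrictScalars k).comap τ := h𝔭.1.2 ((hA _).2 hz)
    by_cases h4 : (𝔭.restrictScalars k).comap τ = ⊤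
    · rw [Ideal.span_le]
      rintro _ ⟨u, rfl⟩
      have : u ∈ (𝔭.restrictScalars k).comap τ := h4 ▸ trivial
      exact this
    · refine absurd h3 (hv _ ?_)
      rw [Finset.mem_filter, Finset.mem_image]
      exact ⟨⟨𝔭, hfin.mem_toFinset.2 h2, rfl⟩, h4⟩
  obtain ⟨N, hN⟩ := Ideal.exists_pow_le_of_le_radical_of_fg hrad
    ((isNoetherianRing_iff_ideal_fg B).1 inferInstance _)
  exact ⟨N, fun b hb => (hA b).1 (hN hb)⟩

theorem exists_finset_torsion_of_mul_mem {B E : Type*} [CommRing B] [IsNoetherianRing B]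
    [Algebra k B] [AddCommGroup E] [Module k E] (τ : E →ₗ[k] B) (𝔟 : Ideal B) :
    ∃ s : Finset (Submodule k E), ⊤ ∉ s ∧ ∀ v, (∀ p ∈ s, v ∉ p) → ∀ z : B, τ v * z ∈ 𝔟 →
      ∃ N, ∀ b ∈ Ideal.span (Set.range τ) ^ N, b * z ∈ 𝔟 := by
  obtain ⟨s, hs, H⟩ := exists_finset_torsion_of_smul_eq_zero (M := B ⧸ 𝔟) τ
  refine ⟨s, hs, fun v hv z hz => ?_⟩
  obtain ⟨N, hN⟩ := H v hv (Ideal.Quotient.mk 𝔟 z) (Ideal.Quotient.eq_zero_iff_mem.2 hz)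
  exact ⟨N, fun b hb => Ideal.Quotient.eq_zero_iff_mem.1 (hN b hb)⟩

/-- A vector space over an infinite field is not a finite union of proper subspaces. -/
theorem exists_notMem_of_top_notMem [Infinite k] {E : Type*} [AddCommGroup E] [Module k E]
    {s : Finset (Submodule k E)} (hs : ⊤ ∉ s) : ∃ v, ∀ p ∈ s, v ∉ p := by
  by_contra! h
  refine Subspace.biUnion_ne_univ_of_top_notMem hs (Set.eq_univ_of_forall fun v => ?_)
  obtain ⟨p, hp, hv⟩ := h v
  exact Set.mem_biUnion hp hv

end GeneralElements

section FilterRegular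

variable {k S : Type*} [Field k] [CommRing S] [Algebra k S]

/-- The elements of `Jⁿ` which `f` multiplies into `𝔣 Jⁿ` form a `J`-filtration. -/
def mulFiltration (J 𝔣 : Ideal S) (f : S) : J.Filtration S where
  N n := J ^ n ⊓ Submodule.comap (LinearMap.mulLeft S f) (𝔣 * J ^ n)
  mono n := inf_le_inf (Ideal.pow_le_pow_right n.le_succ)
    (Submodule.comap_mono (Ideal.mul_mono_right (Ideal.pow_le_pow_right n.le_succ)))
  smul_le n := by
    rw [Submodule.smul_le]
    rintro y hy x ⟨hx, hfx⟩
    refine ⟨?_, ?_⟩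
    · rw [pow_succ']; exact Ideal.mul_mem_mul hy hx
    · change f * (y * x) ∈ 𝔣 * J ^ (n + 1)
      have hfx' : f * x ∈ 𝔣 * J ^ n := hfx
      have := Ideal.mul_mem_mul hy hfx'
      rw [mul_left_comm, ← pow_succ'] at this
      rwa [mul_left_comm]

/-- Artin–Rees: a J-filtration contained in the J-adic one is stable. -/
theorem mulFiltration_stable [IsNoetherianRing S] (J 𝔣 : Ideal S) (f : S) :
    (mulFiltration J 𝔣 f).Stable := by
  refine Ideal.Filtration.Stable.of_le (Ideal.stableFiltration_stable J ⊤) fun n => ?_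
  change _ ≤ J ^ n • ⊤
  rw [Ideal.smul_eq_mul, Ideal.mul_top]
  exact inf_le_left

/-- `x t` as an element of the Rees algebra. -/
noncomputable def reesDegreeOne (J : Ideal S) (E : Submodule k S) (hE : ∀ x ∈ E, x ∈ J) :
    E →ₗ[k] reesAlgebra J where
  toFun v := ⟨Polynomial.monomial 1 v.1, reesAlgebra.monomial_mem.2 (by simpa using hE _ v.2)⟩
  map_add' _ _ := Subtype.ext (by simp)
  map_smul' c v := Subtype.ext (Polynomial.smul_monomial c 1 v.1).symm

theorem exists_mem_span_reesDegreeOne_pow {J : Ideal S} {E : Submodule k S}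
    (hE : Ideal.span (E : Set S) = J) (hE' : ∀ x ∈ E, x ∈ J) (N : ℕ) {y : S} (hy : y ∈ J ^ N) :
    ∃ b ∈ Ideal.span (Set.range (reesDegreeOne J E hE')) ^ N,
      (b : Polynomial S) = Polynomial.monomial N y := by
  have h1 : ∀ u ∈ J, ∃ b ∈ Ideal.span (Set.range (reesDegreeOne J E hE')),
      (b : Polynomial S) = Polynomial.monomial 1 u := by
    intro u hu
    rw [← hE] at hu
    refine Submodule.span_induction ?_ ?_ ?_ ?_ hu
    · intro x hx
      exact ⟨_, Ideal.subset_span ⟨⟨x, hx⟩, rfl⟩, rfl⟩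
    · exact ⟨0, Ideal.zero_mem _, by simp⟩
    · rintro x y _ _ ⟨b, hb, hbx⟩ ⟨c, hc, hcy⟩
      exact ⟨b + c, Ideal.add_mem _ hb hc, by simp [hbx, hcy]⟩
    · rintro s x _ ⟨b, hb, hbx⟩
      refine ⟨s • b, Submodule.smul_of_tower_mem _ s hb, ?_⟩
      change s • (b : Polynomial S) = _
      rw [hbx, Polynomial.smul_monomial]
  induction N generalizing y with
  | zero => exact ⟨algebraMap S _ y, by simp, rfl⟩
  | succ N ih =>
    rw [pow_succ'] at hy
    refine Submodule.mul_induction_on hy ?_ ?_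
    · intro u hu w hw
      obtain ⟨b, hb, hbu⟩ := h1 u hu
      obtain ⟨c, hc, hcw⟩ := ih hw
      refine ⟨b * c, by rw [pow_succ']; exact Ideal.mul_mem_mul hb hc, ?_⟩
      change (b : Polynomial S) * c = _
      rw [hbu, hcw, Polynomial.monomial_mul_monomial, add_comm]
    · rintro x y ⟨b, hb, hbx⟩ ⟨c, hc, hcy⟩
      exact ⟨b + c, Ideal.add_mem _ hb hc, by simp [hbx, hcy]⟩

/-- The ideal of the Rees algebra generated by the elements `f t` with `f ∈ 𝔣`. -/
noncomputable def reesShift (J 𝔣 : Ideal S) : Ideal (reesAlgebra J) :=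
  Ideal.span {b | ∃ f ∈ 𝔣, (b : Polynomial S) = Polynomial.monomial 1 f}

theorem coeff_mem_of_mem_reesShift {J 𝔣 : Ideal S} {b : reesAlgebra J} (hb : b ∈ reesShift J 𝔣)
    (n : ℕ) : (b : Polynomial S).coeff (n + 1) ∈ 𝔣 * J ^ n := by
  refine Submodule.span_induction ?_ ?_ ?_ ?_ hb
  · rintro x ⟨f, hf, hx⟩
    rw [hx, Polynomial.coeff_monomial]
    split_ifs with h
    · obtain rfl : n = 0 := by omega
      simpa using hf
    · exact Ideal.zero_mem _
  · simp
  · intro x y _ _ hx hy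
    simpa using add_mem hx hy
  · intro s x hx _
    revert s
    refine Submodule.span_induction ?_ ?_ ?_ ?_ hx
    · rintro x ⟨f, hf, hx⟩ s
      have : ((s • x : reesAlgebra J) : Polynomial S) = s * Polynomial.monomial 1 f := by
        rw [← hx]; rfl
      rw [this, ← Polynomial.C_mul_X_pow_eq_monomial, pow_one, ← mul_assoc,
        Polynomial.coeff_mul_X, Polynomial.coeff_mul_C, mul_comm _ f]
      exact Ideal.mul_mem_mul hf ((mem_reesAlgebra_iff J s).1 s.2 n)
    · simp
    · intro x y _ _ hx hy s
      rw [smul_add]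
      simpa using add_mem (hx s) (hy s)
    · intro a x _ hx s
      rw [smul_smul]
      exact hx _

theorem mem_reesShift_of_mem {J 𝔣 : Ideal S} (h𝔣 : 𝔣 ≤ J) {n : ℕ} {y : S} (hy : y ∈ 𝔣 * J ^ n)
    {b : reesAlgebra J} (hb : (b : Polynomial S) = Polynomial.monomial (n + 1) y) :
    b ∈ reesShift J 𝔣 := by
  have : ∃ c ∈ reesShift J 𝔣, (c : Polynomial S) = Polynomial.monomial (n + 1) y := by
    refine Submodule.mul_induction_on hy ?_ ?_
    · intro f hf w hw
      refine ⟨⟨_, reesAlgebra.monomial_mem.2 hw⟩ * ⟨Polynomial.monomial 1 f,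
        reesAlgebra.monomial_mem.2 (by simpa using h𝔣 hf)⟩,
        Ideal.mul_mem_left _ _ (Ideal.subset_span ⟨f, hf, rfl⟩), ?_⟩
      change Polynomial.monomial n w * Polynomial.monomial 1 f = _
      rw [Polynomial.monomial_mul_monomial, mul_comm w]
    · rintro x y ⟨b, hb, hbx⟩ ⟨c, hc, hcy⟩
      exact ⟨b + c, Ideal.add_mem _ hb hc, by simp [hbx, hcy]⟩
  obtain ⟨c, hc, hcy⟩ := this
  rwa [Subtype.ext (hb.trans hcy.symm)]

/-- In the Rees algebra modulo the ideal generated by 𝔣t, multiplication by a general vt kills only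
elements annihilated by a power of Jt. By Artin–Rees the kernel in high degrees is generated from
one degree n₀, so one power of Jt annihilates its generators and the kernel vanishes in large
degrees. -/
theorem exists_finset_isFilterRegularOn [IsNoetherianRing S] {J 𝔣 : Ideal S} (h𝔣 : 𝔣 ≤ J)
    {E : Submodule k S} (hE : Ideal.span (E : Set S) = J) :
    ∃ s : Finset (Submodule k E), ⊤ ∉ s ∧ ∀ v : E, (∀ p ∈ s, v ∉ p) →
      IsFilterRegularOn J 𝔣 (v : S) := by
  have hE' : ∀ x ∈ E, x ∈ J := fun x hx => hE ▸ Ideal.subset_span hx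
  obtain ⟨s, hs, H⟩ := exists_finset_torsion_of_mul_mem (reesDegreeOne J E hE') (reesShift J 𝔣)
  refine ⟨s, hs, fun v hv => ?_⟩
  obtain ⟨n₀, hn₀⟩ := (mulFiltration_stable J 𝔣 (v : S)).exists_pow_smul_eq
  -- The exponent N + 1 makes the t-degree n₀ + N + 1 positive, as is needed to read off a
  -- coefficient in 𝔣 times J to the power n₀ + N.
  have key : ∀ x ∈ (mulFiltration J 𝔣 (v : S)).N n₀, ∃ N, ∀ y ∈ J ^ (N + 1),
      y * x ∈ 𝔣 * J ^ (n₀ + N) := by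
    rintro x ⟨hx, hvx⟩
    obtain ⟨N, hN⟩ := H v hv ⟨_, reesAlgebra.monomial_mem.2 hx⟩ (by
      refine mem_reesShift_of_mem h𝔣 (y := v * x) hvx ?_
      change Polynomial.monomial 1 (v : S) * Polynomial.monomial n₀ x = _
      rw [Polynomial.monomial_mul_monomial, add_comm])
    refine ⟨N, fun y hy => ?_⟩
    obtain ⟨b, hb, hby⟩ := exists_mem_span_reesDegreeOne_pow hE hE' (N + 1) hy
    have h1 := coeff_mem_of_mem_reesShift
      (hN b (Ideal.pow_le_pow_right N.le_succ hb)) (n₀ + N)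
    have h2 : ((b * (⟨_, reesAlgebra.monomial_mem.2 hx⟩ : reesAlgebra J) : reesAlgebra J) :
        Polynomial S) = Polynomial.monomial (n₀ + N + 1) (y * x) := by
      change (b : Polynomial S) * Polynomial.monomial n₀ x = _
      rw [hby, Polynomial.monomial_mul_monomial]
      congr 2
      ring
    rwa [h2, Polynomial.coeff_monomial_same] at h1
  obtain ⟨T, hT⟩ := (isNoetherianRing_iff_ideal_fg S).1 inferInstance
    ((mulFiltration J 𝔣 (v : S)).N n₀)
  have hTm : ∀ x ∈ T, x ∈ (mulFiltration J 𝔣 (v : S)).N n₀ := fun x hx =>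
    hT ▸ Submodule.subset_span hx
  choose! N hN using key
  let M := T.sup N
  have hM : J ^ (M + 1) * (mulFiltration J 𝔣 (v : S)).N n₀ ≤ 𝔣 * J ^ (n₀ + M) := by
    rw [Ideal.mul_le]
    intro y hy x hx
    rw [← hT] at hx
    refine Submodule.span_induction ?_ ?_ ?_ ?_ hx
    · intro x hx
      have hle : N x ≤ M := Finset.le_sup hx
      have hy' : y ∈ J ^ (M - N x) * J ^ (N x + 1) := by
        rwa [← pow_add, show M - N x + (N x + 1) = M + 1 by omega]
      refine Submodule.mul_induction_on hy' ?_ ?_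
      · intro a ha c hc
        have := Ideal.mul_mem_mul ha (hN x (hTm x hx) c hc)
        rwa [mul_left_comm, ← pow_add, show M - N x + (n₀ + N x) = n₀ + M by omega,
          ← mul_assoc] at this
      · intro a c ha hc
        rw [add_mul]; exact add_mem ha hc
    · simp
    · intro a c _ _ ha hc
      rw [mul_add]; exact add_mem ha hc
    · intro a c _ hc
      rw [smul_eq_mul, mul_left_comm]; exact Ideal.mul_mem_left _ _ hc
  refine ⟨n₀ + M, fun n hn x hx hvx => ?_⟩
  have h1 : x ∈ (mulFiltration J 𝔣 (v : S)).N (n₀ + (M + 1 + (n - (n₀ + M)))) := by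
    rw [show n₀ + (M + 1 + (n - (n₀ + M))) = n + 1 by omega]
    exact ⟨hx, hvx⟩
  rw [hn₀, Ideal.smul_eq_mul, pow_add, mul_comm (J ^ (M + 1)), mul_assoc] at h1
  have h2 := Ideal.mul_mono_right hM h1
  rwa [mul_left_comm, ← pow_add, show n - (n₀ + M) + (n₀ + M) = n by omega] at h2

end FilterRegular

/-! ### Residual intersections and the condition G_d -/

section ResidualIntersections

variable {k S : Type*} [Field k] [CommRing S] [Algebra k S]

/-- The product of the multipliers of finitely many generators of J works for all of J. -/
theorem exists_notMem_colon [IsNoetherianRing S] {P J 𝔞 : Ideal S} [hP : P.IsPrime]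
    (h : ∀ x ∈ J, ∃ c ∉ P, c * x ∈ 𝔞) : ∃ c ∉ P, c ∈ 𝔞.colon (J : Set S) := by
  classical
  obtain ⟨T, hT⟩ := (isNoetherianRing_iff_ideal_fg S).1 inferInstance J
  choose! c hc hcx using h
  have hTJ : ∀ x ∈ T, x ∈ J := fun x hx => hT ▸ Submodule.subset_span hx
  refine ⟨∏ x ∈ T, c x, fun hmem => ?_, ?_⟩
  · obtain ⟨x, hx, hxP⟩ := (hP.prod_mem_iff).1 hmem
    exact hc x (hTJ x hx) hxP
  · rw [← hT]
    rw [Ideal.colon_span, Submodule.mem_colon]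
    intro x hx
    rw [smul_eq_mul, ← Finset.mul_prod_erase T c hx, mul_right_comm]
    exact Ideal.mul_mem_right _ _ (hcx x (hTJ x hx))

/-- A form of Nakayama's lemma. -/
theorem exists_pow_add_mem_colon [IsNoetherianRing S] {J 𝔣 𝔮 : Ideal S} {a : S}
    (h : ∀ x ∈ J, a * x ∈ 𝔣 ⊔ 𝔮 * J) : ∃ n, ∃ q ∈ 𝔮, a ^ n + q ∈ 𝔣.colon (J : Set S) := by
  let N : Submodule S J := Submodule.comap J.subtype 𝔣
  have hrange : LinearMap.range (algebraMap S (Module.End S (J ⧸ N)) a) ≤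
      𝔮 • (⊤ : Submodule S (J ⧸ N)) := by
    rintro _ ⟨z, rfl⟩
    obtain ⟨⟨x, hx⟩, rfl⟩ := Submodule.mkQ_surjective _ z
    obtain ⟨u, hu, w, hw, huw⟩ := Submodule.mem_sup.1 (h x hx)
    have hw' : ∃ y : J, (y : S) = w ∧ N.mkQ y ∈ 𝔮 • (⊤ : Submodule S (J ⧸ N)) := by
      refine Submodule.mul_induction_on hw ?_ ?_
      · intro q hq y hy
        refine ⟨q • ⟨y, hy⟩, rfl, ?_⟩
        rw [map_smul]
        exact Submodule.smul_mem_smul hq trivial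
      · rintro x y ⟨x', rfl, hx⟩ ⟨y', rfl, hy⟩
        exact ⟨x' + y', rfl, by rw [map_add]; exact add_mem hx hy⟩
    obtain ⟨y, rfl, hy⟩ := hw'
    convert hy using 1
    change N.mkQ (a • ⟨x, hx⟩) = _
    rw [← sub_eq_zero, ← map_sub, Submodule.mkQ_apply, Submodule.Quotient.mk_eq_zero]
    change a * x - y ∈ 𝔣
    rw [← huw, add_sub_cancel_right]
    exact hu
  -- Cayley–Hamilton for multiplication by a on J / (J ∩ 𝔣): p is monic with lower coefficients in
  -- 𝔮, so p(a) is a power of a modulo 𝔮.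
  obtain ⟨p, hp, -, hcoeff, hzero⟩ :=
    LinearMap.exists_monic_and_natDegree_eq_and_coeff_mem_pow_and_aeval_eq_zero S _ 𝔮 hrange
  rw [Polynomial.aeval_algebraMap_apply] at hzero
  refine ⟨p.natDegree, p.eval a - a ^ p.natDegree, ?_, ?_⟩
  · rw [← Ideal.Quotient.eq_zero_iff_mem, map_sub, sub_eq_zero, map_pow, ← Polynomial.eval_map_apply]
    have : p.map (Ideal.Quotient.mk 𝔮) = Polynomial.X ^ p.natDegree := by
      ext i
      rw [Polynomial.coeff_map, Polynomial.coeff_X_pow]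
      split_ifs with hi
      · rw [hi, hp.coeff_natDegree, map_one]
      · rcases lt_or_gt_of_ne hi with hi | hi
        · rw [Ideal.Quotient.eq_zero_iff_mem]
          exact Ideal.pow_le_self (by omega) (hcoeff i)
        · rw [Polynomial.coeff_eq_zero_of_natDegree_lt hi, map_zero]
    rw [this, Polynomial.eval_pow, Polynomial.eval_X]
  · rw [add_sub_cancel, Submodule.mem_colon]
    intro x hx
    have := LinearMap.congr_fun hzero (N.mkQ ⟨x, hx⟩)
    rw [Polynomial.coe_aeval_eq_eval] at this
    change N.mkQ (p.eval a • ⟨x, hx⟩) = 0 at this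
    rwa [Submodule.mkQ_apply, Submodule.Quotient.mk_eq_zero] at this

/-- The primes containing this ideal are the primes `P ⊇ J` at which `J / 𝔣` cannot be generated
by `s` elements. -/
def residualIdeal (J 𝔣 : Ideal S) (s : ℕ) : Ideal S :=
  J ⊔ ⨆ g : Fin s → J, (𝔣 ⊔ Ideal.span (Set.range fun i => (g i : S))).colon (J : Set S)

/-- The locus where `J / 𝔣` needs more than `s` generators has height at least
`min d (i + s + 1)`. -/
def HasResidualHeight (J 𝔣 : Ideal S) (d i : ℕ) : Prop :=
  ∀ (s : ℕ) (P : Ideal S) [P.IsPrime], residualIdeal J 𝔣 s ≤ P →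
    ((min d (i + s + 1) : ℕ) : ℕ∞) ≤ P.height

theorem le_residualIdeal (J 𝔣 : Ideal S) (s : ℕ) : J ≤ residualIdeal J 𝔣 s := le_sup_left

theorem colon_le_residualIdeal {J 𝔣 : Ideal S} {s : ℕ} (g : Fin s → J) :
    (𝔣 ⊔ Ideal.span (Set.range fun i => (g i : S))).colon (J : Set S) ≤ residualIdeal J 𝔣 s :=
  le_sup_of_le_right (le_iSup (fun g : Fin s → J =>
    (𝔣 ⊔ Ideal.span (Set.range fun i => (g i : S))).colon (J : Set S)) g)

theorem residualIdeal_mono {J 𝔣 𝔤 : Ideal S} (h : 𝔣 ≤ 𝔤) (s : ℕ) :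
    residualIdeal J 𝔣 s ≤ residualIdeal J 𝔤 s :=
  sup_le_sup_left (iSup_mono fun _ => Submodule.colon_mono (sup_le_sup_right h _) le_rfl) _

theorem exists_span_range_eq_of_spanRank_le {R : Type*} [CommRing R] {𝔞 : Ideal R} {s : ℕ}
    (h : 𝔞.spanRank ≤ s) : ∃ g : Fin s → R, Ideal.span (Set.range g) = 𝔞 := by
  obtain ⟨t, ht, rfl⟩ := Submodule.exists_span_set_card_eq_spanRank 𝔞
  rw [← ht] at h
  have : Nonempty (t ↪ Fin s) := by
    rw [← Cardinal.lift_mk_le']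
    simpa using h
  obtain ⟨e⟩ := this
  refine ⟨Function.extend e Subtype.val 0, le_antisymm (Ideal.span_le.2 ?_)
    (Ideal.span_le.2 fun x hx => Ideal.subset_span ⟨e ⟨x, hx⟩, e.injective.extend_apply _ _ _⟩)⟩
  rintro _ ⟨i, rfl⟩
  by_cases hi : ∃ x, e x = i
  · obtain ⟨x, rfl⟩ := hi
    rw [e.injective.extend_apply]
    exact Submodule.subset_span x.2
  · rw [Function.extend_apply' _ _ _ hi]
    exact Submodule.zero_mem _

/-- At a prime of height less than min d (s + 1), G_d gives s local generators of J. Clearing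
denominators, they are elements of J whose colon is not contained in the prime. -/
theorem SatisfiesG.hasResidualHeight [IsNoetherianRing S] {J : Ideal S} {d : ℕ}
    (hG : SatisfiesG J d) : HasResidualHeight J ⊥ d 0 := by
  intro s P hP hJP
  by_contra! hlt
  have hlt1 : P.height < d := hlt.trans_le (Nat.cast_le.2 (min_le_left _ _))
  have hlt2 : P.height < (s : ℕ∞) + 1 :=
    hlt.trans_le ((Nat.cast_le.2 (min_le_right _ _)).trans (by simp))
  have h1 := (hG P ((le_residualIdeal _ _ _).trans hJP) hlt1).trans
    (Order.le_of_lt_add_one hlt2)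
  rw [Cardinal.toENat_le_natCast] at h1
  obtain ⟨h, hh⟩ := exists_span_range_eq_of_spanRank_le h1
  have h2 : ∀ i, ∃ x : J × P.primeCompl,
      h i * algebraMap S (Localization.AtPrime P) x.2 = algebraMap S _ x.1 := fun i =>
    (IsLocalization.mem_map_algebraMap_iff P.primeCompl _).1
      (hh ▸ Ideal.subset_span ⟨i, rfl⟩)
  choose x hx using h2
  have hspan : J.map (algebraMap S (Localization.AtPrime P)) ≤
      (Ideal.span (Set.range fun i => ((x i).1 : S))).map (algebraMap S _) := by
    rw [← hh, Ideal.span_le]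
    rintro _ ⟨i, rfl⟩
    refine (IsLocalization.mem_map_algebraMap_iff P.primeCompl _).2 ⟨⟨⟨(x i).1,
      Ideal.subset_span ⟨i, rfl⟩⟩, (x i).2⟩, hx i⟩
  obtain ⟨c, hc, hcJ⟩ := exists_notMem_colon (P := P) (J := J)
      (𝔞 := ⊥ ⊔ Ideal.span (Set.range fun i => ((x i).1 : S))) fun y hy => by
    have := hspan (Ideal.mem_map_of_mem _ hy)
    rw [IsLocalization.algebraMap_mem_map_algebraMap_iff P.primeCompl] at this
    obtain ⟨m, hm, hmy⟩ := this
    exact ⟨m, hm, Ideal.mem_sup_right hmy⟩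
  exact hc (hJP (colon_le_residualIdeal (fun i => (x i).1) hcJ))

/-- The ideal of elements which lie in `𝔞` at the prime `P`. -/
def saturationAt (P 𝔞 : Ideal S) [hP : P.IsPrime] : Ideal S where
  carrier := {x | ∃ a ∉ P, a * x ∈ 𝔞}
  zero_mem' := ⟨1, fun h => hP.ne_top ((Ideal.eq_top_iff_one _).2 h), by simp⟩
  add_mem' := by
    rintro x y ⟨a, ha, hax⟩ ⟨b, hb, hby⟩
    refine ⟨a * b, fun h => (hP.mem_or_mem h).elim ha hb, ?_⟩
    rw [mul_add]
    exact add_mem (by rw [mul_right_comm]; exact Ideal.mul_mem_right _ _ hax)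
      (by rw [mul_assoc]; exact Ideal.mul_mem_left _ _ hby)
  smul_mem' := by
    rintro c x ⟨a, ha, hax⟩
    exact ⟨a, ha, by rw [smul_eq_mul, mul_left_comm]; exact Ideal.mul_mem_left _ _ hax⟩

/-- Steinitz exchange at P: since v does not lie in 𝔣 + PJ locally, some coefficient in its
expression through the g's is a unit at P, and v replaces that generator. -/
theorem exchange_colon {J 𝔣 P : Ideal S} [hP : P.IsPrime] {s : ℕ} (g : Fin (s + 1) → J) {b v : S}
    (hb : b ∉ P) (hv : v ∈ J)
    (hbg : b ∈ (𝔣 ⊔ Ideal.span (Set.range fun i => (g i : S))).colon (J : Set S))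
    (hvP : v ∉ saturationAt P (𝔣 ⊔ P * J)) :
    ∃ (g' : Fin s → J) (c : S), c ∉ P ∧
      c ∈ ((𝔣 ⊔ Ideal.span {v}) ⊔ Ideal.span (Set.range fun i => (g' i : S))).colon
        (J : Set S) := by
  obtain ⟨u, hu, w, hw, huw⟩ := Submodule.mem_sup.1 (Submodule.mem_colon.1 hbg v hv)
  obtain ⟨a, rfl⟩ := (Submodule.mem_span_range_iff_exists_fun S).1 hw
  have hj : ∃ j, a j ∉ P := by
    by_contra! h
    refine hvP ⟨b, hb, ?_⟩
    change b • v ∈ _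
    rw [← huw]
    exact add_mem (Ideal.mem_sup_left hu) (Ideal.mem_sup_right (sum_mem fun i _ =>
      Ideal.mul_mem_mul (h i) (g i).2))
  obtain ⟨j, hj⟩ := hj
  refine ⟨g ∘ j.succAbove, a j * b, fun h => (hP.mem_or_mem h).elim hj hb, ?_⟩
  set T := (𝔣 ⊔ Ideal.span {v}) ⊔ Ideal.span (Set.range fun i => ((g ∘ j.succAbove) i : S))
  have hmem : ∀ i, (g (j.succAbove i) : S) ∈ T := fun i =>
    Ideal.mem_sup_right (Ideal.subset_span ⟨i, rfl⟩)
  have h𝔣T : 𝔣 ≤ T := le_sup_left.trans le_sup_left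
  have hvT : v ∈ T := Ideal.mem_sup_left (Ideal.mem_sup_right (Ideal.mem_span_singleton_self v))
  have hgj : a j * (g j : S) ∈ T := by
    rw [Fin.sum_univ_succAbove _ j] at huw
    have : a j * (g j : S) = b * v - u - ∑ i, a (j.succAbove i) • (g (j.succAbove i) : S) := by
      rw [← smul_eq_mul b, ← huw, smul_eq_mul]; ring
    rw [this]
    exact sub_mem (sub_mem (Ideal.mul_mem_left _ _ hvT) (h𝔣T hu))
      (sum_mem fun i _ => Ideal.mul_mem_left _ _ (hmem i))
  have key : 𝔣 ⊔ Ideal.span (Set.range fun i => (g i : S)) ≤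
      Submodule.comap (LinearMap.mulLeft S (a j)) T := by
    refine sup_le (fun x hx => Ideal.mul_mem_left _ _ (h𝔣T hx)) (Ideal.span_le.2 ?_)
    rintro _ ⟨i, rfl⟩
    change a j * (g i : S) ∈ T
    rcases Fin.eq_self_or_eq_succAbove j i with rfl | ⟨i, rfl⟩
    · exact hgj
    · exact Ideal.mul_mem_left _ _ (hmem i)
  rw [Submodule.mem_colon]
  intro x hx
  rw [smul_eq_mul, mul_assoc]
  exact key (Submodule.mem_colon.1 hbg x hx)

/-- A prime P at which J / (𝔣, v) needs more than s generators also needs more than s for J / 𝔣.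
Either it needs more than s + 1, and the bound for s + 1 applies; or P properly contains a minimal
prime of the locus for s, and the height rises by one. That P is itself such a minimal prime is
excluded by general v, through `exchange_colon`. -/
theorem exists_finset_hasResidualHeight [IsNoetherianRing S] {J 𝔣 : Ideal S} {d i : ℕ}
    (h : HasResidualHeight J 𝔣 d i) {E : Submodule k S} (hE : Ideal.span (E : Set S) = J) :
    ∃ s : Finset (Submodule k E), ⊤ ∉ s ∧ ∀ v : E, (∀ p ∈ s, v ∉ p) →
      HasResidualHeight J (𝔣 ⊔ Ideal.span {(v : S)}) d (i + 1) := by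
  classical
  have hE' : ∀ x ∈ E, x ∈ J := fun x hx => hE ▸ Ideal.subset_span hx
  -- The subspaces to be avoided; the value ⊥ at non-primes is never used.
  let B : Ideal S → Submodule k E := fun Q => if hQ : Q.IsPrime then
    ((saturationAt Q (𝔣 ⊔ Q * J)).restrictScalars k).comap E.subtype else ⊥
  -- If this space were everything, J = 𝔣 + QJ would hold at Q. By Nakayama J = 𝔣 at Q, so 𝔣 : J
  -- would not lie in Q, although it lies in the residual ideal.
  have hB : ∀ s, ∀ Q ∈ (residualIdeal J 𝔣 s).minimalPrimes, B Q ≠ ⊤ := by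
    intro s Q hQ htop
    have hQp : Q.IsPrime := hQ.1.1
    simp only [B, dif_pos hQp] at htop
    have hJle : J ≤ saturationAt Q (𝔣 ⊔ Q * J) := by
      rw [← hE, Ideal.span_le]
      intro x hx
      have : (⟨x, hx⟩ : E) ∈ ((saturationAt Q (𝔣 ⊔ Q * J)).restrictScalars k).comap E.subtype :=
        htop ▸ trivial
      exact hE ▸ this
    obtain ⟨a, ha, haJ⟩ := exists_notMem_colon (P := Q) (fun x hx => hJle hx)
    obtain ⟨n, q, hq, hn⟩ := exists_pow_add_mem_colon (𝔣 := 𝔣) (𝔮 := Q) (a := a)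
      (fun x hx => Submodule.mem_colon.1 haJ x hx)
    have h1 : a ^ n + q ∈ Q := hQ.1.2 (colon_le_residualIdeal (fun _ => 0)
      (Submodule.colon_mono le_sup_left le_rfl hn))
    exact ha (hQp.mem_of_pow_mem n ((Submodule.add_mem_iff_left Q hq).1 h1))
  refine ⟨(Finset.range d).biUnion fun s =>
    ((residualIdeal J 𝔣 s).finite_minimalPrimes_of_isNoetherianRing S).toFinset.image B, ?_, ?_⟩
  · intro htop
    simp only [Finset.mem_biUnion, Finset.mem_image, Set.Finite.mem_toFinset] at htop
    obtain ⟨s, -, Q, hQ, hQB⟩ := htop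
    exact hB s Q hQ hQB
  · intro v hv s P hP hle
    have hle' : residualIdeal J 𝔣 s ≤ P := (residualIdeal_mono le_sup_left s).trans hle
    -- For s ≥ d both minima equal d and the old bound suffices; this is why finitely many s have to
    -- be treated.
    by_cases hsd : s < d
    swap
    · exact (Nat.cast_le.2 (by omega)).trans (h s P hle')
    by_cases hP1 : residualIdeal J 𝔣 (s + 1) ≤ P
    · exact (Nat.cast_le.2 (by omega)).trans (h (s + 1) P hP1)
    obtain ⟨Q, hQ, hQP⟩ := Ideal.exists_minimalPrimes_le hle'
    have hQp : Q.IsPrime := hQ.1.1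
    rcases hQP.eq_or_lt with rfl | hlt
    · exfalso
      have hcolon : ∃ g : Fin (s + 1) → J,
          ¬ (𝔣 ⊔ Ideal.span (Set.range fun i => (g i : S))).colon (J : Set S) ≤ Q := by
        by_contra! hall
        exact hP1 (sup_le ((le_residualIdeal _ _ _).trans hle) (iSup_le hall))
      obtain ⟨g, hg⟩ := hcolon
      obtain ⟨b, hbg, hbP⟩ := SetLike.not_le_iff_exists.1 hg
      have hvQ : (v : S) ∉ saturationAt Q (𝔣 ⊔ Q * J) := by
        have := hv (B Q) (Finset.mem_biUnion.2 ⟨s, Finset.mem_range.2 hsd, Finset.mem_image.2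
          ⟨Q, (Set.Finite.mem_toFinset _).2 hQ, rfl⟩⟩)
        simp only [B, dif_pos hQp] at this
        exact this
      obtain ⟨g', c, hc, hcg⟩ := exchange_colon g hbP (hE' _ v.2) hbg hvQ
      exact hc (hle (colon_le_residualIdeal g' hcg))
    · have h1 := h s Q hQ.1.2
      have h2 := Ideal.height_add_one_le_of_lt_of_isPrime hlt
      calc ((min d (i + 1 + s + 1) : ℕ) : ℕ∞) ≤ ((min d (i + s + 1) + 1 : ℕ) : ℕ∞) :=
            Nat.cast_le.2 (by omega)
        _ ≤ Q.height + 1 := by push_cast; gcongr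
        _ ≤ P.height := h2

end ResidualIntersections

/-! ### Dimension bounds from finite extensions -/

section IntegralDimension

/-- Incomparability: contraction of primes along an integral map is strictly monotone. -/
theorem ringKrullDim_le_of_algebra_isIntegral (A B : Type*) [CommRing A] [CommRing B] [Algebra A B]
    [Algebra.IsIntegral A B] : ringKrullDim B ≤ ringKrullDim A := by
  refine Order.krullDim_le_of_strictMono (PrimeSpectrum.comap (algebraMap A B)) fun P Q hPQ => ?_
  exact Ideal.IsIntegral.comap_lt_comap hPQ

variable {k B : Type*} [Field k] [CommRing B] [Algebra k B]

theorem iSup_pow_eq_top_of_adjoin_eq_top {T : Submodule k B}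
    (hT : Algebra.adjoin k (T : Set B) = ⊤) : ⨆ n, T ^ n = ⊤ := by
  rw [eq_top_iff, ← Algebra.top_toSubmodule, ← hT, Algebra.adjoin_eq_span, Submodule.span_le]
  intro x hx
  have : ∃ i, x ∈ T ^ i := by
    refine Submonoid.closure_induction ?_ ?_ ?_ hx
    · intro x hx; exact ⟨1, by simpa using hx⟩
    · exact ⟨0, by rw [pow_zero]; exact Submodule.one_le.1 le_rfl⟩
    · rintro x y _ _ ⟨i, hi⟩ ⟨j, hj⟩
      exact ⟨i + j, by rw [pow_add]; exact Submodule.mul_mem_mul hi hj⟩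
  obtain ⟨i, hi⟩ := this
  exact Submodule.mem_iSup_of_mem i hi

/-- The inclusion makes T⁰ + … + Tᴺ generate B as a module over the polynomial ring acting through
y, so B is finite over a ring of dimension s. -/
theorem ringKrullDim_le_of_pow_le_span_mul {T : Submodule k B} (hfg : T.FG)
    (hT : Algebra.adjoin k (T : Set B) = ⊤) {s N : ℕ} (y : Fin s → B)
    (hy : T ^ (N + 1) ≤ Submodule.span k (Set.range y) * T ^ N) : ringKrullDim B ≤ s := by
  let A := MvPolynomial (Fin s) k
  let _ : Algebra A B := (MvPolynomial.aeval y).toAlgebra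
  have hscalar : IsScalarTower k A B := IsScalarTower.of_algebraMap_eq fun c =>
    ((MvPolynomial.aeval y).commutes c).symm
  have hA : ∀ (a : A) (b : B), a • b = MvPolynomial.aeval y a * b := fun a b => rfl
  let T' : Submodule k B := ⨆ i : Fin (N + 1), T ^ (i : ℕ)
  have hT' : T'.FG := Submodule.fg_iSup _ fun i => hfg.pow i
  obtain ⟨G, hG⟩ := hT'
  let M : Submodule A B := Submodule.span A (G : Set B)
  have hGM : T' ≤ M.restrictScalars k := by
    rw [← hG, Submodule.span_le]
    exact Submodule.subset_span
  have hpow : ∀ n, T ^ n ≤ M.restrictScalars k := by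
    intro n
    induction n using Nat.strong_induction_on with
    | _ n ih =>
      rcases Nat.lt_or_ge n (N + 1) with hn | hn
      · exact (le_iSup (fun i : Fin (N + 1) => T ^ (i : ℕ)) ⟨n, hn⟩).trans hGM
      · obtain ⟨j, rfl⟩ := Nat.exists_eq_add_of_le hn
        have h1 : T ^ (N + 1 + j) ≤ Submodule.span k (Set.range y) * T ^ (N + j) := by
          rw [pow_add, pow_add _ N j, ← mul_assoc]
          exact mul_le_mul_left hy _
        refine h1.trans (Submodule.mul_le.2 fun a ha b hb => ?_)
        have hb' := ih (N + j) (by omega) hb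
        refine Submodule.span_induction ?_ ?_ ?_ ?_ ha
        · rintro _ ⟨i, rfl⟩
          have := M.smul_mem (MvPolynomial.X i) hb'
          rwa [hA, MvPolynomial.aeval_X] at this
        · simp
        · intro a c _ _ ha hc
          rw [add_mul]; exact add_mem ha hc
        · intro c a _ ha
          rw [smul_mul_assoc]; exact Submodule.smul_mem _ c ha
  have hM : M = ⊤ := by
    have h1 : (⊤ : Submodule k B) ≤ M.restrictScalars k := by
      rw [← iSup_pow_eq_top_of_adjoin_eq_top hT]
      exact iSup_le hpow
    exact eq_top_iff.2 fun x _ => h1 trivial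
  have hfin : Module.Finite A B := ⟨⟨G, hM⟩⟩
  have hint : Algebra.IsIntegral A B := Algebra.IsIntegral.of_finite A B
  refine (ringKrullDim_le_of_algebra_isIntegral A B).trans ?_
  rw [MvPolynomial.ringKrullDim_of_isNoetherianRing, ringKrullDim_eq_zero_of_field]
  simp

end IntegralDimension

/-! ### Inductive choice of sequences -/

section InitialIdeal

variable {k S : Type*} [Field k] [CommRing S] [Algebra k S]

/-- The ideal generated by the first `i` elements of the sequence `f`. -/
def initialIdeal (f : ℕ → S) (i : ℕ) : Ideal S := Ideal.span (f '' Set.Iio i)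

@[simp]
theorem initialIdeal_zero (f : ℕ → S) : initialIdeal f 0 = ⊥ := by simp [initialIdeal]

theorem initialIdeal_succ (f : ℕ → S) (i : ℕ) :
    initialIdeal f (i + 1) = initialIdeal f i ⊔ Ideal.span {f i} := by
  rw [initialIdeal, initialIdeal, ← Ideal.span_union]
  congr 1
  ext x
  simp only [Set.mem_image, Set.mem_Iio, Set.mem_union, Set.mem_singleton_iff,
    Nat.lt_succ_iff_lt_or_eq]
  constructor
  · rintro ⟨j, hj | rfl, rfl⟩
    · exact Or.inl ⟨j, hj, rfl⟩
    · exact Or.inr rfl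
  · rintro (⟨j, hj, rfl⟩ | rfl)
    · exact ⟨j, Or.inl hj, rfl⟩
    · exact ⟨i, Or.inr rfl, rfl⟩

theorem initialIdeal_le {f : ℕ → S} {J : Ideal S} (h : ∀ i, f i ∈ J) (i : ℕ) :
    initialIdeal f i ≤ J := Ideal.span_le.2 (by rintro _ ⟨j, -, rfl⟩; exact h j)

theorem generatedInDegree_initialIdeal {𝒜 : ℕ → Submodule k S} {f : ℕ → S} {r : ℕ}
    (h : ∀ i, f i ∈ 𝒜 r) (i : ℕ) : GeneratedInDegree 𝒜 (initialIdeal f i) r :=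
  ⟨f '' Set.Iio i, by rintro _ ⟨j, -, rfl⟩; exact h j, rfl⟩

/-- Dependent choice: C is an invariant of the ideal generated so far, and R is what the next
element must satisfy relative to that ideal. -/
theorem exists_seq_of_initialIdeal {E : Submodule k S} {R : Ideal S → S → Prop}
    {C : ℕ → Ideal S → Prop} (h0 : C 0 ⊥)
    (hstep : ∀ i 𝔣, 𝔣 ≤ Ideal.span (E : Set S) → C i 𝔣 →
      ∃ v ∈ E, R 𝔣 v ∧ C (i + 1) (𝔣 ⊔ Ideal.span {v})) :
    ∃ f : ℕ → S, ∀ i, f i ∈ E ∧ R (initialIdeal f i) (f i) ∧ C i (initialIdeal f i) := by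
  choose! F hF using hstep
  let 𝔤 : ℕ → Ideal S := fun i => Nat.rec ⊥ (fun i 𝔣 => 𝔣 ⊔ Ideal.span {F i 𝔣}) i
  have h𝔤 : ∀ i, 𝔤 (i + 1) = 𝔤 i ⊔ Ideal.span {F i (𝔤 i)} := fun i => rfl
  have hC : ∀ i, 𝔤 i ≤ Ideal.span (E : Set S) ∧ C i (𝔤 i) := by
    intro i
    induction i with
    | zero => exact ⟨bot_le, h0⟩
    | succ i ih =>
      obtain ⟨h1, -, h3⟩ := hF i (𝔤 i) ih.1 ih.2
      exact ⟨sup_le ih.1 (Ideal.span_mono (by simpa using h1)), h3⟩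
  have hinit : ∀ i, initialIdeal (fun i => F i (𝔤 i)) i = 𝔤 i := by
    intro i
    induction i with
    | zero => exact initialIdeal_zero _
    | succ i ih => rw [initialIdeal_succ, ih, h𝔤]
  refine ⟨fun i => F i (𝔤 i), fun i => ?_⟩
  rw [hinit]
  obtain ⟨h1, h2, -⟩ := hF i (𝔤 i) (hC i).1 (hC i).2
  exact ⟨h1, h2, (hC i).2⟩

end InitialIdeal

/-! ### The irrelevant ideal, linear parameters and the Hilbert function of S -/

section Irrelevant

variable {k S : Type*} [Field k] [CommRing S] [Algebra k S]
  (𝒜 : ℕ → Submodule k S) [GradedAlgebra 𝒜] [IsStandardGraded 𝒜]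

theorem exists_algebraMap_eq_of_mem_degree_zero {x : S} (hx : x ∈ 𝒜 0) :
    ∃ c, algebraMap k S c = x := by
  rw [IsStandardGraded.degree_zero (𝒜 := 𝒜)] at hx
  exact hx

theorem generatedInDegree_irrelevant :
    GeneratedInDegree 𝒜 (HomogeneousIdeal.irrelevant 𝒜).toIdeal 1 := by
  refine ⟨𝒜 1, le_rfl, le_antisymm ?_ (Ideal.span_le.2 fun x hx =>
    HomogeneousIdeal.mem_irrelevant_of_mem 𝒜 one_pos hx)⟩
  refine (HomogeneousIdeal.toIdeal_irrelevant_le 𝒜).2 fun i hi x hx => ?_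
  have hx' : x ∈ 𝒜 i := hx
  obtain ⟨j, rfl⟩ := Nat.exists_eq_add_of_le' hi
  rw [degree_add 𝒜] at hx'
  refine Submodule.mul_induction_on hx' ?_ ?_
  · intro a _ b hb
    exact Ideal.mul_mem_left _ _ (Ideal.subset_span hb)
  · intro a b ha hb
    exact add_mem ha hb

theorem span_degree_one :
    Ideal.span (𝒜 1 : Set S) = (HomogeneousIdeal.irrelevant 𝒜).toIdeal := by
  refine le_antisymm (Ideal.span_le.2 fun x hx =>
    HomogeneousIdeal.mem_irrelevant_of_mem 𝒜 one_pos hx) ?_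
  rw [← (generatedInDegree_irrelevant 𝒜).span_degreePart]
  exact Ideal.span_mono fun x hx => hx.2

variable {𝒜} in
theorem mem_irrelevant_pow {n m : ℕ} (hnm : n ≤ m) {x : S} (hx : x ∈ 𝒜 m) :
    x ∈ (HomogeneousIdeal.irrelevant 𝒜).toIdeal ^ n := by
  refine Ideal.pow_le_pow_right hnm ?_
  induction m generalizing x n with
  | zero => simp
  | succ m ih =>
    rw [degree_add 𝒜] at hx
    refine Submodule.mul_induction_on hx ?_ ?_
    · intro a ha b hb
      rw [pow_succ]
      exact Ideal.mul_mem_mul (ih le_rfl ha) (HomogeneousIdeal.mem_irrelevant_of_mem 𝒜 one_pos hb)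
    · intro a b ha hb
      exact add_mem ha hb

theorem degreePart_irrelevant_pow (n m : ℕ) :
    degreePart 𝒜 ((HomogeneousIdeal.irrelevant 𝒜).toIdeal ^ n) (n + m) = 𝒜 (n + m) :=
  le_antisymm (degreePart_le _ _) fun _ hx => ⟨mem_irrelevant_pow (Nat.le_add_right n m) hx, hx⟩

theorem exists_algebraMap_sub_mem_irrelevant (x : S) :
    ∃ c : k, x - algebraMap k S c ∈ (HomogeneousIdeal.irrelevant 𝒜).toIdeal := by
  obtain ⟨c, hc⟩ := exists_algebraMap_eq_of_mem_degree_zero 𝒜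
    (SetLike.coe_mem (DirectSum.decompose 𝒜 x 0))
  refine ⟨c, ?_⟩
  change GradedRing.projZeroRingHom 𝒜 _ = 0
  rw [map_sub, sub_eq_zero]
  change (DirectSum.decompose 𝒜 x 0 : S) = (DirectSum.decompose 𝒜 (algebraMap k S c) 0 : S)
  rw [← hc, coe_decompose_of_mem]
  rw [IsStandardGraded.degree_zero (𝒜 := 𝒜)]
  exact ⟨c, rfl⟩

variable {𝒜} in
theorem le_irrelevant_of_isHomogeneous {I : Ideal S} (hI : I.IsHomogeneous 𝒜) (hI' : I ≠ ⊤) :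
    I ≤ (HomogeneousIdeal.irrelevant 𝒜).toIdeal := by
  intro x hx
  have h0 := hI 0 hx
  obtain ⟨c, hc⟩ := exists_algebraMap_eq_of_mem_degree_zero 𝒜
    (SetLike.coe_mem (DirectSum.decompose 𝒜 x 0))
  by_cases hc0 : c = 0
  · change (DirectSum.decompose 𝒜 x 0 : S) = 0
    rw [← hc, hc0, map_zero]
  · refine absurd (Ideal.eq_top_of_isUnit_mem I h0 ?_) hI'
    rw [← hc]
    exact (IsUnit.mk0 c hc0).map (algebraMap k S)

theorem isHomogeneous_of_mem_minimalPrimes {I P : Ideal S} (hI : I.IsHomogeneous 𝒜)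
    (hP : P ∈ I.minimalPrimes) : P.IsHomogeneous 𝒜 := by
  have h1 : (P.homogeneousCore 𝒜).toIdeal.IsPrime := hP.1.1.homogeneousCore
  have h2 : I ≤ (P.homogeneousCore 𝒜).toIdeal := by
    rw [← hI.toIdeal_homogeneousCore_eq_self]
    exact Ideal.homogeneousCore_mono 𝒜 hP.1.2
  have h3 := hP.2 ⟨h1, h2⟩ (Ideal.toIdeal_homogeneousCore_le 𝒜 P)
  rw [le_antisymm h3 (Ideal.toIdeal_homogeneousCore_le 𝒜 P)]
  exact HomogeneousIdeal.isHomogeneous _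

theorem le_irrelevant_of_mem_minimalPrimes {I P : Ideal S} (hI : I.IsHomogeneous 𝒜)
    (hP : P ∈ I.minimalPrimes) : P ≤ (HomogeneousIdeal.irrelevant 𝒜).toIdeal :=
  le_irrelevant_of_isHomogeneous (isHomogeneous_of_mem_minimalPrimes 𝒜 hI hP) hP.1.1.ne_top

variable {𝒜} in
/-- A homogeneous ideal all of whose minimal primes equal `𝔫` contains a power of `𝔫`. -/
theorem exists_irrelevant_pow_le [IsNoetherianRing S] {I : Ideal S}
    (h : ∀ P ∈ I.minimalPrimes, P = (HomogeneousIdeal.irrelevant 𝒜).toIdeal) :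
    ∃ t, (HomogeneousIdeal.irrelevant 𝒜).toIdeal ^ t ≤ I := by
  refine Ideal.exists_pow_le_of_le_radical_of_fg ?_
    ((isNoetherianRing_iff_ideal_fg S).1 inferInstance _)
  rw [← Ideal.sInf_minimalPrimes]
  exact le_sInf fun P hP => (h P hP).ge

theorem degreePart_span_eq {X : Set S} {a : ℕ} (hX : X ⊆ (𝒜 a : Set S)) :
    degreePart 𝒜 (Ideal.span X) a = Submodule.span k X := by
  refine le_antisymm ?_ (Submodule.span_le.2 fun x hx => ⟨Ideal.subset_span hx, hX hx⟩)
  intro x hx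
  rw [← coe_decompose_of_mem hx.2]
  refine Submodule.closure_induction ?_ ?_ ?_ hx.1
  · simp
  · intro x y _ _ hx hy
    rw [DirectSum.decompose_add]; exact add_mem hx hy
  · intro s x hx
    obtain ⟨c, hc⟩ := exists_algebraMap_eq_of_mem_degree_zero 𝒜
      (SetLike.coe_mem (DirectSum.decompose 𝒜 s 0))
    have h := DirectSum.coe_decompose_mul_add_of_right_mem 𝒜 (a := s) (i := 0) (hX hx)
    rw [zero_add] at h
    rw [smul_eq_mul, h, ← hc, ← Algebra.smul_def]
    exact Submodule.smul_mem _ c (Submodule.subset_span hx)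

/-- A homogeneous system of parameters consisting of linear forms. -/
theorem exists_linear_parameters [Infinite k] [IsNoetherianRing S] {s : ℕ}
    (hs : (HomogeneousIdeal.irrelevant 𝒜).toIdeal.height = s) :
    ∃ y : ℕ → S, (∀ i, y i ∈ 𝒜 1) ∧
      ∃ N, (HomogeneousIdeal.irrelevant 𝒜).toIdeal ^ N ≤ initialIdeal y s := by
  set 𝔫 := (HomogeneousIdeal.irrelevant 𝒜).toIdeal with h𝔫
  have h𝔫p : 𝔫.IsPrime := IsStandardGraded.isPrime_irrelevant 𝒜
  -- The invariant is that minimal primes other than 𝔫 have height at least i. It is preserved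
  -- because no such prime contains all linear forms. For i = s = ht 𝔫 a minimal prime strictly
  -- below 𝔫 would already have height s, so none remains.
  obtain ⟨y, hy⟩ := exists_seq_of_initialIdeal (E := 𝒜 1) (R := fun _ _ => True)
    (C := fun i 𝔣 => 𝔣.IsHomogeneous 𝒜 ∧ ∀ P ∈ 𝔣.minimalPrimes, P ≠ 𝔫 → (i : ℕ∞) ≤ P.height)
    ⟨Ideal.IsHomogeneous.bot 𝒜, by simp⟩ (by
      classical
      rintro i 𝔣 - ⟨hhom, hC⟩
      have hfin := 𝔣.finite_minimalPrimes_of_isNoetherianRing S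
      obtain ⟨v, hv⟩ := exists_notMem_of_top_notMem (k := k) (E := 𝒜 1)
        (s := (hfin.toFinset.filter (· ≠ 𝔫)).image fun P =>
          (P.restrictScalars k).comap (𝒜 1).subtype) (by
          simp only [Finset.mem_image, Finset.mem_filter, Set.Finite.mem_toFinset, not_exists,
            not_and, and_imp]
          intro P hP hPn htop
          refine hPn (le_antisymm (le_irrelevant_of_mem_minimalPrimes 𝒜 hhom hP) ?_)
          rw [h𝔫, ← span_degree_one, Ideal.span_le]
          intro x hx
          have : (⟨x, hx⟩ : 𝒜 1) ∈ (P.restrictScalars k).comap (𝒜 1).subtype := htop ▸ trivial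
          exact this)
      have hhom' : (𝔣 ⊔ Ideal.span {(v : S)}).IsHomogeneous 𝒜 :=
        hhom.sup (Ideal.homogeneous_span 𝒜 _ (by rintro _ rfl; exact ⟨1, v.2⟩))
      refine ⟨v, v.2, trivial, hhom', fun P hP hPn => ?_⟩
      have hPp : P.IsPrime := hP.1.1
      obtain ⟨Q, hQ, hQP⟩ := Ideal.exists_minimalPrimes_le (le_sup_left.trans hP.1.2)
      have hQp : Q.IsPrime := hQ.1.1
      have hPle := le_irrelevant_of_mem_minimalPrimes 𝒜 hhom' hP
      have hQn : Q ≠ 𝔫 := by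
        rintro rfl
        exact hPn (le_antisymm hPle hQP)
      have hvQ : (v : S) ∉ Q := hv ((Q.restrictScalars k).comap (𝒜 1).subtype)
        (Finset.mem_image_of_mem _ (by simp [hQ, hQn]))
      have hlt : Q < P := lt_of_le_of_ne hQP (by
        rintro rfl
        exact hvQ (hP.1.2 (Ideal.mem_sup_right (Ideal.mem_span_singleton_self _))))
      calc ((i + 1 : ℕ) : ℕ∞) ≤ Q.height + 1 := by push_cast; gcongr; exact hC Q hQ hQn
        _ ≤ P.height := Ideal.height_add_one_le_of_lt_of_isPrime hlt)
  refine ⟨y, fun i => (hy i).1, exists_irrelevant_pow_le fun P hP => ?_⟩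
  by_contra hPn
  have hPp : P.IsPrime := hP.1.1
  have h1 := (hy s).2.2.2 P hP hPn
  have h2 := Ideal.height_add_one_le_of_lt_of_isPrime
    (lt_of_le_of_ne (le_irrelevant_of_mem_minimalPrimes 𝒜 (hy s).2.2.1 hP) hPn)
  rw [← h𝔫, hs] at h2
  have h3 : ((s : ℕ∞) + 1) ≤ s := (add_le_add_left h1 1).trans h2
  exact absurd h3 (by exact_mod_cast Nat.not_succ_le_self s)

theorem ringKrullDim_le_height_irrelevant [Infinite k] [IsNoetherianRing S] {s : ℕ}
    (hs : (HomogeneousIdeal.irrelevant 𝒜).toIdeal.height = s) : ringKrullDim S ≤ s := by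
  obtain ⟨y, hy, N, hN⟩ := exists_linear_parameters 𝒜 hs
  refine ringKrullDim_le_of_pow_le_span_mul (k := k) (T := 𝒜 1) (N := N)
    (Module.Finite.iff_fg.1 IsStandardGraded.finite_degree_one)
    IsStandardGraded.adjoin_degree_one (fun i : Fin s => y i) ?_
  have hrange : Set.range (fun i : Fin s => y i) = y '' Set.Iio s := by
    ext x
    simp only [Set.mem_range, Set.mem_image, Set.mem_Iio]
    exact ⟨fun ⟨i, hi⟩ => ⟨i, i.2, hi⟩, fun ⟨i, hi, h⟩ => ⟨⟨i, hi⟩, h⟩⟩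
  have hgen := generatedInDegree_initialIdeal hy s
  rw [hrange, ← degreePart_span_eq 𝒜 (X := y '' Set.Iio s)
    (by rintro _ ⟨j, -, rfl⟩; exact hy j), ← degree_eq_pow, ← degree_eq_pow, add_comm]
  have h1 := hgen.degreePart_add N
  rw [initialIdeal] at h1
  rw [← h1]
  exact fun x hx => ⟨hN (mem_irrelevant_pow (by omega) hx), hx⟩

/-- S is finite over the polynomial ring in ht 𝔫 linear parameters, so dim S ≤ ht 𝔫; this transfers
the dimension of S to the localization at 𝔫. -/
theorem height_irrelevant [Infinite k] [IsNoetherianRing S] {d : ℕ} (hd : ringKrullDim S = d) :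
    (HomogeneousIdeal.irrelevant 𝒜).toIdeal.height = d := by
  have hp : (HomogeneousIdeal.irrelevant 𝒜).toIdeal.IsPrime :=
    IsStandardGraded.isPrime_irrelevant 𝒜
  obtain ⟨s, hs⟩ := ENat.ne_top_iff_exists.1
    (Ideal.height_ne_top_of_isPrime (I := (HomogeneousIdeal.irrelevant 𝒜).toIdeal))
  have h1 := ringKrullDim_le_height_irrelevant 𝒜 hs.symm
  have h2 := Ideal.height_le_ringKrullDim_of_isPrime
    (I := (HomogeneousIdeal.irrelevant 𝒜).toIdeal)
  rw [← hs, hd] at h2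
  rw [hd] at h1
  rw [← hs]
  exact_mod_cast le_antisymm (by exact_mod_cast h2) (by exact_mod_cast h1)

/-- The Hilbert function of a standard graded algebra of dimension `d > 0` is bounded by a
polynomial of degree `d - 1`. -/
theorem exists_finrank_degree_le [Infinite k] [IsNoetherianRing S] {d : ℕ}
    (hd : ringKrullDim S = (d + 1 : ℕ)) :
    ∃ C, ∀ n, Module.finrank k (𝒜 n) ≤ C * (n + 1) ^ d := by
  obtain ⟨y, hy, N, hN⟩ := exists_linear_parameters 𝒜 (height_irrelevant 𝒜 hd)
  set 𝔫 := (HomogeneousIdeal.irrelevant 𝒜).toIdeal with h𝔫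
  have hy𝔫 : ∀ i, y i ∈ degreePart 𝒜 𝔫 1 := fun i =>
    ⟨HomogeneousIdeal.mem_irrelevant_of_mem 𝒜 one_pos (hy i), hy i⟩
  have hgen := generatedInDegree_irrelevant 𝒜
  -- The difference chain is applied to J = 𝔫 with r = 1 and m = 0, where the component of 𝔫ⁿ⁺¹ is
  -- all of degree n + 1. The upper estimate needs no filter-regularity.
  have hzero : ∀ n, N ≤ n → reductionHilbert 𝒜 𝔫 1 (initialIdeal y (d + 1)) 0 n = 0 := by
    intro n hn
    refine Nat.sub_eq_zero_of_le (Submodule.finrank_mono fun x hx => ⟨?_, hx.2⟩)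
    have h1 := hx.2
    have h2 := (generatedInDegree_initialIdeal hy (d + 1)).degreePart_add n
    rw [show 1 * (n + 1) + 0 = 1 + n by ring] at h1
    have h3 : x ∈ degreePart 𝒜 (initialIdeal y (d + 1)) (1 + n) :=
      ⟨hN (mem_irrelevant_pow (by omega) h1), h1⟩
    rw [h2] at h3
    refine Submodule.mul_induction_on h3 ?_ ?_
    · intro a ha b hb
      exact Ideal.mul_mem_mul ha.1 (mem_irrelevant_pow le_rfl hb)
    · intro a b ha hb
      exact add_mem ha hb
  obtain ⟨w, hw⟩ := le_choose_of_succ_le (s := d) (q := reductionHilbert 𝒜 𝔫 1 (initialIdeal y d) 0 N)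
    (a := fun i n => reductionHilbert 𝒜 𝔫 1 (initialIdeal y i) 0 n) (n₁ := N)
    (fun i hi n hn => by
      simp only [initialIdeal_succ]
      exact reductionHilbert_succ_le 𝒜 hgen (generatedInDegree_initialIdeal hy i).isHomogeneous
        (initialIdeal_le (fun i => (hy𝔫 i).1) i) (hy𝔫 i) 0 n)
    (fun n hn => by
      induction n, hn using Nat.le_induction with
      | base => exact le_rfl
      | succ n hn ih =>
        refine (reductionHilbert_succ_le 𝒜 hgen
          (generatedInDegree_initialIdeal hy d).isHomogeneous
          (initialIdeal_le (fun i => (hy𝔫 i).1) d) (hy𝔫 d) 0 n).trans ?_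
        rw [← initialIdeal_succ, hzero _ (by omega), zero_add]
        exact ih)
  have hval : ∀ n, reductionHilbert 𝒜 𝔫 1 (initialIdeal y 0) 0 n = Module.finrank k (𝒜 (n + 1)) := by
    intro n
    have := degreePart_irrelevant_pow 𝒜 (n + 1) 0
    rw [reductionHilbert, one_mul, initialIdeal_zero, Ideal.bot_mul, degreePart_bot, finrank_bot,
      Nat.sub_zero]
    rw [this, add_zero]
  let C := reductionHilbert 𝒜 𝔫 1 (initialIdeal y d) 0 N + ∑ j ∈ Finset.range d, w j
  let C' := ∑ n ∈ Finset.range (N + 1), Module.finrank k (𝒜 n)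
  refine ⟨C + C', fun n => ?_⟩
  rcases Nat.lt_or_ge n (N + 1) with hn | hn
  · have h1 : Module.finrank k (𝒜 n) ≤ C' := Finset.single_le_sum
      (f := fun n => Module.finrank k (𝒜 n)) (fun _ _ => Nat.zero_le _) (Finset.mem_range.2 hn)
    have h2 : 1 ≤ (n + 1) ^ d := Nat.one_le_pow _ _ (by omega)
    nlinarith [Nat.zero_le C]
  · obtain ⟨m, rfl⟩ := Nat.exists_eq_add_of_le hn
    have h1 := (hw m).trans (choose_sum_le_pow _ d w m)
    simp only [hval] at h1
    rw [show N + 1 + m = N + m + 1 by ring]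
    refine h1.trans ((Nat.mul_le_mul_left _ (Nat.pow_le_pow_left (by omega) d)).trans
      (Nat.mul_le_mul_right _ (Nat.le_add_right C C')))

end Irrelevant

/-! ### Spanning as a Zariski-open condition -/

section OpenConditions

variable {k : Type*} [Field k]

/-- Spanning a finite-dimensional space is an open condition on linearly varying vectors. -/
theorem exists_eval_ne_zero_of_span_eq_top {W Q ι : Type*} [AddCommGroup W] [Module k W]
    [AddCommGroup Q] [Module k Q] [Module.Finite k Q] (L : ι → W →ₗ[k] Q) {w₀ : W}
    (hw₀ : Submodule.span k (Set.range fun i => L i w₀) = ⊤) :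
    ∃ p : MvPolynomial (Module.Dual k W) k,
      MvPolynomial.eval (fun l : Module.Dual k W => l w₀) p ≠ 0 ∧
      ∀ w, MvPolynomial.eval (fun l : Module.Dual k W => l w) p ≠ 0 →
        Submodule.span k (Set.range fun i => L i w) = ⊤ := by
  obtain ⟨v, hv, hspan, hli⟩ :=
    Submodule.exists_fun_fin_finrank_span_eq k (Set.range fun i => L i w₀)
  have hspan := hspan.trans hw₀
  choose i hi using hv
  -- A basis selected among the vectors at w₀. The determinant of the same vectors at w in this
  -- basis is a polynomial in linear forms with value 1 at w₀.
  let b := Module.Basis.mk hli hspan.ge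
  let A : Matrix _ _ (MvPolynomial (Module.Dual k W) k) :=
    Matrix.of fun a c => MvPolynomial.X ((b.coord a).comp (L (i c)))
  have heval : ∀ w, MvPolynomial.eval (fun l : Module.Dual k W => l w) A.det =
      b.det fun c => L (i c) w := by
    intro w
    rw [RingHom.map_det, Module.Basis.det_apply]
    congr 1
    ext a c
    simp [A, Module.Basis.toMatrix_apply]
  refine ⟨A.det, ?_, fun w hw => ?_⟩
  · rw [heval, ← isUnit_iff_ne_zero, ← Module.Basis.is_basis_iff_det]
    have : (fun c => L (i c) w₀) = v := funext hi
    rw [this]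
    exact ⟨hli, hspan⟩
  · rw [heval, ← isUnit_iff_ne_zero, ← Module.Basis.is_basis_iff_det] at hw
    rw [eq_top_iff, ← hw.2]
    exact Submodule.span_mono (by rintro _ ⟨c, rfl⟩; exact ⟨i c, rfl⟩)

/-- The inclusion says that the classes of the products f_j x, with x in X, span Y / (Z ∩ Y), and
these classes are linear in f. -/
theorem exists_eval_ne_zero_of_le_sup_span_mul {S : Type*} [CommRing S] [Algebra k S]
    {E X Y Z : Submodule k S} [Module.Finite k Y] (hXY : E * X ≤ Y) {n : ℕ} {f₀ : Fin n → E}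
    (hf₀ : Y ≤ Z ⊔ Submodule.span k (Set.range fun j => (f₀ j : S)) * X) :
    ∃ p : MvPolynomial (Module.Dual k (Fin n → E)) k,
      MvPolynomial.eval (fun l : Module.Dual k (Fin n → E) => l f₀) p ≠ 0 ∧
      ∀ f, MvPolynomial.eval (fun l : Module.Dual k (Fin n → E) => l f) p ≠ 0 →
        Y ≤ Z ⊔ Submodule.span k (Set.range fun j => (f j : S)) * X := by
  let L : Fin n × X → (Fin n → E) →ₗ[k] (Y ⧸ Z.submoduleOf Y) := fun i =>
    (Z.submoduleOf Y).mkQ.comp ((((LinearMap.mulRight k (i.2 : S)).comp E.subtype).codRestrict Y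
      fun e => hXY (Submodule.mul_mem_mul e.2 i.2.2)).comp (LinearMap.proj i.1))
  have key : ∀ f : Fin n → E, Submodule.span k (Set.range fun i => L i f) = ⊤ ↔
      Y ≤ Z ⊔ Submodule.span k (Set.range fun j => (f j : S)) * X := by
    intro f
    have hle : Submodule.span k (Set.range fun j => (f j : S)) * X ≤ Y :=
      (mul_le_mul_left (Submodule.span_le.2 (by rintro _ ⟨j, rfl⟩; exact (f j).2)) X).trans
        hXY
    have h1 : Submodule.span k (Set.range fun i => L i f) =
        ((Submodule.span k (Set.range fun j => (f j : S)) * X).submoduleOf Y).map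
          (Z.submoduleOf Y).mkQ := by
      refine le_antisymm (Submodule.span_le.2 ?_) ?_
      · rintro _ ⟨⟨j, x⟩, rfl⟩
        exact ⟨⟨f j * x, hXY (Submodule.mul_mem_mul (f j).2 x.2)⟩,
          Submodule.mul_mem_mul (Submodule.subset_span ⟨j, rfl⟩) x.2, rfl⟩
      · rintro _ ⟨⟨y, hy⟩, hy', rfl⟩
        have hy'' : y ∈ Submodule.span k (Set.range fun j => (f j : S)) * X := hy'
        suffices ∃ hy : y ∈ Y, (Z.submoduleOf Y).mkQ ⟨y, hy⟩ ∈
            Submodule.span k (Set.range fun i => L i f) from this.2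
        refine Submodule.mul_induction_on hy'' ?_ ?_
        · intro a ha x hx
          refine Submodule.span_induction ?_ ?_ ?_ ?_ ha
          · rintro _ ⟨j, rfl⟩
            exact ⟨hXY (Submodule.mul_mem_mul (f j).2 hx),
              Submodule.subset_span ⟨(j, ⟨x, hx⟩), rfl⟩⟩
          · exact ⟨by simp, by
              convert Submodule.zero_mem _
              rw [Submodule.mkQ_apply, Submodule.Quotient.mk_eq_zero]
              change 0 * x ∈ Z
              simp⟩
          · rintro a b _ _ ⟨ha, ha'⟩ ⟨hb, hb'⟩
            refine ⟨by rw [add_mul]; exact add_mem ha hb, ?_⟩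
            have := add_mem ha' hb'
            rw [← map_add] at this
            convert this using 2
            exact Subtype.ext (add_mul _ _ _)
          · rintro c a _ ⟨ha, ha'⟩
            refine ⟨by rw [smul_mul_assoc]; exact Submodule.smul_mem _ c ha, ?_⟩
            have := Submodule.smul_mem _ c ha'
            rw [← map_smul] at this
            convert this using 2
            exact Subtype.ext (smul_mul_assoc _ _ _)
        · rintro a b ⟨ha, ha'⟩ ⟨hb, hb'⟩
          have := add_mem ha' hb'
          rw [← map_add] at this
          exact ⟨add_mem ha hb, this⟩
    rw [h1]
    constructor
    · intro htop y hy
      have : (Z.submoduleOf Y).mkQ ⟨y, hy⟩ ∈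
          ((Submodule.span k (Set.range fun j => (f j : S)) * X).submoduleOf Y).map
            (Z.submoduleOf Y).mkQ := htop ▸ trivial
      obtain ⟨⟨u, hu⟩, hu', huy⟩ := this
      rw [← sub_eq_zero, ← map_sub, Submodule.mkQ_apply, Submodule.Quotient.mk_eq_zero] at huy
      have hz : u - y ∈ Z := huy
      have h2 : u ∈ Submodule.span k (Set.range fun j => (f j : S)) * X := hu'
      have : u - (u - y) ∈ Z ⊔ Submodule.span k (Set.range fun j => (f j : S)) * X :=
        sub_mem (Submodule.mem_sup_right h2) (Submodule.mem_sup_left hz)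
      convert this using 1
      ring
    · intro h
      rw [eq_top_iff]
      rintro q -
      obtain ⟨⟨y, hy⟩, rfl⟩ := Submodule.mkQ_surjective _ q
      obtain ⟨z, hz, u, hu, rfl⟩ := Submodule.mem_sup.1 (h hy)
      refine ⟨⟨u, hle hu⟩, hu, ?_⟩
      rw [← sub_eq_zero, ← map_sub, Submodule.mkQ_apply, Submodule.Quotient.mk_eq_zero]
      change u - (z + u) ∈ Z
      simpa using hz
  obtain ⟨p, hp₀, hp⟩ := exists_eval_ne_zero_of_span_eq_top L ((key f₀).2 hf₀)
  exact ⟨p, hp₀, fun f hf => (key f).1 (hp f hf)⟩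

theorem holdsForGeneral_of_eval_ne_zero {V : Type*} [AddCommGroup V] [Module k V] {Q : V → Prop}
    (p : MvPolynomial (Module.Dual k V) k) {v₀ : V}
    (hp : MvPolynomial.eval (fun l : Module.Dual k V => l v₀) p ≠ 0)
    (h : ∀ v, MvPolynomial.eval (fun l : Module.Dual k V => l v) p ≠ 0 → Q v) :
    HoldsForGeneral k Q :=
  ⟨{v | MvPolynomial.eval (fun l : Module.Dual k V => l v) p ≠ 0}, ⟨{p}, by simp⟩, ⟨v₀, hp⟩, h⟩

end OpenConditions

section DegreePartSup

variable {k S : Type*} [Field k] [CommRing S] [Algebra k S]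
  {𝒜 : ℕ → Submodule k S} [GradedAlgebra 𝒜]

theorem degreePart_sup_le {I J : Ideal S} (hI : I.IsHomogeneous 𝒜) (hJ : J.IsHomogeneous 𝒜)
    (e : ℕ) : degreePart 𝒜 (I ⊔ J) e ≤ degreePart 𝒜 I e ⊔ degreePart 𝒜 J e := by
  intro x hx
  obtain ⟨a, ha, b, hb, hab⟩ := Submodule.mem_sup.1 hx.1
  rw [← coe_decompose_of_mem hx.2, ← hab, DirectSum.decompose_add]
  exact add_mem (Submodule.mem_sup_left (decompose_mem_degreePart hI ha e))
    (Submodule.mem_sup_right (decompose_mem_degreePart hJ hb e))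

/-- A power of `𝔮` kills `L` modulo `𝔟` as soon as each element of `L` is killed by a power. -/
theorem exists_pow_mul_le [IsNoetherianRing S] {𝔮 L 𝔟 : Ideal S}
    (h : ∀ z ∈ L, ∃ N, ∀ b ∈ 𝔮 ^ N, b * z ∈ 𝔟) : ∃ N, 𝔮 ^ N * L ≤ 𝔟 := by
  obtain ⟨T, rfl⟩ := (isNoetherianRing_iff_ideal_fg S).1 inferInstance L
  choose! N hN using h
  refine ⟨T.sup N, Ideal.mul_le.2 fun b hb z hz => ?_⟩
  refine Submodule.span_induction ?_ ?_ ?_ ?_ hz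
  · intro z hz
    exact hN z (Submodule.subset_span hz) b (Ideal.pow_le_pow_right (Finset.le_sup hz) hb)
  · simp
  · intro a c _ _ ha hc
    rw [mul_add]; exact add_mem ha hc
  · intro a c _ hc
    rw [smul_eq_mul, mul_left_comm]; exact Ideal.mul_mem_left _ _ hc

end DegreePartSup

/-! ### Filter-regular sequences and the leading coefficients c(m) -/

section FilterRegularSequences

variable {k S : Type*} [Field k] [CommRing S] [Algebra k S]
  (𝒜 : ℕ → Submodule k S) [GradedAlgebra 𝒜] [IsStandardGraded 𝒜]

theorem exists_filterRegular_seq [Infinite k] [IsNoetherianRing S] {J : Ideal S} {r d : ℕ}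
    (hJ : GeneratedInDegree 𝒜 J r) (hG : SatisfiesG J d) :
    ∃ f : ℕ → S, (∀ i, f i ∈ degreePart 𝒜 J r) ∧
      (∀ i, IsFilterRegularOn J (initialIdeal f i) (f i)) ∧
      ∀ i, HasResidualHeight J (initialIdeal f i) d i := by
  classical
  obtain ⟨f, hf⟩ := exists_seq_of_initialIdeal (E := degreePart 𝒜 J r)
    (R := fun 𝔣 v => IsFilterRegularOn J 𝔣 v) (C := fun i 𝔣 => HasResidualHeight J 𝔣 d i)
    hG.hasResidualHeight (fun i 𝔣 h𝔣 hC => by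
      rw [hJ.span_degreePart] at h𝔣
      obtain ⟨s₁, hs₁, H₁⟩ := exists_finset_isFilterRegularOn h𝔣 hJ.span_degreePart
      obtain ⟨s₂, hs₂, H₂⟩ := exists_finset_hasResidualHeight hC hJ.span_degreePart
      obtain ⟨v, hv⟩ := exists_notMem_of_top_notMem (k := k) (s := s₁ ∪ s₂)
        (by simp [hs₁, hs₂])
      exact ⟨v, v.2, H₁ v fun p hp => hv p (Finset.mem_union_left _ hp),
        H₂ v fun p hp => hv p (Finset.mem_union_right _ hp)⟩)
  exact ⟨f, fun i => (hf i).1, fun i => (hf i).2.1, fun i => (hf i).2.2⟩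

/-- For s = 0 the residual ideal is J + (𝔣 : J), and the height condition gives its primes height at
least d = ht 𝔫. Its minimal primes are homogeneous, hence contained in 𝔫 and so equal to it. -/
theorem exists_irrelevant_pow_le_colon_sup [Infinite k] [IsNoetherianRing S] {J : Ideal S}
    {r d i : ℕ} (hJ : GeneratedInDegree 𝒜 J r) (hd : ringKrullDim S = d) {𝔣 : Ideal S}
    (h𝔣 : 𝔣.IsHomogeneous 𝒜) (hid : i + 1 = d) (h : HasResidualHeight J 𝔣 d i) :
    ∃ t, (HomogeneousIdeal.irrelevant 𝒜).toIdeal ^ t ≤ J ⊔ 𝔣.colon (J : Set S) := by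
  refine exists_irrelevant_pow_le fun P hP => ?_
  have hPp : P.IsPrime := hP.1.1
  have h𝔫p : (HomogeneousIdeal.irrelevant 𝒜).toIdeal.IsPrime :=
    IsStandardGraded.isPrime_irrelevant 𝒜
  have hhom : (J ⊔ 𝔣.colon (J : Set S)).IsHomogeneous 𝒜 :=
    hJ.isHomogeneous.sup (isHomogeneous_colon h𝔣 hJ)
  have hle := le_irrelevant_of_mem_minimalPrimes 𝒜 hhom hP
  have h1 := h 0 P (by
    refine sup_le (le_sup_left.trans hP.1.2) (iSup_le fun g => ?_)
    simpa using le_sup_right.trans hP.1.2)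
  rw [show min d (i + 0 + 1) = d by omega] at h1
  by_contra hne
  have h2 := Ideal.height_add_one_le_of_lt_of_isPrime (lt_of_le_of_ne hle hne)
  rw [height_irrelevant 𝒜 hd] at h2
  exact absurd ((add_le_add_left h1 1).trans h2) (by exact_mod_cast Nat.not_succ_le_self d)

variable {J : Ideal S} {r : ℕ} {f : ℕ → S}

theorem eventually_reductionHilbert_succ (hJ : GeneratedInDegree 𝒜 J r)
    (hf : ∀ i, f i ∈ degreePart 𝒜 J r) (hreg : ∀ i, IsFilterRegularOn J (initialIdeal f i) (f i))
    (s : ℕ) : ∃ n₀, ∀ i < s, ∀ n, n₀ ≤ n → ∀ m,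
      reductionHilbert 𝒜 J r (initialIdeal f i) m (n + 1) =
        reductionHilbert 𝒜 J r (initialIdeal f (i + 1)) m (n + 1) +
          reductionHilbert 𝒜 J r (initialIdeal f i) m n := by
  choose N hN using hreg
  refine ⟨(Finset.range s).sup N, fun i hi n hn m => ?_⟩
  rw [initialIdeal_succ]
  exact reductionHilbert_succ_eq 𝒜 hJ
    (generatedInDegree_initialIdeal (fun i => (hf i).2) i).isHomogeneous
    (initialIdeal_le (fun i => (hf i).1) i) (hf i)
    (hN i n ((Finset.le_sup (Finset.mem_range.2 hi)).trans hn)) m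

theorem reductionHilbert_bot (m n : ℕ) : reductionHilbert 𝒜 J r (initialIdeal f 0) m n =
    Module.finrank k (degreePart 𝒜 (J ^ (n + 1)) (r * (n + 1) + m)) := by
  rw [reductionHilbert, initialIdeal_zero, Ideal.bot_mul, degreePart_bot, finrank_bot,
    Nat.sub_zero]

theorem exists_choose_gt (K N s : ℕ) :
    ∃ n, K * (N + n + 1) ^ s < n.choose (s + 1) := by
  by_contra! h
  -- The first term beats the constant from the factorial and the power of 2; the summands N + s + 1
  -- give N + (M + s) + 1 ≤ 2M.
  let M := (s + 1)! * K * 2 ^ s + N + s + 1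
  have h1 := h (M + s)
  have h2 : (M : ℕ) ^ (s + 1) ≤ (s + 1)! * (M + s).choose (s + 1) := by
    have := Nat.pow_le_choose (α := ℚ) (s + 1) (M + s)
    have h4 : M + s + 1 - (s + 1) = M := by omega
    rw [h4, div_le_iff₀' (by positivity)] at this
    exact_mod_cast this
  have h3 : (N + (M + s) + 1) ^ s ≤ 2 ^ s * M ^ s := by
    rw [← mul_pow]
    exact Nat.pow_le_pow_left (by omega) s
  have h4 : M ^ (s + 1) ≤ ((s + 1)! * K * 2 ^ s) * M ^ s := by
    calc M ^ (s + 1) ≤ (s + 1)! * (K * (2 ^ s * M ^ s)) :=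
          h2.trans (Nat.mul_le_mul_left _ (h1.trans (Nat.mul_le_mul_left _ h3)))
      _ = _ := by ring
  rw [pow_succ'] at h4
  have h5 := Nat.le_of_mul_le_mul_right h4 (by positivity)
  omega

/-- If the last difference function never vanished, summing δ + 1 times would give growth of order δ
+ 1 for components of S, whose dimensions are O(nᵟ). One vanishing in the generating degree r(n+1)
yields the inclusion of ideals for all later n. -/
theorem exists_pow_le_initialIdeal_mul [Infinite k] [IsNoetherianRing S]
    (hJ : GeneratedInDegree 𝒜 J r) {δ : ℕ} (hd : ringKrullDim S = (δ + 1 : ℕ))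
    (hf : ∀ i, f i ∈ degreePart 𝒜 J r)
    (hreg : ∀ i, IsFilterRegularOn J (initialIdeal f i) (f i)) :
    ∃ N, ∀ n, N ≤ n → J ^ (n + 1) ≤ initialIdeal f (δ + 1) * J ^ n := by
  obtain ⟨C, hC⟩ := exists_finrank_degree_le 𝒜 hd
  obtain ⟨n₀, hn₀⟩ := eventually_reductionHilbert_succ 𝒜 hJ hf hreg (δ + 1)
  have hzero : ∃ n, reductionHilbert 𝒜 J r (initialIdeal f (δ + 1)) 0 n = 0 := by
    by_contra! hpos
    have hl := choose_le_of_le_succ (s := δ + 1) (q := 1) (n₁ := n₀)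
      (a := fun i n => reductionHilbert 𝒜 J r (initialIdeal f i) 0 n)
      (fun i hi n hn => (hn₀ i hi n hn 0).ge) (fun n _ => Nat.one_le_iff_ne_zero.2 (hpos n))
    obtain ⟨n, hn⟩ := exists_choose_gt (C * (r + 1) ^ δ) n₀ δ
    refine absurd hn (not_lt.2 ?_)
    have h1 := hl n
    rw [one_mul, reductionHilbert_bot] at h1
    refine h1.trans ((Submodule.finrank_mono (degreePart_le _ _)).trans ((hC _).trans ?_))
    rw [mul_assoc, ← mul_pow]
    refine Nat.mul_le_mul_left _ (Nat.pow_le_pow_left ?_ δ)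
    nlinarith
  obtain ⟨N, hN⟩ := hzero
  have hle : initialIdeal f (δ + 1) ≤ J := initialIdeal_le (fun i => (hf i).1) _
  have hbase : J ^ (N + 1) ≤ initialIdeal f (δ + 1) * J ^ N := by
    have h1 := reductionHilbert_add 𝒜 (r := r) hle 0 N
    rw [hN, zero_add] at h1
    have h2 := Submodule.eq_of_le_of_finrank_eq
      (degreePart_mono (𝒜 := 𝒜) (mul_pow_le_pow_succ hle N) (r * (N + 1) + 0)) h1
    rw [← (hJ.pow (N + 1)).span_degreePart, Ideal.span_le]
    intro x hx
    rw [← add_zero (r * (N + 1)), ← h2] at hx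
    exact hx.1
  refine ⟨N, fun n hn => ?_⟩
  obtain ⟨j, rfl⟩ := Nat.exists_eq_add_of_le hn
  rw [show N + j + 1 = N + 1 + j by ring, pow_add, pow_add J N j, ← mul_assoc]
  exact Ideal.mul_mono_left hbase

theorem reductionHilbert_eq_zero {𝔣 : Ideal S} {n : ℕ} (h : J ^ (n + 1) ≤ 𝔣 * J ^ n) (m : ℕ) :
    reductionHilbert 𝒜 J r 𝔣 m n = 0 :=
  Nat.sub_eq_zero_of_le (finrank_degreePart_mono 𝒜 h _)

/-- For a filter-regular sequence, the leading coefficients of the polynomials counting the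
elements of `Jⁿ⁺¹` of degree `r (n + 1) + m` are the values of the last difference function. -/
theorem exists_tendsto_finrank_degreePart_pow [Infinite k] [IsNoetherianRing S]
    (hJ : GeneratedInDegree 𝒜 J r) {δ : ℕ} (hd : ringKrullDim S = (δ + 1 : ℕ))
    (hf : ∀ i, f i ∈ degreePart 𝒜 J r)
    (hreg : ∀ i, IsFilterRegularOn J (initialIdeal f i) (f i)) :
    ∃ n₂, J ^ (n₂ + 1) ≤ initialIdeal f (δ + 1) * J ^ n₂ ∧ ∀ m,
      Tendsto (fun n : ℕ => (Module.finrank k (degreePart 𝒜 (J ^ (n + 1)) (r * (n + 1) + m)) : ℝ) /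
        (n : ℝ) ^ δ) atTop
        (𝓝 (reductionHilbert 𝒜 J r (initialIdeal f δ) m n₂ / (δ ! : ℝ))) := by
  obtain ⟨N, hN⟩ := exists_pow_le_initialIdeal_mul 𝒜 hJ hd hf hreg
  obtain ⟨n₀, hn₀⟩ := eventually_reductionHilbert_succ 𝒜 hJ hf hreg (δ + 1)
  refine ⟨max N n₀, hN _ (le_max_left _ _), fun m => ?_⟩
  have hconst : ∀ n, max N n₀ ≤ n → reductionHilbert 𝒜 J r (initialIdeal f δ) m n =
      reductionHilbert 𝒜 J r (initialIdeal f δ) m (max N n₀) := by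
    intro n hn
    induction n, hn using Nat.le_induction with
    | base => rfl
    | succ n hn ih =>
      rw [hn₀ δ (Nat.lt_succ_self δ) n ((le_max_right _ _).trans hn),
        reductionHilbert_eq_zero 𝒜 (hN (n + 1) (by omega)), zero_add, ih]
  obtain ⟨w, hw⟩ := le_choose_of_succ_le (s := δ) (n₁ := max N n₀)
    (a := fun i n => reductionHilbert 𝒜 J r (initialIdeal f i) m n)
    (fun i hi n hn => (hn₀ i (by omega) n ((le_max_right _ _).trans hn) m).le)
    (fun n hn => (hconst n hn).le)
  have hl := choose_le_of_le_succ (s := δ) (n₁ := max N n₀)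
    (a := fun i n => reductionHilbert 𝒜 J r (initialIdeal f i) m n)
    (fun i hi n hn => (hn₀ i (by omega) n ((le_max_right _ _).trans hn) m).ge)
    (fun n hn => (hconst n hn).ge)
  simpa only [reductionHilbert_bot] using tendsto_div_pow_of_choose_bounds hw hl

/-- The Hilbert function of S bounds each component; for fixed m the shift by m disappears in the
limit over n, so the bound does not depend on m. -/
theorem exists_bound_of_tendsto [Infinite k] [IsNoetherianRing S] {δ : ℕ}
    (hd : ringKrullDim S = (δ + 1 : ℕ)) {c : ℕ → ℕ}
    (hc : ∀ m, Tendsto (fun n : ℕ =>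
      (Module.finrank k (degreePart 𝒜 (J ^ (n + 1)) (r * (n + 1) + m)) : ℝ) / (n : ℝ) ^ δ) atTop
        (𝓝 (c m / (δ ! : ℝ)))) : ∃ B, ∀ m, c m ≤ B := by
  obtain ⟨C, hC⟩ := exists_finrank_degree_le 𝒜 hd
  refine ⟨δ ! * (C * (r + 1) ^ δ), fun m => ?_⟩
  have hlim : Tendsto (fun n : ℕ => ((C * (r + 1) ^ δ : ℕ) : ℝ) *
      (((r + m + 1 + n : ℕ) : ℝ) ^ δ / (n : ℝ) ^ δ)) atTop
      (𝓝 (((C * (r + 1) ^ δ : ℕ) : ℝ) * 1)) := by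
    refine Tendsto.const_mul _ ?_
    have := (tendsto_add_pow_div_pow (r + m + 1) δ).inv₀ one_ne_zero
    rw [inv_one] at this
    exact this.congr fun n => by rw [inv_div]
  have h := le_of_tendsto_of_tendsto' (hc m) hlim fun n => by
    rw [mul_div_assoc']
    gcongr
    have h1 : Module.finrank k (degreePart 𝒜 (J ^ (n + 1)) (r * (n + 1) + m)) ≤
        C * (r + 1) ^ δ * (r + m + 1 + n) ^ δ := by
      refine (Submodule.finrank_mono (degreePart_le _ _)).trans ((hC _).trans ?_)
      rw [mul_assoc, ← mul_pow]
      refine Nat.mul_le_mul_left _ (Nat.pow_le_pow_left ?_ δ)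
      nlinarith [Nat.zero_le (r * m), Nat.zero_le (r * r)]
    exact_mod_cast h1
  rw [mul_one, div_le_iff₀ (by positivity), mul_comm] at h
  exact_mod_cast h

theorem exists_eq_of_monotone_of_bounded {c : ℕ → ℕ} {D B : ℕ}
    (hmono : ∀ m, D ≤ m → c m ≤ c (m + 1)) (hB : ∀ m, c m ≤ B) :
    ∃ m₁, D ≤ m₁ ∧ ∀ m, m₁ ≤ m → c m = c m₁ := by
  classical
  have hex : ∃ v, ∃ m, D ≤ m ∧ B - c m = v := ⟨_, D, le_rfl, rfl⟩
  obtain ⟨m₁, hD, hm₁⟩ := Nat.find_spec hex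
  refine ⟨m₁, hD, fun m hm => ?_⟩
  have h1 : c m₁ ≤ c m := by
    induction m, hm using Nat.le_induction with
    | base => exact le_rfl
    | succ n hn ih => exact ih.trans (hmono n (hD.trans hn))
  have h2 := Nat.find_min' hex ⟨m, hD.trans hm, rfl⟩
  have := hB m
  omega

/-- If the Hilbert function of `Jⁿ⁺¹ / 𝔣 Jⁿ` is bounded, then multiplication by a general linear
form is bijective in large degrees. -/
theorem exists_linear_form_surjective [Infinite k] [IsNoetherianRing S] {𝔣 : Ideal S} (h𝔣J : 𝔣 ≤ J)
    (n : ℕ) {B : ℕ} (hB : ∀ m, reductionHilbert 𝒜 J r 𝔣 m n ≤ B) :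
    ∃ x ∈ 𝒜 1, ∃ m₁, (∀ m, m₁ ≤ m →
      reductionHilbert 𝒜 J r 𝔣 m n = reductionHilbert 𝒜 J r 𝔣 m₁ n) ∧
      degreePart 𝒜 (J ^ (n + 1)) (r * (n + 1) + m₁ + 1) ≤
        degreePart 𝒜 (𝔣 * J ^ n) (r * (n + 1) + m₁ + 1) ⊔
          (degreePart 𝒜 (J ^ (n + 1)) (r * (n + 1) + m₁)).map (LinearMap.mulLeft k x) := by
  obtain ⟨s, hs, H⟩ := exists_finset_torsion_of_mul_mem (𝒜 1).subtype (𝔣 * J ^ n)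
  obtain ⟨⟨x, hx⟩, hxs⟩ := exists_notMem_of_top_notMem (k := k) hs
  have H := H ⟨x, hx⟩ hxs
  rw [show Ideal.span (Set.range (𝒜 1).subtype) = (HomogeneousIdeal.irrelevant 𝒜).toIdeal by
    rw [← span_degree_one]; congr 1; ext; simp] at H
  -- The kernel of multiplication by x is 𝔫-torsion for general x, hence zero in large degrees. The
  -- Hilbert function is therefore increasing in m; being bounded it becomes constant, and
  -- injectivity turns into surjectivity.
  let L : Ideal S := J ^ (n + 1) ⊓ Submodule.comap (LinearMap.mulLeft S x) (𝔣 * J ^ n)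
  obtain ⟨N, hN⟩ := exists_pow_mul_le (𝔮 := (HomogeneousIdeal.irrelevant 𝒜).toIdeal) (L := L)
    (𝔟 := 𝔣 * J ^ n) fun z hz => H z hz.2
  obtain ⟨D, hD⟩ := exists_degreePart_le_mul (𝒜 := 𝒜) (L := L)
    (𝔮 := (HomogeneousIdeal.irrelevant 𝒜).toIdeal ^ N) (t := N)
    fun m hm x hx => mem_irrelevant_pow hm hx
  have hle := mul_pow_le_pow_succ h𝔣J n
  have hstep : ∀ m, D ≤ m →
      Module.finrank k (degreePart 𝒜 (𝔣 * J ^ n) (r * (n + 1) + m + 1) ⊔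
        (degreePart 𝒜 (J ^ (n + 1)) (r * (n + 1) + m)).map (LinearMap.mulLeft k x) :
          Submodule k S) + Module.finrank k (degreePart 𝒜 (𝔣 * J ^ n) (r * (n + 1) + m)) =
      Module.finrank k (degreePart 𝒜 (𝔣 * J ^ n) (r * (n + 1) + m + 1)) +
        Module.finrank k (degreePart 𝒜 (J ^ (n + 1)) (r * (n + 1) + m)) := by
    intro m hm
    refine finrank_add_finrank_eq_of_eq_sup_mul (f := x) le_sup_left le_rfl le_sup_right ?_
    refine le_antisymm (le_inf (degreePart_mono hle _) fun z hz => ?_) ?_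
    · refine ⟨Ideal.mul_mem_left _ _ hz.1, ?_⟩
      rw [add_comm]
      exact SetLike.mul_mem_graded hx hz.2
    · rintro z ⟨hz, hxz⟩
      exact ⟨hN (hD _ (by omega) z ⟨⟨hz.1, hxz.1⟩, hz.2⟩), hz.2⟩
  have hsub : ∀ m, degreePart 𝒜 (𝔣 * J ^ n) (r * (n + 1) + m + 1) ⊔
        (degreePart 𝒜 (J ^ (n + 1)) (r * (n + 1) + m)).map (LinearMap.mulLeft k x) ≤
      degreePart 𝒜 (J ^ (n + 1)) (r * (n + 1) + m + 1) := by
    intro m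
    refine sup_le (degreePart_mono hle _) ?_
    rintro _ ⟨z, hz, rfl⟩
    refine ⟨Ideal.mul_mem_left _ _ hz.1, ?_⟩
    rw [add_comm]
    exact SetLike.mul_mem_graded hx hz.2
  have hadd := fun m => reductionHilbert_add 𝒜 (r := r) h𝔣J m n
  obtain ⟨m₁, hm₁, hconst⟩ := exists_eq_of_monotone_of_bounded
    (c := fun m => reductionHilbert 𝒜 J r 𝔣 m n) (D := D) (fun m hm => by
      have h1 := hstep m hm
      have h2 := Submodule.finrank_mono (hsub m)
      have h3 := hadd m
      have h4 := hadd (m + 1)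
      rw [← add_assoc] at h4
      omega) hB
  refine ⟨x, hx, m₁, hconst, (Submodule.eq_of_le_of_finrank_eq (hsub m₁) ?_).ge⟩
  have h1 := hstep m₁ hm₁
  have h3 := hadd m₁
  have h4 := hadd (m₁ + 1)
  have h5 := hconst (m₁ + 1) (by omega)
  rw [← add_assoc] at h4
  omega

end FilterRegularSequences

/-! ### Comparing S / (𝔣 : J) with Jⁿ⁺¹ / 𝔣Jⁿ -/

section GeneralResidual

variable {k S : Type*} [Field k] [CommRing S] [Algebra k S]
  (𝒜 : ℕ → Submodule k S) [GradedAlgebra 𝒜] [IsStandardGraded 𝒜]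
  {J : Ideal S} {r : ℕ}

/-- Nakayama in the form `exists_pow_add_mem_colon`. It recovers the 𝔫-primary condition on J + (𝔣 :
J) from an inclusion that can be checked in one degree and is therefore open in 𝔣. -/
theorem exists_irrelevant_pow_le_of_pow_mul_le [IsNoetherianRing S] {𝔣 : Ideal S} {t : ℕ}
    (h : (HomogeneousIdeal.irrelevant 𝒜).toIdeal ^ t * J ≤ 𝔣 ⊔ J * J) :
    ∃ t', (HomogeneousIdeal.irrelevant 𝒜).toIdeal ^ t' ≤ J ⊔ 𝔣.colon (J : Set S) := by
  refine Ideal.exists_pow_le_of_le_radical_of_fg (fun a ha => ?_)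
    ((isNoetherianRing_iff_ideal_fg S).1 inferInstance _)
  obtain ⟨n, q, hq, hn⟩ := exists_pow_add_mem_colon (a := a ^ t) (J := J) (𝔣 := 𝔣) (𝔮 := J)
    fun x hx => h (Ideal.mul_mem_mul (Ideal.pow_mem_pow ha t) hx)
  refine ⟨t * n, ?_⟩
  rw [pow_mul, ← add_sub_cancel_right ((a ^ t) ^ n) q]
  exact sub_mem (Ideal.mem_sup_right hn) (Ideal.mem_sup_left hq)

/-- Without filter-regularity the chain inequalities still bound the growth of Jⁿ above by the last
difference function, which is nonincreasing from n₂ on since the next one vanishes after n₂.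
Comparing leading coefficients gives a lower bound valid for every reduction. -/
theorem le_reductionHilbert_of_tendsto {F : ℕ → S} (hJ : GeneratedInDegree 𝒜 J r)
    (hF : ∀ i, F i ∈ degreePart 𝒜 J r) {δ n₂ : ℕ}
    (h : J ^ (n₂ + 1) ≤ initialIdeal F (δ + 1) * J ^ n₂) {m c : ℕ}
    (hc : Tendsto (fun n : ℕ =>
      (Module.finrank k (degreePart 𝒜 (J ^ (n + 1)) (r * (n + 1) + m)) : ℝ) / (n : ℝ) ^ δ) atTop
        (𝓝 (c / (δ ! : ℝ)))) :
    c ≤ reductionHilbert 𝒜 J r (initialIdeal F δ) m n₂ := by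
  have hN : ∀ n, n₂ ≤ n → J ^ (n + 1) ≤ initialIdeal F (δ + 1) * J ^ n := by
    intro n hn
    obtain ⟨j, rfl⟩ := Nat.exists_eq_add_of_le hn
    rw [show n₂ + j + 1 = n₂ + 1 + j by ring, pow_add, pow_add J n₂ j, ← mul_assoc]
    exact Ideal.mul_mono_left h
  have hstep : ∀ i n, reductionHilbert 𝒜 J r (initialIdeal F i) m (n + 1) ≤
      reductionHilbert 𝒜 J r (initialIdeal F (i + 1)) m (n + 1) +
        reductionHilbert 𝒜 J r (initialIdeal F i) m n := fun i n => by
    rw [initialIdeal_succ]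
    exact reductionHilbert_succ_le 𝒜 hJ
      (generatedInDegree_initialIdeal (fun i => (hF i).2) i).isHomogeneous
      (initialIdeal_le (fun i => (hF i).1) i) (hF i) m n
  obtain ⟨w, hw⟩ := le_choose_of_succ_le (s := δ) (n₁ := n₂)
    (q := reductionHilbert 𝒜 J r (initialIdeal F δ) m n₂)
    (a := fun i n => reductionHilbert 𝒜 J r (initialIdeal F i) m n)
    (fun i _ n _ => hstep i n) (fun n hn => by
      induction n, hn using Nat.le_induction with
      | base => exact le_rfl
      | succ n hn ih =>
        refine (hstep δ n).trans ?_
        rw [reductionHilbert_eq_zero 𝒜 (hN (n + 1) (by omega)), zero_add]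
        exact ih)
  simp only [reductionHilbert_bot] at hw
  exact le_of_tendsto_div_pow_of_le_choose hw hc

theorem pow_add_le_sup_span_pow {𝔣 : Ideal S} {g : S} {n₂ : ℕ}
    (h : J ^ (n₂ + 1) ≤ (𝔣 ⊔ Ideal.span {g}) * J ^ n₂) (j : ℕ) :
    J ^ (n₂ + j) ≤ 𝔣 ⊔ Ideal.span {g ^ j} * J ^ n₂ := by
  induction j with
  | zero => simp
  | succ j ih =>
    rw [← add_assoc, pow_succ']
    refine (Ideal.mul_mono_right ih).trans ?_
    rw [Ideal.mul_sup]
    refine sup_le (Ideal.mul_le_right.trans le_sup_left) ?_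
    rw [mul_left_comm, ← pow_succ']
    refine (Ideal.mul_mono_right h).trans ?_
    rw [Ideal.sup_mul, Ideal.mul_sup]
    have h1 : Ideal.span {g ^ j} * (𝔣 * J ^ n₂) ≤ 𝔣 :=
      (Ideal.mul_le_right (I := Ideal.span {g ^ j})).trans (Ideal.mul_le_left (I := 𝔣))
    have h2 : Ideal.span {g ^ j} * (Ideal.span {g} * J ^ n₂) =
        Ideal.span {g ^ (j + 1)} * J ^ n₂ := by
      rw [← mul_assoc, Ideal.span_singleton_mul_span_singleton, ← pow_succ]
    exact sup_le_sup h1 h2.le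

theorem colon_mul_le {𝔣 : Ideal S} : 𝔣.colon (J : Set S) * J ≤ 𝔣 :=
  Ideal.mul_le.2 fun _ ha _ hb => Submodule.mem_colon.1 ha _ hb

/-- In large degrees, multiplication by `gⁿ⁺¹` identifies `S / (𝔣 : J)` with `Jⁿ⁺¹ / 𝔣 Jⁿ`. -/
theorem exists_degreePart_colon [IsNoetherianRing S] (hJ : GeneratedInDegree 𝒜 J r)
    {𝔣 : Ideal S} (h𝔣 : 𝔣.IsHomogeneous 𝒜) {g : S} (hg : g ∈ degreePart 𝒜 J r)
    {n t : ℕ} (hred : J ^ (n + 1) ≤ (𝔣 ⊔ Ideal.span {g}) * J ^ n)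
    (ht : (HomogeneousIdeal.irrelevant 𝒜).toIdeal ^ t ≤ J ⊔ 𝔣.colon (J : Set S)) :
    ∃ M, ∀ m, M ≤ m →
      degreePart 𝒜 (J ^ (n + 1)) (r * (n + 1) + m) ≤
        degreePart 𝒜 (𝔣 * J ^ n) (r * (n + 1) + m) ⊔
          (𝒜 m).map (LinearMap.mulLeft k (g ^ (n + 1))) ∧
      degreePart 𝒜 (𝔣.colon (J : Set S)) m = 𝒜 m ⊓
        (degreePart 𝒜 (𝔣 * J ^ n) (r * (n + 1) + m)).comap
          (LinearMap.mulLeft k (g ^ (n + 1))) := by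
  set K := 𝔣.colon (J : Set S) with hK
  set 𝔫 := (HomogeneousIdeal.irrelevant 𝒜).toIdeal
  have hgdeg : g ^ (n + 1) ∈ 𝒜 (r * (n + 1)) := by
    have := SetLike.pow_mem_graded (n + 1) hg.2
    rwa [smul_eq_mul, mul_comm] at this
  have h𝔣K : 𝔣 ≤ K := Ideal.le_colon
  obtain ⟨t', ht'⟩ : ∃ t', 𝔫 ^ t' ≤ K ⊔ Ideal.span {g ^ (n + 1)} := by
    -- The power 1 + (2n + 1) of K + J lies in K plus the power 2n + 1 of J, and the latter lies in
    -- 𝔣 + gⁿ⁺¹Jⁿ by n + 1 uses of the reduction equation.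
    refine ⟨t * (1 + (n + (n + 1))), ?_⟩
    rw [pow_mul]
    refine (Ideal.pow_right_mono ht _).trans ?_
    rw [sup_comm]
    refine (Ideal.sup_pow_add_le_pow_sup_pow (n := 1)).trans ?_
    rw [pow_one]
    refine sup_le le_sup_left ((pow_add_le_sup_span_pow hred (n + 1)).trans ?_)
    exact sup_le_sup h𝔣K Ideal.mul_le_left
  have hKJ : K * J ^ (n + 1) ≤ 𝔣 * J ^ n := by
    rw [pow_succ', ← mul_assoc]
    exact Ideal.mul_mono_left colon_mul_le
  -- The kernel of multiplication by gⁿ⁺¹ modulo 𝔣Jⁿ. It contains K, and a power of 𝔫 carries it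
  -- into K, so the two agree in large degrees.
  let L : Ideal S := Submodule.comap (LinearMap.mulLeft S (g ^ (n + 1))) (𝔣 * J ^ n)
  have hL : 𝔫 ^ t' * L ≤ K := by
    refine Ideal.mul_le.2 fun a ha x hx => ?_
    obtain ⟨b, hb, c, hc, rfl⟩ := Submodule.mem_sup.1 (ht' ha)
    obtain ⟨s, rfl⟩ := Ideal.mem_span_singleton'.1 hc
    have hx' : g ^ (n + 1) * x ∈ 𝔣 * J ^ n := hx
    rw [add_mul, mul_assoc]
    exact add_mem (Ideal.mul_mem_right _ _ hb)
      (Ideal.mul_mem_left _ _ (h𝔣K (Ideal.mul_le_left hx')))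
  obtain ⟨D, hD⟩ := exists_degreePart_le_mul (𝒜 := 𝒜) (L := L) (𝔮 := 𝔫 ^ t') (t := t')
    fun m hm x hx => mem_irrelevant_pow hm hx
  refine ⟨max D t', fun m hm => ⟨fun z hz => ?_, le_antisymm (fun x hx => ?_) ?_⟩⟩
  · have hz1 : z ∈ 𝔫 ^ t' * J ^ (n + 1) := by
      have := hz
      rw [(hJ.pow (n + 1)).degreePart_add] at this
      refine Submodule.mul_induction_on this (fun a ha b hb => ?_) fun a b ha hb => add_mem ha hb
      have h1 := Ideal.mul_mem_mul (mem_irrelevant_pow ((le_max_right _ _).trans hm) hb) ha.1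
      rwa [mul_comm b a] at h1
    have hz2 : z ∈ 𝔣 * J ^ n ⊔ Ideal.span {g ^ (n + 1)} * ⊤ := by
      have := Ideal.mul_mono_left ht' hz1
      rw [Ideal.sup_mul] at this
      exact sup_le_sup hKJ (Ideal.mul_mono_right le_top) this
    obtain ⟨u, hu, y, hy, rfl⟩ := exists_add_mul_of_mem_sup (h𝔣.mul (hJ.pow n).isHomogeneous)
      (Ideal.IsHomogeneous.top 𝒜) hgdeg hz2 hz.2
    exact add_mem (Submodule.mem_sup_left hu) (Submodule.mem_sup_right ⟨y, hy.2, rfl⟩)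
  · refine ⟨hx.2, ?_, SetLike.mul_mem_graded hgdeg hx.2⟩
    have h1 := hKJ (Ideal.mul_mem_mul hx.1 (Ideal.pow_mem_pow hg.1 (n + 1)))
    rwa [mul_comm x] at h1
  · rintro x ⟨hx, hgx⟩
    exact ⟨hL (hD m ((le_max_left _ _).trans hm) x ⟨hgx.1, hx⟩), hx⟩

/-- Both the Hilbert function and the surjectivity of multiplication by x are transported through
the identification of `exists_degreePart_colon`. -/
theorem eventually_finrank_colon [IsNoetherianRing S] (hJ : GeneratedInDegree 𝒜 J r)
    {𝔣 : Ideal S} (h𝔣 : 𝔣.IsHomogeneous 𝒜) (h𝔣J : 𝔣 ≤ J) {g : S} (hg : g ∈ degreePart 𝒜 J r)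
    {n t : ℕ} (hred : J ^ (n + 1) ≤ (𝔣 ⊔ Ideal.span {g}) * J ^ n)
    (ht : (HomogeneousIdeal.irrelevant 𝒜).toIdeal ^ t ≤ J ⊔ 𝔣.colon (J : Set S))
    {x : S} (hx : x ∈ 𝒜 1) {m₁ : ℕ}
    (hxs : ∀ m, m₁ ≤ m → degreePart 𝒜 (J ^ (n + 1)) (r * (n + 1) + m + 1) ≤
        degreePart 𝒜 (𝔣 * J ^ n) (r * (n + 1) + m + 1) ⊔
          (degreePart 𝒜 (J ^ (n + 1)) (r * (n + 1) + m)).map (LinearMap.mulLeft k x)) :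
    ∃ M, ∀ m, M ≤ m →
      Module.finrank k (𝒜 m) = Module.finrank k (degreePart 𝒜 (𝔣.colon (J : Set S)) m) +
        reductionHilbert 𝒜 J r 𝔣 m n ∧
      𝒜 (m + 1) ≤ degreePart 𝒜 (𝔣.colon (J : Set S)) (m + 1) ⊔
        (𝒜 m).map (LinearMap.mulLeft k x) := by
  obtain ⟨M, hM⟩ := exists_degreePart_colon 𝒜 hJ h𝔣 hg hred ht
  have hgdeg : g ^ (n + 1) ∈ degreePart 𝒜 (J ^ (n + 1)) (r * (n + 1)) := by
    refine ⟨Ideal.pow_mem_pow hg.1 _, ?_⟩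
    have := SetLike.pow_mem_graded (n + 1) hg.2
    rwa [smul_eq_mul, mul_comm] at this
  have hgm : ∀ m, ∀ y ∈ 𝒜 m, g ^ (n + 1) * y ∈ degreePart 𝒜 (J ^ (n + 1)) (r * (n + 1) + m) :=
    fun m y hy => ⟨Ideal.mul_mem_right _ _ hgdeg.1, SetLike.mul_mem_graded hgdeg.2 hy⟩
  refine ⟨max M m₁, fun m hm => ⟨?_, fun z hz => ?_⟩⟩
  · obtain ⟨h1, h2⟩ := hM m ((le_max_left _ _).trans hm)
    have h3 := finrank_add_finrank_eq_of_eq_sup_mul (f := g ^ (n + 1))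
      (degreePart_mono (mul_pow_le_pow_succ h𝔣J n) _) h1
      (by rintro _ ⟨y, hy, rfl⟩; exact hgm m y hy) h2
    have h4 := reductionHilbert_add 𝒜 (r := r) h𝔣J m n
    omega
  · have h1 := hxs m ((le_max_right _ _).trans hm) (hgm (m + 1) z hz)
    obtain ⟨u, hu, _, ⟨v, hv, rfl⟩, huv⟩ := Submodule.mem_sup.1 h1
    obtain ⟨u', hu', _, ⟨w, hw, rfl⟩, rfl⟩ :=
      Submodule.mem_sup.1 ((hM m ((le_max_left _ _).trans hm)).1 hv)
    have hxw : x * w ∈ 𝒜 (m + 1) := by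
      rw [add_comm]; exact SetLike.mul_mem_graded hx hw
    have hzw : z - x * w ∈ degreePart 𝒜 (𝔣.colon (J : Set S)) (m + 1) := by
      rw [(hM (m + 1) (((le_max_left _ _).trans hm).trans (Nat.le_succ m))).2]
      refine ⟨sub_mem hz hxw, ?_⟩
      have h5 : g ^ (n + 1) * (z - x * w) = u + x * u' := by
        simp only [LinearMap.mulLeft_apply] at huv
        linear_combination -huv
      change g ^ (n + 1) * (z - x * w) ∈ degreePart 𝒜 (𝔣 * J ^ n) (r * (n + 1) + (m + 1))
      rw [h5]
      refine add_mem hu ⟨Ideal.mul_mem_left _ _ hu'.1, ?_⟩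
      rw [← add_assoc, add_comm]
      exact SetLike.mul_mem_graded hx hu'.2
    rw [← sub_add_cancel z (x * w)]
    exact add_mem (Submodule.mem_sup_left hzw) (Submodule.mem_sup_right ⟨w, hw, rfl⟩)

end GeneralResidual

/-! ### The Hilbert function of S / (𝔣 : J) for general 𝔣 -/

section GeneralColon

variable {k S : Type*} [Field k] [CommRing S] [Algebra k S]
  (𝒜 : ℕ → Submodule k S) [GradedAlgebra 𝒜] [IsStandardGraded 𝒜]
  {J : Ideal S} {r : ℕ}

theorem initialIdeal_eq_span_range {F : ℕ → S} {δ : ℕ} {f : Fin δ → S}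
    (h : ∀ i : Fin δ, F i = f i) : initialIdeal F δ = Ideal.span (Set.range f) := by
  rw [initialIdeal]
  congr 1
  ext x
  constructor
  · rintro ⟨i, hi, rfl⟩
    exact ⟨⟨i, hi⟩, (h ⟨i, hi⟩).symm⟩
  · rintro ⟨i, rfl⟩
    exact ⟨i, i.2, h i⟩

theorem degreePart_span_range_mul {δ : ℕ} (f : Fin δ → degreePart 𝒜 J r) {𝔶 : Ideal S}
    (h𝔶 : 𝔶.IsHomogeneous 𝒜) (e : ℕ) :
    degreePart 𝒜 (Ideal.span (Set.range fun i => (f i : S)) * 𝔶) (r + e) =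
      Submodule.span k (Set.range fun i => (f i : S)) * degreePart 𝒜 𝔶 e := by
  have hX : Set.range (fun i => (f i : S)) ⊆ (𝒜 r : Set S) := by
    rintro _ ⟨i, rfl⟩; exact (f i).2.2
  rw [GeneratedInDegree.degreePart_mul ⟨_, hX, rfl⟩ h𝔶, degreePart_span_eq 𝒜 hX]

theorem exists_eval_ne_zero_of_degreePart_le {δ : ℕ} {f₀ : Fin δ → degreePart 𝒜 J r}
    {𝔶 𝔷 : Ideal S} (h𝔶 : 𝔶.IsHomogeneous 𝒜) (h : J * 𝔶 ≤ 𝔷) {a e : ℕ} (ha : a = r + e)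
    (Z : Submodule k S) (hf₀ : degreePart 𝒜 𝔷 a ≤
      Z ⊔ degreePart 𝒜 (Ideal.span (Set.range fun i => (f₀ i : S)) * 𝔶) a) :
    ∃ p : MvPolynomial (Module.Dual k (Fin δ → degreePart 𝒜 J r)) k,
      MvPolynomial.eval (fun l : Module.Dual k (Fin δ → degreePart 𝒜 J r) => l f₀) p ≠ 0 ∧
      ∀ f, MvPolynomial.eval (fun l : Module.Dual k (Fin δ → degreePart 𝒜 J r) => l f) p ≠ 0 →
        degreePart 𝒜 𝔷 a ≤ Z ⊔ degreePart 𝒜 (Ideal.span (Set.range fun i => (f i : S)) * 𝔶) a := by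
  subst ha
  simp only [degreePart_span_range_mul 𝒜 _ h𝔶] at hf₀ ⊢
  exact exists_eval_ne_zero_of_le_sup_span_mul
    (mul_degreePart_le.trans (degreePart_mono h _)) hf₀

theorem GeneratedInDegree.degreePart_succ {L : Ideal S} {a : ℕ} (hL : GeneratedInDegree 𝒜 L a)
    (b : ℕ) : degreePart 𝒜 L (a + b + 1) = degreePart 𝒜 L (a + b) * 𝒜 1 := by
  rw [add_assoc, hL.degreePart_add, hL.degreePart_add, mul_assoc, degree_add 𝒜]

theorem GeneratedInDegree.le_of_degreePart_le {L L' : Ideal S} {a : ℕ}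
    (hL : GeneratedInDegree 𝒜 L a) (h : degreePart 𝒜 L a ≤ L'.restrictScalars k) : L ≤ L' := by
  rw [← hL.span_degreePart, Ideal.span_le]
  exact h

/-- Each further component of L is the previous one times the linear forms, so surjectivity in one
degree propagates upward. -/
theorem degreePart_le_sup_map_mulLeft {L D : Ideal S} {a : ℕ} (hL : GeneratedInDegree 𝒜 L a)
    {x : S} {m₁ : ℕ} (h : degreePart 𝒜 L (a + m₁ + 1) ≤ degreePart 𝒜 D (a + m₁ + 1) ⊔
      (degreePart 𝒜 L (a + m₁)).map (LinearMap.mulLeft k x)) (m : ℕ) (hm : m₁ ≤ m) :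
    degreePart 𝒜 L (a + m + 1) ≤ degreePart 𝒜 D (a + m + 1) ⊔
      (degreePart 𝒜 L (a + m)).map (LinearMap.mulLeft k x) := by
  induction m, hm using Nat.le_induction with
  | base => exact h
  | succ m hm ih =>
    rw [← add_assoc, add_assoc a m 1, hL.degreePart_succ 𝒜 (m + 1), ← add_assoc]
    refine Submodule.mul_le.2 fun u hu v hv => ?_
    obtain ⟨b, hb, _, ⟨c, hc, rfl⟩, rfl⟩ := Submodule.mem_sup.1 (ih hu)
    rw [add_mul]
    refine add_mem (Submodule.mem_sup_left ⟨Ideal.mul_mem_right _ _ hb.1,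
      SetLike.mul_mem_graded hb.2 hv⟩) (Submodule.mem_sup_right ⟨c * v, ?_, ?_⟩)
    · exact ⟨Ideal.mul_mem_right _ _ hc.1, SetLike.mul_mem_graded hc.2 hv⟩
    · simp [mul_assoc]

theorem reductionHilbert_le_of_surjective {𝔣 : Ideal S} (h𝔣J : 𝔣 ≤ J) {x : S} (hx : x ∈ 𝒜 1)
    {m n : ℕ} (h : degreePart 𝒜 (J ^ (n + 1)) (r * (n + 1) + m + 1) ≤
        degreePart 𝒜 (𝔣 * J ^ n) (r * (n + 1) + m + 1) ⊔
          (degreePart 𝒜 (J ^ (n + 1)) (r * (n + 1) + m)).map (LinearMap.mulLeft k x)) :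
    reductionHilbert 𝒜 J r 𝔣 (m + 1) n ≤ reductionHilbert 𝒜 J r 𝔣 m n := by
  have hle := mul_pow_le_pow_succ h𝔣J n
  have hxm : ∀ {L : Ideal S} {e : ℕ} {z : S}, z ∈ degreePart 𝒜 L e →
      x * z ∈ degreePart 𝒜 L (e + 1) := fun {L e z} hz => by
    refine ⟨Ideal.mul_mem_left _ _ hz.1, ?_⟩
    rw [add_comm]
    exact SetLike.mul_mem_graded hx hz.2
  have h1 := finrank_add_finrank_eq_of_eq_sup_mul (f := x) (degreePart_mono (𝒜 := 𝒜) hle _) h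
    (by rintro _ ⟨z, hz, rfl⟩; exact hxm hz) rfl
  have h2 := Submodule.finrank_mono (R := k) (s := degreePart 𝒜 (𝔣 * J ^ n) (r * (n + 1) + m))
    (t := degreePart 𝒜 (J ^ (n + 1)) (r * (n + 1) + m) ⊓
      (degreePart 𝒜 (𝔣 * J ^ n) (r * (n + 1) + m + 1)).comap (LinearMap.mulLeft k x))
    fun z hz => ⟨⟨hle hz.1, hz.2⟩, hxm hz⟩
  have h3 := reductionHilbert_add 𝒜 (r := r) h𝔣J m n
  have h4 := reductionHilbert_add 𝒜 (r := r) h𝔣J (m + 1) n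
  rw [← add_assoc] at h4
  omega

/-- A special filter-regular sequence F determines q and serves as the point where four
determinantal conditions are satisfied. For f satisfying them, with g = F δ, n, x and m₁ kept fixed,
the Hilbert function of Jⁿ⁺¹ / 𝔣Jⁿ is squeezed to q from m₁ on; f itself need not be filter-regular.
-/
theorem exists_holdsForGeneral_finrank_colon [Infinite k] [IsNoetherianRing S]
    (hJ : GeneratedInDegree 𝒜 J r) {δ : ℕ} (hd : ringKrullDim S = (δ + 1 : ℕ))
    (hG : SatisfiesG J (δ + 1)) :
    ∃ (c : ℕ → ℕ) (q : ℕ), ∃ x ∈ 𝒜 1,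
      (∀ m, Tendsto (fun n : ℕ =>
        (Module.finrank k (degreePart 𝒜 (J ^ (n + 1)) (r * (n + 1) + m)) : ℝ) / (n : ℝ) ^ δ) atTop
        (𝓝 (c m / (δ ! : ℝ)))) ∧
      (∃ m₁, ∀ m, m₁ ≤ m → c m = q) ∧
      (∃ F : ℕ → S, (∀ i, F i ∈ degreePart 𝒜 J r) ∧
        ∃ m n, reductionHilbert 𝒜 J r (initialIdeal F δ) m n = q) ∧
      HoldsForGeneral k (fun f : Fin δ → degreePart 𝒜 J r => ∃ M, ∀ m, M ≤ m →
        Module.finrank k (𝒜 m) = Module.finrank k (degreePart 𝒜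
          ((Ideal.span (Set.range fun i => (f i : S))).colon (J : Set S)) m) + q ∧
        𝒜 (m + 1) ≤ degreePart 𝒜
          ((Ideal.span (Set.range fun i => (f i : S))).colon (J : Set S)) (m + 1) ⊔
          (𝒜 m).map (LinearMap.mulLeft k x)) := by
  obtain ⟨F, hF, hreg, hres⟩ := exists_filterRegular_seq 𝒜 hJ hG
  obtain ⟨n, hn, hlim⟩ := exists_tendsto_finrank_degreePart_pow 𝒜 hJ hd hF hreg
  obtain ⟨B, hB⟩ := exists_bound_of_tendsto 𝒜 hd hlim
  have hFJ : initialIdeal F δ ≤ J := initialIdeal_le (fun i => (hF i).1) δ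
  have hFh : (initialIdeal F δ).IsHomogeneous 𝒜 :=
    (generatedInDegree_initialIdeal (fun i => (hF i).2) δ).isHomogeneous
  obtain ⟨t, ht⟩ := exists_irrelevant_pow_le_colon_sup 𝒜 hJ hd hFh rfl (hres δ)
  obtain ⟨x, hx, m₁, hconst, hsurj⟩ := exists_linear_form_surjective 𝒜 hFJ n hB
  set q := reductionHilbert 𝒜 J r (initialIdeal F δ) m₁ n with hq
  set g := F δ with hg
  let f₀ : Fin δ → degreePart 𝒜 J r := fun i => ⟨F i, hF i⟩
  have hFf₀ : initialIdeal F δ = Ideal.span (Set.range fun i => (f₀ i : S)) :=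
    initialIdeal_eq_span_range fun i => rfl
  have hJn := hJ.pow (n + 1)
  have hJh := (hJ.pow n).isHomogeneous
  have hJJ : J * J ^ n ≤ J ^ (n + 1) := (pow_succ' J n).ge
  have hdeg : ∀ m, r * (n + 1) + m = r + (r * n + m) := fun m => by ring
  have hgh : (Ideal.span {g} * J ^ n).IsHomogeneous 𝒜 :=
    (Ideal.homogeneous_span 𝒜 _ (by rintro _ rfl; exact ⟨r, (hF δ).2⟩)).mul hJh
  -- A fixed complement of dimension at most q; that it still spans modulo 𝔣Jⁿ is the open form of
  -- the upper bound at m₁.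
  obtain ⟨Z, hZ, hZq⟩ : ∃ Z : Submodule k S,
      degreePart 𝒜 (J ^ (n + 1)) (r * (n + 1) + m₁) ≤
        Z ⊔ degreePart 𝒜 (initialIdeal F δ * J ^ n) (r * (n + 1) + m₁) ∧
      Module.Finite k Z ∧ Module.finrank k Z ≤ q := by
    obtain ⟨C, hC⟩ := Submodule.exists_isCompl
      (degreePart 𝒜 (initialIdeal F δ * J ^ n) (r * (n + 1) + m₁))
    have hle := degreePart_mono (𝒜 := 𝒜) (mul_pow_le_pow_succ hFJ n) (r * (n + 1) + m₁)
    have hsup : degreePart 𝒜 (initialIdeal F δ * J ^ n) (r * (n + 1) + m₁) ⊔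
        C ⊓ degreePart 𝒜 (J ^ (n + 1)) (r * (n + 1) + m₁) =
        degreePart 𝒜 (J ^ (n + 1)) (r * (n + 1) + m₁) := by
      rw [← sup_inf_assoc_of_le C hle, hC.sup_eq_top, top_inf_eq]
    have hfin : Module.Finite k (C ⊓ degreePart 𝒜 (J ^ (n + 1)) (r * (n + 1) + m₁) :
        Submodule k S) := Submodule.finiteDimensional_of_le inf_le_right
    refine ⟨C ⊓ degreePart 𝒜 (J ^ (n + 1)) (r * (n + 1) + m₁), ?_, hfin, ?_⟩
    · rw [sup_comm, hsup]
    · have h1 := Submodule.finrank_sup_add_finrank_inf_eq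
        (degreePart 𝒜 (initialIdeal F δ * J ^ n) (r * (n + 1) + m₁))
        (C ⊓ degreePart 𝒜 (J ^ (n + 1)) (r * (n + 1) + m₁))
      rw [hsup, ← inf_assoc, hC.inf_eq_bot, bot_inf_eq, finrank_bot] at h1
      have h2 := reductionHilbert_add 𝒜 (r := r) hFJ m₁ n
      omega
  -- First condition: J lies in J² + 𝔣 in degree r + t, which makes J + (𝔣 : J) contain a power of
  -- 𝔫.
  obtain ⟨p₁, hp₁, H₁⟩ := exists_eval_ne_zero_of_degreePart_le 𝒜 (f₀ := f₀)
    (𝔶 := ⊤) (𝔷 := J) (Ideal.IsHomogeneous.top 𝒜) Ideal.mul_le_left (a := r + t) rfl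
    (degreePart 𝒜 (J * J) (r + t)) (by
      rw [← hFf₀, Ideal.mul_top]
      refine le_trans (b := degreePart 𝒜 (J * J ⊔ initialIdeal F δ) (r + t))
        (fun z hz => ⟨?_, hz.2⟩) (degreePart_sup_le (hJ.isHomogeneous.mul hJ.isHomogeneous) hFh (r + t))
      rw [hJ.degreePart_add] at hz
      refine Submodule.mul_induction_on hz (fun a ha b hb => ?_) fun a b ha hb => add_mem ha hb
      obtain ⟨u, hu, v, hv, rfl⟩ := Submodule.mem_sup.1 (ht (mem_irrelevant_pow le_rfl hb))
      rw [mul_add]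
      refine add_mem (Ideal.mem_sup_left (Ideal.mul_mem_mul ha.1 hu)) (Ideal.mem_sup_right ?_)
      rw [mul_comm]
      exact Submodule.mem_colon.1 hv _ ha.1)
  -- Second condition: Jⁿ⁺¹ = (𝔣, g)Jⁿ, tested in the generating degree r(n+1).
  obtain ⟨p₂, hp₂, H₂⟩ := exists_eval_ne_zero_of_degreePart_le 𝒜 (f₀ := f₀)
    hJh hJJ (hdeg 0) (degreePart 𝒜 (Ideal.span {g} * J ^ n) (r * (n + 1) + 0)) (by
      rw [← hFf₀]
      refine le_trans (degreePart_mono (hn.trans ?_) _)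
        (degreePart_sup_le hgh (hFh.mul hJh) _)
      rw [initialIdeal_succ, sup_comm, Ideal.sup_mul])
  -- Third and fourth conditions: x is surjective from m₁ to m₁ + 1 modulo 𝔣Jⁿ, and Z spans at m₁.
  -- Together they bound the Hilbert function by q from m₁ on.
  obtain ⟨p₃, hp₃, H₃⟩ := exists_eval_ne_zero_of_degreePart_le 𝒜 (f₀ := f₀)
    hJh hJJ (hdeg (m₁ + 1))
    ((degreePart 𝒜 (J ^ (n + 1)) (r * (n + 1) + m₁)).map (LinearMap.mulLeft k x)) (by
      rw [← hFf₀, sup_comm]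
      exact hsurj)
  obtain ⟨p₄, hp₄, H₄⟩ := exists_eval_ne_zero_of_degreePart_le 𝒜 (f₀ := f₀)
    hJh hJJ (hdeg m₁) Z (by rw [← hFf₀]; exact hZ)
  refine ⟨fun m => reductionHilbert 𝒜 J r (initialIdeal F δ) m n, q, x, hx, hlim,
    ⟨m₁, hconst⟩, ⟨F, hF, m₁, n, rfl⟩,
    holdsForGeneral_of_eval_ne_zero (p₁ * p₂ * p₃ * p₄) (v₀ := f₀) ?_ fun f hf => ?_⟩
  · simp only [map_mul]
    exact mul_ne_zero (mul_ne_zero (mul_ne_zero hp₁ hp₂) hp₃) hp₄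
  simp only [map_mul, mul_ne_zero_iff] at hf
  have H₁ := H₁ f hf.1.1.1
  have H₂ := H₂ f hf.1.1.2
  have H₃ := H₃ f hf.1.2
  have H₄ := H₄ f hf.2
  set 𝔣 := Ideal.span (Set.range fun i => (f i : S)) with h𝔣def
  have h𝔣J : 𝔣 ≤ J := Ideal.span_le.2 (by rintro _ ⟨i, rfl⟩; exact (f i).2.1)
  have h𝔣h : 𝔣.IsHomogeneous 𝒜 :=
    Ideal.homogeneous_span 𝒜 _ (by rintro _ ⟨i, rfl⟩; exact ⟨r, (f i).2.2⟩)
  have hred : J ^ (n + 1) ≤ (𝔣 ⊔ Ideal.span {g}) * J ^ n := by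
    refine hJn.le_of_degreePart_le 𝒜 (H₂.trans (sup_le (fun z hz => ?_) fun z hz => ?_))
    · exact Ideal.mul_mono_left le_sup_right hz.1
    · exact Ideal.mul_mono_left le_sup_left hz.1
  obtain ⟨t', ht'⟩ := exists_irrelevant_pow_le_of_pow_mul_le 𝒜 (J := J) (𝔣 := 𝔣) (t := t) (by
    have h1 := (generatedInDegree_irrelevant 𝒜).pow t |>.mul hJ
    refine h1.le_of_degreePart_le 𝒜 fun z hz => ?_
    have h2 := H₁ (x := z) ⟨Ideal.mul_le_right hz.1, by rw [add_comm r]; simpa using hz.2⟩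
    obtain ⟨u, hu, v, hv, rfl⟩ := Submodule.mem_sup.1 h2
    exact add_mem (Ideal.mem_sup_right hu.1) (Ideal.mem_sup_left (Ideal.mul_le_left hv.1)))
  have hxs := degreePart_le_sup_map_mulLeft 𝒜 hJn (x := x) (D := 𝔣 * J ^ n) (m₁ := m₁) (by
    rw [sup_comm]; exact H₃)
  have hup : ∀ m, m₁ ≤ m → reductionHilbert 𝒜 J r 𝔣 m n ≤ q := by
    intro m hm
    induction m, hm using Nat.le_induction with
    | base =>
      have := hZq.1
      have h1 := Submodule.finrank_mono (R := k) H₄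
      have h2 := Submodule.finrank_add_le_finrank_add_finrank Z
        (degreePart 𝒜 (𝔣 * J ^ n) (r * (n + 1) + m₁))
      have h3 := reductionHilbert_add 𝒜 (r := r) h𝔣J m₁ n
      have := hZq.2
      omega
    | succ m hm ih => exact (reductionHilbert_le_of_surjective 𝒜 h𝔣J hx (hxs m hm)).trans ih
  have hlow : ∀ m, m₁ ≤ m → q ≤ reductionHilbert 𝒜 J r 𝔣 m n := by
    intro m hm
    -- The sequence f followed by g. Only its first δ + 1 terms matter; they generate a reduction,
    -- so the asymptotic lower bound applies.
    let G : ℕ → S := fun i => if h : i < δ then f ⟨i, h⟩ else g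
    have hG1 : initialIdeal G δ = 𝔣 := initialIdeal_eq_span_range fun i => by simp [G]
    have hGm : ∀ i, G i ∈ degreePart 𝒜 J r := fun i => by
      by_cases h : i < δ
      · simpa only [G, dif_pos h] using (f ⟨i, h⟩).2
      · simpa only [G, dif_neg h] using hF δ
    have h1 := le_reductionHilbert_of_tendsto 𝒜 hJ hGm (δ := δ) (n₂ := n) (m := m) (by
      rw [initialIdeal_succ, hG1]
      simpa [G] using hred) (hlim m)
    rw [hG1, hconst m hm] at h1
    exact h1
  obtain ⟨M, hM⟩ := eventually_finrank_colon 𝒜 hJ h𝔣h h𝔣J (hF δ) hred ht' hx hxs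
  refine ⟨max M m₁, fun m hm => ?_⟩
  obtain ⟨h1, h2⟩ := hM m ((le_max_left _ _).trans hm)
  have hm' := (le_max_right M m₁).trans hm
  exact ⟨by rw [h1, le_antisymm (hup m hm') (hlow m hm')], h2⟩

end GeneralColon

/-! ### Lengths as vector space dimensions -/

section Length

/-- R acts through scalars of k, so the two lattices of submodules coincide. -/
theorem length_eq_length_of_smul_eq_zero {k R N : Type*} [Field k] [CommRing R] [Algebra k R]
    [AddCommGroup N] [Module R N] [Module k N] [IsScalarTower k R N] {𝔪 : Ideal R}
    (h𝔪 : ∀ a : R, ∃ c : k, a - algebraMap k R c ∈ 𝔪) (h : ∀ a ∈ 𝔪, ∀ x : N, a • x = 0) :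
    Module.length R N = Module.length k N := by
  have hsmul : ∀ a : R, ∃ c : k, ∀ x : N, a • x = c • x := fun a => by
    obtain ⟨c, hc⟩ := h𝔪 a
    refine ⟨c, fun x => ?_⟩
    rw [← sub_eq_zero, ← algebraMap_smul R c x, ← sub_smul]
    exact h _ hc x
  let e : Submodule R N ≃o Submodule k N :=
    { toFun := fun P => P.restrictScalars k
      invFun := fun P =>
        { P.toAddSubmonoid with
          smul_mem' := fun a x hx => by
            obtain ⟨c, hc⟩ := hsmul a
            change a • x ∈ P
            rw [hc]
            exact P.smul_mem c hx }
      left_inv := fun P => rfl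
      right_inv := fun P => rfl
      map_rel_iff' := Iff.rfl }
  apply WithBot.coe_injective
  rw [Module.coe_length, Module.coe_length, Order.krullDim_eq_of_orderIso e]

/-- Over a `k`-algebra with residue field `k`, the length of a module killed by a power of the
maximal ideal is its dimension over `k`. -/
theorem length_eq_length_of_pow_smul_eq_zero {k R : Type*} [Field k] [CommRing R] [Algebra k R]
    {𝔪 : Ideal R} (h𝔪 : ∀ a : R, ∃ c : k, a - algebraMap k R c ∈ 𝔪) (t : ℕ) {N : Type*}
    [AddCommGroup N] [Module R N] [Module k N] [IsScalarTower k R N]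
    (h : ∀ a ∈ 𝔪 ^ t, ∀ x : N, a • x = 0) : Module.length R N = Module.length k N := by
  induction t generalizing N with
  | zero =>
    have : Subsingleton N := ⟨fun x y => by
      rw [← one_smul R x, ← one_smul R y, h 1 (by simp), h 1 (by simp)]⟩
    rw [Module.length_eq_zero, Module.length_eq_zero]
  | succ t ih =>
    let N' : Submodule R N := 𝔪 • ⊤
    have hexact : Function.Exact (N'.subtype.restrictScalars k) (N'.mkQ.restrictScalars k) :=
      fun x => LinearMap.exact_subtype_mkQ N' x
    have hinj : Function.Injective (N'.subtype.restrictScalars k) := N'.injective_subtype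
    have hsurj : Function.Surjective (N'.mkQ.restrictScalars k) := Submodule.mkQ_surjective N'
    rw [Module.length_eq_add_of_exact N'.subtype N'.mkQ N'.injective_subtype
        (Submodule.mkQ_surjective _) (LinearMap.exact_subtype_mkQ N'),
      Module.length_eq_add_of_exact _ _ hinj hsurj hexact]
    congr 1
    · refine ih (N := N') fun a ha x => Subtype.ext ?_
      change a • (x : N) = 0
      refine Submodule.smul_induction_on x.2 (fun b hb y _ => ?_) fun y z hy hz => ?_
      · rw [← mul_smul]
        exact h _ (by rw [pow_succ]; exact Ideal.mul_mem_mul ha hb) y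
      · rw [smul_add, hy, hz, add_zero]
    · have : IsScalarTower k R (N ⧸ N') := ⟨fun c a x => by
        obtain ⟨x, rfl⟩ := Submodule.mkQ_surjective _ x
        exact congrArg N'.mkQ (smul_assoc c a x)⟩
      refine length_eq_length_of_smul_eq_zero (N := N ⧸ N') h𝔪 fun a ha x => ?_
      obtain ⟨x, rfl⟩ := Submodule.mkQ_surjective _ x
      rw [← map_smul, Submodule.mkQ_apply, Submodule.Quotient.mk_eq_zero]
      exact Submodule.smul_mem_smul ha trivial

end Length

/-! ### Graded dimension counts and the multiplicity of S / K -/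

section GradedLength

variable {k S : Type*} [Field k] [CommRing S] [Algebra k S]
  (𝒜 : ℕ → Submodule k S) [GradedAlgebra 𝒜] [IsStandardGraded 𝒜]

theorem mem_of_forall_decompose_mem {L : Ideal S} {x : S}
    (h : ∀ e, (DirectSum.decompose 𝒜 x e : S) ∈ L) : x ∈ L := by
  classical
  rw [← DirectSum.sum_support_decompose 𝒜 x]
  exact sum_mem fun e _ => h e

/-- The homogeneous component of degree `e` of `𝔴 / 𝔲`. -/
def QuotientComponent (𝔲 𝔴 : Ideal S) (e : ℕ) : Type _ :=
  degreePart 𝒜 𝔴 e ⧸ (degreePart 𝒜 𝔲 e).submoduleOf (degreePart 𝒜 𝔴 e)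

instance QuotientComponent.instAddCommGroup (𝔲 𝔴 : Ideal S) (e : ℕ) :
    AddCommGroup (QuotientComponent 𝒜 𝔲 𝔴 e) :=
  inferInstanceAs (AddCommGroup
    (degreePart 𝒜 𝔴 e ⧸ (degreePart 𝒜 𝔲 e).submoduleOf (degreePart 𝒜 𝔴 e)))

instance QuotientComponent.instModule (𝔲 𝔴 : Ideal S) (e : ℕ) :
    Module k (QuotientComponent 𝒜 𝔲 𝔴 e) :=
  inferInstanceAs (Module k
    (degreePart 𝒜 𝔴 e ⧸ (degreePart 𝒜 𝔲 e).submoduleOf (degreePart 𝒜 𝔴 e)))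

/-- The quotient map onto the homogeneous component of degree `e` of `𝔴 / 𝔲`. -/
def QuotientComponent.mk (𝔲 𝔴 : Ideal S) (e : ℕ) :
    degreePart 𝒜 𝔴 e →ₗ[k] QuotientComponent 𝒜 𝔲 𝔴 e :=
  ((degreePart 𝒜 𝔲 e).submoduleOf (degreePart 𝒜 𝔴 e)).mkQ

theorem QuotientComponent.mk_surjective (𝔲 𝔴 : Ideal S) (e : ℕ) :
    Function.Surjective (QuotientComponent.mk 𝒜 𝔲 𝔴 e) := Submodule.mkQ_surjective _

theorem QuotientComponent.mk_eq_zero {𝔲 𝔴 : Ideal S} {e : ℕ} (x : degreePart 𝒜 𝔴 e) :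
    QuotientComponent.mk 𝒜 𝔲 𝔴 e x = 0 ↔ (x : S) ∈ 𝔲 :=
  (Submodule.Quotient.mk_eq_zero _).trans ⟨fun h => h.1, fun h => ⟨h, x.2.2⟩⟩

instance QuotientComponent.instFinite (𝔲 𝔴 : Ideal S) (e : ℕ) :
    Module.Finite k (QuotientComponent 𝒜 𝔲 𝔴 e) :=
  Module.Finite.of_surjective _ (QuotientComponent.mk_surjective 𝒜 𝔲 𝔴 e)

theorem QuotientComponent.finrank_add {𝔲 𝔴 : Ideal S} (h : 𝔲 ≤ 𝔴) (e : ℕ) :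
    Module.finrank k (QuotientComponent 𝒜 𝔲 𝔴 e) + Module.finrank k (degreePart 𝒜 𝔲 e) =
      Module.finrank k (degreePart 𝒜 𝔴 e) := by
  have h1 := Submodule.finrank_quotient_add_finrank
    ((degreePart 𝒜 𝔲 e).submoduleOf (degreePart 𝒜 𝔴 e))
  rwa [(Submodule.submoduleOfEquivOfLe (degreePart_mono h e)).finrank_eq] at h1

/-- As 𝔴 / 𝔲 vanishes from degree B on, it is the product of its first B components. -/
theorem exists_surjective_pi_degreePart {𝔲 𝔴 : Ideal S} (hu : 𝔲.IsHomogeneous 𝒜)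
    (hw : 𝔴.IsHomogeneous 𝒜) {B : ℕ}
    (hB : ∀ e, B ≤ e → degreePart 𝒜 𝔴 e ≤ degreePart 𝒜 𝔲 e) :
    ∃ Θ : 𝔴.restrictScalars k →ₗ[k] ∀ e : Fin B, QuotientComponent 𝒜 𝔲 𝔴 e,
      Function.Surjective Θ ∧ ∀ x, Θ x = 0 ↔ (x : S) ∈ 𝔲 := by
  let proj : ∀ e : Fin B, 𝔴.restrictScalars k →ₗ[k] degreePart 𝒜 𝔴 e := fun e =>
    ((GradedAlgebra.proj 𝒜 e).comp (𝔴.restrictScalars k).subtype).codRestrict (degreePart 𝒜 𝔴 e)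
      fun x => decompose_mem_degreePart hw x.2 e
  have hproj : ∀ e x, (proj e x : S) = DirectSum.decompose 𝒜 (x : S) e := fun e x => rfl
  refine ⟨LinearMap.pi fun e : Fin B => (QuotientComponent.mk 𝒜 𝔲 𝔴 e).comp (proj e), fun q => ?_, fun x => ?_⟩
  · have hex : ∀ e : Fin B, ∃ y, QuotientComponent.mk 𝒜 𝔲 𝔴 e y = q e :=
      fun e => QuotientComponent.mk_surjective 𝒜 𝔲 𝔴 e (q e)
    choose y hy using hex
    refine ⟨⟨∑ e, (y e : S), sum_mem fun e _ => (y e).2.1⟩, funext fun e => ?_⟩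
    rw [LinearMap.pi_apply, LinearMap.comp_apply, ← hy e]
    congr 1
    refine Subtype.ext ?_
    rw [hproj, DirectSum.decompose_sum, DFinsupp.finsetSum_apply,
      AddSubmonoidClass.coe_finsetSum, Finset.sum_eq_single e]
    · exact coe_decompose_of_mem (y e).2.2
    · intro e' _ hne
      exact DirectSum.decompose_of_mem_ne 𝒜 (y e').2.2 fun h => hne (Fin.ext h)
    · simp
  · have h1 : (LinearMap.pi fun e : Fin B =>
        (QuotientComponent.mk 𝒜 𝔲 𝔴 e).comp (proj e)) x = 0 ↔
        ∀ e : Fin B, (DirectSum.decompose 𝒜 (x : S) e : S) ∈ 𝔲 := by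
      rw [funext_iff]
      refine forall_congr' fun e => ?_
      rw [LinearMap.pi_apply, LinearMap.comp_apply, Pi.zero_apply, QuotientComponent.mk_eq_zero,
        hproj]
    rw [h1]
    refine ⟨fun h => mem_of_forall_decompose_mem 𝒜 fun e => ?_, fun h e => hu e h⟩
    by_cases he : e < B
    · exact h ⟨e, he⟩
    · exact (hB e (not_lt.1 he) (decompose_mem_degreePart hw x.2 e)).1

theorem finrank_eq_of_surjective_of_ker_eq {V N Q : Type*} [AddCommGroup V] [Module k V]
    [AddCommGroup N] [Module k N] [AddCommGroup Q] [Module k Q] [Module.Finite k Q]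
    {π : V →ₗ[k] N} {Θ : V →ₗ[k] Q} (hπ : Function.Surjective π) (hΘ : Function.Surjective Θ)
    (h : ∀ x, π x = 0 ↔ Θ x = 0) :
    Module.Finite k N ∧ Module.finrank k N = Module.finrank k Q := by
  have hker : LinearMap.ker π = LinearMap.ker Θ := by
    ext x
    rw [LinearMap.mem_ker, LinearMap.mem_ker, h]
  let E : N ≃ₗ[k] Q := (π.quotKerEquivOfSurjective hπ).symm ≪≫ₗ
    Submodule.quotEquivOfEq _ _ hker ≪≫ₗ Θ.quotKerEquivOfSurjective hΘ
  exact ⟨Module.Finite.equiv E.symm, E.finrank_eq⟩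

/-- The dimension of a quotient of homogeneous ideals is the sum of the dimensions of its
homogeneous components. -/
theorem finrank_add_sum_finrank_degreePart {𝔲 𝔴 : Ideal S} (hu : 𝔲.IsHomogeneous 𝒜)
    (hw : 𝔴.IsHomogeneous 𝒜) (huw : 𝔲 ≤ 𝔴) {B : ℕ}
    (hB : ∀ e, B ≤ e → degreePart 𝒜 𝔴 e ≤ degreePart 𝒜 𝔲 e)
    {N : Type*} [AddCommGroup N] [Module k N] (π : 𝔴.restrictScalars k →ₗ[k] N)
    (hπ : Function.Surjective π) (hker : ∀ x, π x = 0 ↔ (x : S) ∈ 𝔲) :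
    Module.Finite k N ∧
      Module.finrank k N + ∑ e ∈ Finset.range B, Module.finrank k (degreePart 𝒜 𝔲 e) =
        ∑ e ∈ Finset.range B, Module.finrank k (degreePart 𝒜 𝔴 e) := by
  obtain ⟨Θ, hΘ, hΘ0⟩ := exists_surjective_pi_degreePart 𝒜 hu hw hB
  have hπΘ : ∀ x, π x = 0 ↔ Θ x = 0 := fun x => (hker x).trans (hΘ0 x).symm
  obtain ⟨hfin, h⟩ := finrank_eq_of_surjective_of_ker_eq hπ hΘ hπΘ
  refine ⟨hfin, ?_⟩
  rw [h, Module.finrank_pi_fintype, ← Fin.sum_univ_eq_sum_range (fun e =>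
    Module.finrank k (degreePart 𝒜 𝔲 e)), ← Fin.sum_univ_eq_sum_range (fun e =>
    Module.finrank k (degreePart 𝒜 𝔴 e)), ← Finset.sum_add_distrib]
  exact Finset.sum_congr rfl fun e _ => QuotientComponent.finrank_add 𝒜 huw e

theorem tendsto_factorial_div_pow_mul {a : ℕ → ℕ} {δ v : ℕ}
    (h : Tendsto (fun n : ℕ => (a n : ℝ) / (n : ℝ) ^ δ) atTop (𝓝 (v / (δ ! : ℝ)))) :
    Tendsto (fun n : ℕ => (δ ! : ℝ≥0∞) / (n : ℝ≥0∞) ^ δ * (a n : ℝ≥0∞)) atTop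
      (𝓝 (v : ℝ≥0∞)) := by
  have h1 := ENNReal.tendsto_ofReal (h.const_mul (δ ! : ℝ))
  rw [mul_div_cancel₀ _ (by positivity), ENNReal.ofReal_natCast] at h1
  refine h1.congr' ?_
  filter_upwards [eventually_ge_atTop 1] with n hn
  have hn' : (0 : ℝ) < (n : ℝ) ^ δ := by positivity
  rw [ENNReal.ofReal_mul (by positivity), ENNReal.ofReal_div_of_pos hn', ENNReal.ofReal_natCast,
    ENNReal.ofReal_natCast, ENNReal.ofReal_pow (by positivity), ENNReal.ofReal_natCast,
    mul_div_assoc', div_eq_mul_inv, div_eq_mul_inv]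
  ring

theorem tendsto_sum_div_of_eventually_eq {h : ℕ → ℕ} {M q : ℕ} (hM : ∀ m, M ≤ m → h m = q) :
    Tendsto (fun n : ℕ => ((∑ e ∈ Finset.range n, h e : ℕ) : ℝ) / (n : ℝ) ^ 1) atTop
      (𝓝 (q / (1 ! : ℝ))) := by
  have h1 : Tendsto (fun n => (h n : ℝ)) atTop (𝓝 (q : ℝ)) :=
    tendsto_const_nhds.congr' (by
      filter_upwards [eventually_ge_atTop M] with n hn
      rw [hM n hn])
  have h2 := h1.cesaro
  simp only [Nat.factorial_one, Nat.cast_one, div_one, pow_one]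
  refine h2.congr fun n => ?_
  push_cast
  rw [div_eq_inv_mul]

variable {K : Ideal S}

/-- S / K is finite over the polynomial ring in one variable acting through x. -/
theorem ringKrullDim_quotient_le_one {x : S} {M : ℕ}
    (h : 𝒜 (M + 1) ≤ degreePart 𝒜 K (M + 1) ⊔ (𝒜 M).map (LinearMap.mulLeft k x)) :
    ringKrullDim (S ⧸ K) ≤ 1 := by
  let f : S →ₐ[k] S ⧸ K := Ideal.Quotient.mkₐ k K
  have hpow : ∀ n, (𝒜 1).map f.toLinearMap ^ n = (𝒜 n).map f.toLinearMap := fun n => by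
    rw [degree_eq_pow 𝒜 n, Submodule.map_pow]
  refine ringKrullDim_le_of_pow_le_span_mul (k := k) (T := (𝒜 1).map f.toLinearMap) (N := M)
    (Submodule.FG.map _ (Module.Finite.iff_fg.1 IsStandardGraded.finite_degree_one)) ?_
    (fun _ : Fin 1 => f x) ?_
  · have h1 : (((𝒜 1).map f.toLinearMap : Submodule k (S ⧸ K)) : Set (S ⧸ K)) =
        f '' (𝒜 1 : Set S) := rfl
    rw [h1, ← AlgHom.map_adjoin, IsStandardGraded.adjoin_degree_one, Algebra.map_top,
      AlgHom.range_eq_top]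
    exact Ideal.Quotient.mkₐ_surjective k K
  · rw [hpow, hpow]
    rintro _ ⟨z, hz, rfl⟩
    obtain ⟨a, ha, _, ⟨b, hb, rfl⟩, rfl⟩ := Submodule.mem_sup.1 (h hz)
    rw [map_add]
    refine add_mem ?_ ?_
    · convert Submodule.zero_mem _
      exact Ideal.Quotient.eq_zero_iff_mem.2 ha.1
    · have : f.toLinearMap (LinearMap.mulLeft k x b) = f x * f.toLinearMap b := by simp
      rw [this]
      exact Submodule.mul_mem_mul (Submodule.subset_span ⟨0, rfl⟩) ⟨b, hb, rfl⟩

/-- If 𝔫 were the only minimal prime of K, then K would contain all components of large degree.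
Another minimal prime lies strictly below 𝔫. -/
theorem one_le_ringKrullDim_quotient [IsNoetherianRing S] (hK : K.IsHomogeneous 𝒜)
    (h : ∀ M, ∃ m, M ≤ m ∧ ¬ 𝒜 m ≤ K.restrictScalars k) : 1 ≤ ringKrullDim (S ⧸ K) := by
  have h𝔫p : (HomogeneousIdeal.irrelevant 𝒜).toIdeal.IsPrime :=
    IsStandardGraded.isPrime_irrelevant 𝒜
  have hex : ∃ P ∈ K.minimalPrimes, P ≠ (HomogeneousIdeal.irrelevant 𝒜).toIdeal := by
    by_contra! hall
    obtain ⟨t, ht⟩ := exists_irrelevant_pow_le hall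
    obtain ⟨m, hm, hmK⟩ := h t
    exact hmK fun x hx => ht (mem_irrelevant_pow hm hx)
  obtain ⟨P, hP, hne⟩ := hex
  have hle := le_irrelevant_of_mem_minimalPrimes 𝒜 hK hP
  have hPp : P.IsPrime := hP.1.1
  rw [ringKrullDim_quotient, Order.one_le_krullDim_iff]
  exact ⟨⟨⟨P, hPp⟩, hP.1.2⟩, ⟨⟨_, h𝔫p⟩, hP.1.2.trans hle⟩,
    PrimeSpectrum.asIdeal_lt_asIdeal _ _ |>.1 (lt_of_le_of_ne hle hne)⟩

/-- The lengths are partial sums of a Hilbert function eventually equal to q, so their averages tend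
to q. Positivity of q ensures that the dimension is one and not smaller. -/
theorem hasMultiplicity_quotient [IsNoetherianRing S] (hK : K.IsHomogeneous 𝒜) {x : S} {M q : ℕ} (hq : 0 < q)
    (h : ∀ m, M ≤ m → Module.finrank k (𝒜 m) = Module.finrank k (degreePart 𝒜 K m) + q ∧
      𝒜 (m + 1) ≤ degreePart 𝒜 K (m + 1) ⊔ (𝒜 m).map (LinearMap.mulLeft k x)) :
    HasMultiplicity (HomogeneousIdeal.irrelevant 𝒜).toIdeal (S ⧸ K) (q : ℝ≥0∞) := by
  refine ⟨1, ?_, ?_⟩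
  · rw [Module.supportDim_quotient_eq_ringKrullDim]
    refine le_antisymm (ringKrullDim_quotient_le_one 𝒜 (h M le_rfl).2)
      (one_le_ringKrullDim_quotient 𝒜 hK fun M' => ⟨max M M', le_max_right _ _, fun hle => ?_⟩)
    have h1 := Submodule.finrank_mono (R := k) (s := 𝒜 (max M M'))
      (t := degreePart 𝒜 K (max M M')) (le_inf hle le_rfl)
    have h2 := (h (max M M') (le_max_left _ _)).1
    omega
  set 𝔫 := (HomogeneousIdeal.irrelevant 𝒜).toIdeal with h𝔫
  have hlen : ∀ n, Module.length S ((S ⧸ K) ⧸ (𝔫 ^ n • ⊤ : Submodule S (S ⧸ K))) =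
      ((∑ e ∈ Finset.range n, (Module.finrank k (𝒜 e) - Module.finrank k (degreePart 𝒜 K e)) :
        ℕ) : ℕ∞) := by
    intro n
    have h𝔫n : (𝔫 ^ n).IsHomogeneous 𝒜 :=
      ((generatedInDegree_irrelevant 𝒜).pow n).isHomogeneous
    have hu := hK.sup h𝔫n
    let π₀ : S →ₗ[S] (S ⧸ K) ⧸ (𝔫 ^ n • ⊤ : Submodule S (S ⧸ K)) :=
      (Submodule.mkQ _).comp (Submodule.mkQ K)
    have hker : ∀ y, π₀ y = 0 ↔ y ∈ K ⊔ 𝔫 ^ n := by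
      intro y
      change Submodule.mkQ _ (Submodule.mkQ K y) = 0 ↔ _
      rw [Submodule.mkQ_apply, Submodule.Quotient.mk_eq_zero,
        ← Submodule.range_mkQ K, ← Submodule.map_top, ← Submodule.map_smul'',
        ← Submodule.mem_comap, Submodule.comap_map_mkQ]
      simp
    let π : (⊤ : Ideal S).restrictScalars k →ₗ[k]
        (S ⧸ K) ⧸ (𝔫 ^ n • ⊤ : Submodule S (S ⧸ K)) :=
      (π₀.restrictScalars k).comp (Submodule.subtype _)
    have hπ : Function.Surjective π := by
      intro z
      obtain ⟨z, rfl⟩ := Submodule.mkQ_surjective _ z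
      obtain ⟨y, rfl⟩ := Submodule.mkQ_surjective _ z
      exact ⟨⟨y, trivial⟩, rfl⟩
    obtain ⟨hfin, hsum⟩ := finrank_add_sum_finrank_degreePart 𝒜 hu (Ideal.IsHomogeneous.top 𝒜)
      le_top (B := n) (fun e he y hy =>
        ⟨Ideal.mem_sup_right (mem_irrelevant_pow he hy.2), hy.2⟩) π hπ fun y => hker y
    rw [length_eq_length_of_pow_smul_eq_zero (k := k) (𝔪 := 𝔫)
      (exists_algebraMap_sub_mem_irrelevant 𝒜) n, Module.length_eq_finrank]
    · congr 1
      have hKe : ∀ e ∈ Finset.range n, degreePart 𝒜 (K ⊔ 𝔫 ^ n) e = degreePart 𝒜 K e := by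
        intro e he
        refine le_antisymm ((degreePart_sup_le hK h𝔫n e).trans ?_)
          (degreePart_mono le_sup_left e)
        have := ((generatedInDegree_irrelevant 𝒜).pow n).degreePart_eq_bot (e := e)
          (by simpa using he)
        rw [this, sup_bot_eq]
      rw [Finset.sum_congr rfl fun e he => by rw [hKe e he]] at hsum
      rw [Finset.sum_congr (f := fun e => Module.finrank k (degreePart 𝒜 ⊤ e))
        (g := fun e => Module.finrank k (𝒜 e)) rfl fun e _ => by rw [degreePart_top]] at hsum
      rw [Finset.sum_tsub_distrib _ fun e _ => Submodule.finrank_mono (degreePart_le _ _), ← hsum,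
        Nat.add_sub_cancel]
    · intro a ha z
      obtain ⟨z, rfl⟩ := Submodule.mkQ_surjective _ z
      rw [← map_smul, Submodule.mkQ_apply, Submodule.Quotient.mk_eq_zero]
      exact Submodule.smul_mem_smul ha trivial
  simp only [hlen]
  refine tendsto_factorial_div_pow_mul (δ := 1) (tendsto_sum_div_of_eventually_eq (M := M)
    fun m hm => ?_)
  have := (h m hm).1
  omega

end GradedLength

/-! ### The torsion of Jⁿ / Jⁿ⁺¹ -/

section SaturatedPowers

variable {k S : Type*} [Field k] [CommRing S] [Algebra k S]

/-- The elements of `Jⁿ` whose class in `Jⁿ / Jⁿ⁺¹` is killed by a power of `𝔮`. -/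
def saturatedPower (𝔮 J : Ideal S) (n : ℕ) : Ideal S :=
  J ^ n ⊓ (zerothLocalCohomology 𝔮 (S ⧸ J ^ (n + 1))).comap (Submodule.mkQ (J ^ (n + 1)))

theorem mem_saturatedPower {𝔮 J : Ideal S} {n : ℕ} {x : S} : x ∈ saturatedPower 𝔮 J n ↔
    x ∈ J ^ n ∧ ∃ t, ∀ a ∈ 𝔮 ^ t, a * x ∈ J ^ (n + 1) := by
  refine and_congr_right fun _ => exists_congr fun t => forall₂_congr fun a _ => ?_
  rw [← map_smul, Submodule.mkQ_apply, Submodule.Quotient.mk_eq_zero, smul_eq_mul]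

theorem saturatedPower_le (𝔮 J : Ideal S) (n : ℕ) : saturatedPower 𝔮 J n ≤ J ^ n := inf_le_left

theorem pow_succ_le_saturatedPower (𝔮 J : Ideal S) (n : ℕ) :
    J ^ (n + 1) ≤ saturatedPower 𝔮 J n := fun _ hx =>
  mem_saturatedPower.2 ⟨Ideal.pow_le_pow_right n.le_succ hx, 0,
    fun _ _ => Ideal.mul_mem_left _ _ hx⟩

/-- The `J`-filtration of `S` by the saturated powers. -/
def saturatedPowerFiltration (𝔮 J : Ideal S) : J.Filtration S where
  N := saturatedPower 𝔮 J
  mono n := (saturatedPower_le 𝔮 J (n + 1)).trans (pow_succ_le_saturatedPower 𝔮 J n)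
  smul_le n := by
    rw [Submodule.smul_le]
    intro y hy x hx
    obtain ⟨hx, t, ht⟩ := mem_saturatedPower.1 hx
    refine mem_saturatedPower.2 ⟨?_, t, fun a ha => ?_⟩
    · rw [pow_succ']; exact Ideal.mul_mem_mul hy hx
    · rw [pow_succ', smul_eq_mul, mul_left_comm]
      exact Ideal.mul_mem_mul hy (ht a ha)

theorem saturatedPowerFiltration_stable [IsNoetherianRing S] (𝔮 J : Ideal S) :
    (saturatedPowerFiltration 𝔮 J).Stable := by
  refine Ideal.Filtration.Stable.of_le (Ideal.stableFiltration_stable J ⊤) fun n => ?_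
  change _ ≤ J ^ n • ⊤
  rw [Ideal.smul_eq_mul, Ideal.mul_top]
  exact saturatedPower_le 𝔮 J n

/-- Artin–Rees for the filtration by saturated powers; it makes later bounds on the torsion uniform
in n. -/
theorem exists_saturatedPower_add [IsNoetherianRing S] (𝔮 J : Ideal S) :
    ∃ n₁, ∀ j, saturatedPower 𝔮 J (n₁ + j) = J ^ j * saturatedPower 𝔮 J n₁ := by
  obtain ⟨n₁, h⟩ := saturatedPowerFiltration_stable 𝔮 J
  refine ⟨n₁, fun j => ?_⟩
  induction j with
  | zero => simp
  | succ j ih =>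
    rw [pow_succ', mul_assoc, ← ih]
    exact (h (n₁ + j) (Nat.le_add_right _ _)).symm

theorem exists_pow_mul_saturatedPower_le [IsNoetherianRing S] (𝔮 J : Ideal S) (n : ℕ) :
    ∃ T, 𝔮 ^ T * saturatedPower 𝔮 J n ≤ J ^ (n + 1) :=
  exists_pow_mul_le fun _ hz => (mem_saturatedPower.1 hz).2

variable (𝒜 : ℕ → Submodule k S) [GradedAlgebra 𝒜] [IsStandardGraded 𝒜] {J : Ideal S} {r : ℕ}

theorem isHomogeneous_saturatedPower [IsNoetherianRing S] (hJ : GeneratedInDegree 𝒜 J r) (n : ℕ) :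
    (saturatedPower (HomogeneousIdeal.irrelevant 𝒜).toIdeal J n).IsHomogeneous 𝒜 := by
  obtain ⟨T, hT⟩ := exists_pow_mul_saturatedPower_le (HomogeneousIdeal.irrelevant 𝒜).toIdeal J n
  have h : saturatedPower (HomogeneousIdeal.irrelevant 𝒜).toIdeal J n = J ^ n ⊓ (J ^ (n + 1)).colon
      (((HomogeneousIdeal.irrelevant 𝒜).toIdeal ^ T : Ideal S) : Set S) := by
    refine le_antisymm (le_inf (saturatedPower_le _ _ _) fun x hx => ?_) fun x hx => ?_
    · refine Submodule.mem_colon.2 fun a ha => ?_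
      rw [smul_eq_mul, mul_comm]
      exact hT (Ideal.mul_mem_mul ha hx)
    · refine mem_saturatedPower.2 ⟨hx.1, T, fun a ha => ?_⟩
      rw [mul_comm]
      exact Submodule.mem_colon.1 hx.2 a ha
  rw [h]
  exact (hJ.pow n).isHomogeneous.inf (isHomogeneous_colon (hJ.pow (n + 1)).isHomogeneous
    ((generatedInDegree_irrelevant 𝒜).pow T))

/-- At n₁ the torsion is killed by a power of 𝔫, hence lives in bounded degrees. Passing to n₁ + j
multiplies by Jʲ, generated in degree rj, so the bound moves exactly with rn. -/
theorem exists_degreePart_saturatedPower_le [IsNoetherianRing S] (hJ : GeneratedInDegree 𝒜 J r) :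
    ∃ M n₁, ∀ n, n₁ ≤ n → ∀ e, r * n + M ≤ e →
      degreePart 𝒜 (saturatedPower (HomogeneousIdeal.irrelevant 𝒜).toIdeal J n) e ≤
        degreePart 𝒜 (J ^ (n + 1)) e := by
  set 𝔫 := (HomogeneousIdeal.irrelevant 𝒜).toIdeal with h𝔫
  obtain ⟨n₁, hn₁⟩ := exists_saturatedPower_add 𝔫 J
  obtain ⟨T, hT⟩ := exists_pow_mul_saturatedPower_le 𝔫 J n₁
  obtain ⟨D, hD⟩ := exists_degreePart_le_mul (𝒜 := 𝒜) (L := saturatedPower 𝔫 J n₁)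
    (𝔮 := 𝔫 ^ T) (t := T) fun m hm x hx => mem_irrelevant_pow hm hx
  refine ⟨D, n₁, fun n hn e he => ?_⟩
  obtain ⟨j, rfl⟩ := Nat.exists_eq_add_of_le hn
  obtain ⟨b, rfl⟩ := Nat.exists_eq_add_of_le he
  rw [hn₁ j, show r * (n₁ + j) + D + b = r * j + (r * n₁ + D + b) by ring,
    (hJ.pow j).degreePart_mul (isHomogeneous_saturatedPower 𝒜 hJ n₁),
    show n₁ + j + 1 = j + (n₁ + 1) by ring, pow_add]
  refine Submodule.mul_le.2 fun u hu v hv => ⟨Ideal.mul_mem_mul hu.1 (hT ?_),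
    SetLike.mul_mem_graded hu.2 hv.2⟩
  exact hD _ (by omega) v hv

/-- Multiplication sends (Jⁿ)ₑ to Hom(S_t, (Jⁿ / Jⁿ⁺¹) in degree e + t). Its kernel is killed by 𝔫ᵗ
modulo Jⁿ⁺¹, hence lies in the saturated power. The terms are moved across to avoid subtraction. -/
theorem finrank_le_finrank_saturatedPower_add (n e t : ℕ) :
    Module.finrank k (degreePart 𝒜 (J ^ n) e) +
        Module.finrank k (𝒜 t) * Module.finrank k (degreePart 𝒜 (J ^ (n + 1)) (e + t)) ≤
      Module.finrank k (degreePart 𝒜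
        (saturatedPower (HomogeneousIdeal.irrelevant 𝒜).toIdeal J n) e) +
        Module.finrank k (𝒜 t) * Module.finrank k (degreePart 𝒜 (J ^ n) (e + t)) := by
  set 𝔫 := (HomogeneousIdeal.irrelevant 𝒜).toIdeal with h𝔫
  let H := degreePart 𝒜 (J ^ n) e
  let Q := QuotientComponent 𝒜 (J ^ (n + 1)) (J ^ n) (e + t)
  have hQ := QuotientComponent.finrank_add 𝒜 (Ideal.pow_le_pow_right (I := J) n.le_succ) (e + t)
  let mulMap : H →ₗ[k] 𝒜 t →ₗ[k] degreePart 𝒜 (J ^ n) (e + t) :=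
    LinearMap.mk₂ k (fun x a => ⟨x * a, Ideal.mul_mem_right _ _ x.2.1,
      SetLike.mul_mem_graded x.2.2 a.2⟩)
      (fun _ _ _ => Subtype.ext (add_mul _ _ _)) (fun _ _ _ => Subtype.ext (smul_mul_assoc _ _ _))
      (fun _ _ _ => Subtype.ext (mul_add _ _ _)) (fun _ _ _ => Subtype.ext (mul_smul_comm _ _ _))
  let Ψ : H →ₗ[k] 𝒜 t →ₗ[k] Q :=
    (LinearMap.compRight k (QuotientComponent.mk 𝒜 (J ^ (n + 1)) (J ^ n) (e + t))).comp mulMap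
  have hker : (LinearMap.ker Ψ).map H.subtype ≤ degreePart 𝒜 (saturatedPower 𝔫 J n) e := by
    rintro _ ⟨x, hx, rfl⟩
    refine ⟨mem_saturatedPower.2 ⟨x.2.1, t, fun a ha => ?_⟩, x.2.2⟩
    rw [← (generatedInDegree_irrelevant 𝒜 |>.pow t).span_degreePart] at ha
    refine Submodule.span_induction ?_ ?_ ?_ ?_ ha
    · intro a ha
      have ha' : a ∈ 𝒜 t := by simpa using ha.2
      have h1 := LinearMap.congr_fun (LinearMap.mem_ker.1 hx) ⟨a, ha'⟩
      rw [mul_comm]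
      exact (QuotientComponent.mk_eq_zero 𝒜 _).1 h1
    · simp
    · intro a b _ _ ha hb
      rw [add_mul]; exact add_mem ha hb
    · intro s a _ ha
      rw [smul_eq_mul, mul_assoc]; exact Ideal.mul_mem_left _ _ ha
  have h1 := LinearMap.finrank_range_add_finrank_ker Ψ
  have h2 := Submodule.finrank_mono hker
  rw [← (Submodule.equivMapOfInjective H.subtype H.injective_subtype _).finrank_eq] at h2
  change _ ≤ Module.finrank k (degreePart 𝒜 (saturatedPower 𝔫 J n) e) at h2
  have h3 := Submodule.finrank_le (LinearMap.range Ψ)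
  rw [Module.finrank_linearMap] at h3
  have h4 : Module.finrank k (𝒜 t) * Module.finrank k Q +
      Module.finrank k (𝒜 t) * Module.finrank k (degreePart 𝒜 (J ^ (n + 1)) (e + t)) =
      Module.finrank k (𝒜 t) * Module.finrank k (degreePart 𝒜 (J ^ n) (e + t)) := by
    rw [← mul_add, hQ]
  change _ = Module.finrank k (degreePart 𝒜 (J ^ n) e) at h1
  omega

end SaturatedPowers

/-! ### Asymptotic dimension of the torsion -/

section SaturatedPowerLimits

variable {k S : Type*} [Field k] [CommRing S] [Algebra k S]
  (𝒜 : ℕ → Submodule k S) [GradedAlgebra 𝒜] [IsStandardGraded 𝒜] {J : Ideal S} {r : ℕ}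

theorem tendsto_div_pow_of_succ {a : ℕ → ℕ} {δ : ℕ} {v : ℝ}
    (h : Tendsto (fun n : ℕ => (a (n + 1) : ℝ) / (n : ℝ) ^ δ) atTop (𝓝 v)) :
    Tendsto (fun n : ℕ => (a n : ℝ) / (n : ℝ) ^ δ) atTop (𝓝 v) := by
  rw [← tendsto_add_atTop_iff_nat 1]
  have h1 := h.mul (tendsto_add_pow_div_pow 1 δ)
  rw [mul_one] at h1
  refine h1.congr' ?_
  filter_upwards [eventually_ge_atTop 1] with n hn
  have hn' : (n : ℝ) ^ δ ≠ 0 := by positivity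
  rw [div_mul_div_cancel₀ hn', add_comm 1 n]

theorem tendsto_finrank_saturatedPower {δ q m₁ : ℕ} {c : ℕ → ℕ}
    (hc : ∀ m, Tendsto (fun n : ℕ =>
        (Module.finrank k (degreePart 𝒜 (J ^ (n + 1)) (r * (n + 1) + m)) : ℝ) / (n : ℝ) ^ δ) atTop
        (𝓝 (c m / (δ ! : ℝ))))
    (hq : ∀ m, m₁ ≤ m → c m = q) (m : ℕ) :
    Tendsto (fun n : ℕ => (Module.finrank k (degreePart 𝒜
      (saturatedPower (HomogeneousIdeal.irrelevant 𝒜).toIdeal J n) (r * n + m)) : ℝ) /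
        (n : ℝ) ^ δ) atTop (𝓝 (c m / (δ ! : ℝ))) := by
  have hc' := fun m => tendsto_div_pow_of_succ
    (a := fun n => Module.finrank k (degreePart 𝒜 (J ^ n) (r * n + m))) (hc m)
  have hlow := (hc' m).add (((hc (m + m₁)).sub (hc' (m + r + m₁))).const_mul
    (Module.finrank k (𝒜 (r + m₁)) : ℝ))
  rw [hq (m + m₁) (by omega), hq (m + r + m₁) (by omega), sub_self, mul_zero, add_zero] at hlow
  refine tendsto_of_tendsto_of_tendsto_of_le_of_le hlow (hc' m) (fun n => ?_) fun n => ?_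
  · have h1 := finrank_le_finrank_saturatedPower_add 𝒜 (J := J) n (r * n + m) (r + m₁)
    rw [show r * n + m + (r + m₁) = r * (n + 1) + (m + m₁) by ring] at h1
    have h0 : Module.finrank k (degreePart 𝒜 (J ^ n) (r * (n + 1) + (m + m₁))) =
        Module.finrank k (degreePart 𝒜 (J ^ n) (r * n + (m + r + m₁))) := by
      rw [show r * (n + 1) + (m + m₁) = r * n + (m + r + m₁) by ring]
    rw [h0] at h1
    have h2 : (Module.finrank k (degreePart 𝒜 (J ^ n) (r * n + m)) : ℝ) +
        Module.finrank k (𝒜 (r + m₁)) *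
          (Module.finrank k (degreePart 𝒜 (J ^ (n + 1)) (r * (n + 1) + (m + m₁))) -
          Module.finrank k (degreePart 𝒜 (J ^ n) (r * n + (m + r + m₁)))) ≤
        Module.finrank k (degreePart 𝒜
          (saturatedPower (HomogeneousIdeal.irrelevant 𝒜).toIdeal J n) (r * n + m)) := by
      have h3 : ((_ : ℕ) : ℝ) ≤ ((_ : ℕ) : ℝ) := Nat.cast_le.2 h1
      push_cast at h3
      linarith
    calc _ = _ := ?_
      _ ≤ _ := div_le_div_of_nonneg_right h2 (by positivity)
    ring
  · gcongr
    exact Submodule.finrank_mono (degreePart_mono (saturatedPower_le _ _ _) _)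

theorem sum_finrank_degreePart {L : Ideal S} {a : ℕ} (hL : ∀ e < a, degreePart 𝒜 L e = ⊥)
    (b : ℕ) : ∑ e ∈ Finset.range (a + b), Module.finrank k (degreePart 𝒜 L e) =
      ∑ m ∈ Finset.range b, Module.finrank k (degreePart 𝒜 L (a + m)) := by
  rw [Finset.sum_range_add, Finset.sum_eq_zero, zero_add]
  intro e he
  rw [hL e (Finset.mem_range.1 he), finrank_bot]

/-- The dimensions of the torsion submodules of `Jⁿ / Jⁿ⁺¹` grow like `r q nᵟ / δ!`. -/
theorem tendsto_finrank_torsion (hJ : GeneratedInDegree 𝒜 J r) {δ q m₁ : ℕ} {c : ℕ → ℕ}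
    (hc : ∀ m, Tendsto (fun n : ℕ =>
        (Module.finrank k (degreePart 𝒜 (J ^ (n + 1)) (r * (n + 1) + m)) : ℝ) / (n : ℝ) ^ δ) atTop
        (𝓝 (c m / (δ ! : ℝ))))
    (hq : ∀ m, m₁ ≤ m → c m = q) {a : ℕ → ℕ} {M : ℕ} (hM : m₁ ≤ M)
    (ha : ∀ᶠ n in atTop, a n + ∑ e ∈ Finset.range (r * n + (M + r)),
        Module.finrank k (degreePart 𝒜 (J ^ (n + 1)) e) =
      ∑ e ∈ Finset.range (r * n + (M + r)), Module.finrank k (degreePart 𝒜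
        (saturatedPower (HomogeneousIdeal.irrelevant 𝒜).toIdeal J n) e)) :
    Tendsto (fun n : ℕ => (a n : ℝ) / (n : ℝ) ^ δ) atTop (𝓝 ((r * q : ℕ) / (δ ! : ℝ))) := by
  have h1 := (tendsto_finsetSum (Finset.range (M + r)) fun m _ =>
    tendsto_finrank_saturatedPower 𝒜 hc hq m).sub
    (tendsto_finsetSum (Finset.range M) fun m _ => hc m)
  -- The cutoff rn + (M + r) = r(n+1) + M leaves M + r components of Γₙ and M of Jⁿ⁺¹; the surplus
  -- indices are at least M ≥ m₁, where c = q. This is the source of the factor r.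
  have h2 : ∑ m ∈ Finset.range (M + r), (c m : ℝ) / (δ ! : ℝ) -
      ∑ m ∈ Finset.range M, (c m : ℝ) / (δ ! : ℝ) = (r * q : ℕ) / (δ ! : ℝ) := by
    rw [Finset.sum_range_add, add_sub_cancel_left,
      Finset.sum_congr rfl fun i _ => by rw [hq (M + i) (by omega)]]
    simp [mul_div_assoc]
  rw [h2] at h1
  refine h1.congr' ?_
  filter_upwards [ha] with n hn
  have h3 := sum_finrank_degreePart 𝒜 (L := J ^ (n + 1)) (a := r * (n + 1))
    (fun e he => (hJ.pow (n + 1)).degreePart_eq_bot he) M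
  have h4 := sum_finrank_degreePart 𝒜
    (L := saturatedPower (HomogeneousIdeal.irrelevant 𝒜).toIdeal J n) (a := r * n)
    (fun e he => le_bot_iff.1 ((degreePart_mono (saturatedPower_le _ _ _) e).trans
      ((hJ.pow n).degreePart_eq_bot he).le)) (M + r)
  rw [show r * (n + 1) + M = r * n + (M + r) by ring] at h3
  rw [h3, h4] at hn
  rw [← Finset.sum_div, ← Finset.sum_div, ← sub_div]
  congr 1
  rw [sub_eq_iff_eq_add]
  exact_mod_cast hn.symm

end SaturatedPowerLimits

/-! ### Torsion and localization at the irrelevant ideal -/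

section LocalTorsion

variable {k S : Type*} [Field k] [CommRing S] [Algebra k S]
  (𝒜 : ℕ → Submodule k S) [GradedAlgebra 𝒜] [IsStandardGraded 𝒜] {J : Ideal S}

/-- An element outside 𝔫 is comaximal with 𝔫, hence a unit modulo every power of it. So denominators
can be removed on anything killed by a power of 𝔫. -/
theorem exists_one_sub_mul_mem_irrelevant_pow {s : S}
    (hs : s ∉ (HomogeneousIdeal.irrelevant 𝒜).toIdeal) (t : ℕ) :
    ∃ u, 1 - u * s ∈ (HomogeneousIdeal.irrelevant 𝒜).toIdeal ^ t := by
  obtain ⟨c, hc⟩ := exists_algebraMap_sub_mem_irrelevant 𝒜 s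
  have hc0 : c ≠ 0 := by
    rintro rfl
    rw [map_zero, sub_zero] at hc
    exact hs hc
  have h : IsCoprime (Ideal.span {s}) (HomogeneousIdeal.irrelevant 𝒜).toIdeal := by
    rw [Ideal.isCoprime_iff_exists]
    refine ⟨algebraMap k S c⁻¹ * s, Ideal.mul_mem_left _ _ (Ideal.mem_span_singleton_self s),
      algebraMap k S c⁻¹ * (algebraMap k S c - s), Ideal.mul_mem_left _ _ ?_, ?_⟩
    · rw [← neg_sub]; exact neg_mem hc
    · rw [← mul_add, add_sub_cancel, ← map_mul, inv_mul_cancel₀ hc0, map_one]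
  obtain ⟨x, hx, y, hy, hxy⟩ := Ideal.isCoprime_iff_exists.1 (h.pow_right (n := t))
  obtain ⟨u, rfl⟩ := Ideal.mem_span_singleton'.1 hx
  exact ⟨u, by rw [← hxy, add_sub_cancel_left]; exact hy⟩

variable (R : Type*) [CommRing R] [IsLocalRing R] [Algebra S R]
  [IsLocalization.AtPrime R (HomogeneousIdeal.irrelevant 𝒜).toIdeal]

theorem mem_of_algebraMap_mem_map {𝔟 : Ideal S} {x : S} {t : ℕ}
    (ht : ∀ a ∈ (HomogeneousIdeal.irrelevant 𝒜).toIdeal ^ t, a * x ∈ 𝔟)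
    (hx : algebraMap S R x ∈ 𝔟.map (algebraMap S R)) : x ∈ 𝔟 := by
  obtain ⟨s, hs, hsx⟩ := (IsLocalization.algebraMap_mem_map_algebraMap_iff
    (HomogeneousIdeal.irrelevant 𝒜).toIdeal.primeCompl R 𝔟 x).1 hx
  obtain ⟨u, hu⟩ := exists_one_sub_mul_mem_irrelevant_pow 𝒜 hs t
  have h : x = (1 - u * s) * x + u * (s * x) := by ring
  rw [h]
  exact add_mem (ht _ hu) (Ideal.mul_mem_left _ _ hsx)

/-- Torsion elements of a localized module come from torsion elements. -/
theorem exists_algebraMap_sub_mem_map [IsNoetherianRing S] {𝔞 𝔟 : Ideal S}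
    {y : R} (hy : y ∈ 𝔞.map (algebraMap S R)) {t : ℕ}
    (ht : ∀ a ∈ (HomogeneousIdeal.irrelevant 𝒜).toIdeal ^ t,
      algebraMap S R a * y ∈ 𝔟.map (algebraMap S R)) :
    ∃ x ∈ 𝔞, (∀ a ∈ (HomogeneousIdeal.irrelevant 𝒜).toIdeal ^ t, a * x ∈ 𝔟) ∧
      y - algebraMap S R x ∈ 𝔟.map (algebraMap S R) := by
  set 𝔫 := (HomogeneousIdeal.irrelevant 𝒜).toIdeal with h𝔫
  have h𝔫p : 𝔫.IsPrime := IsStandardGraded.isPrime_irrelevant 𝒜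
  obtain ⟨⟨⟨x, hx⟩, s⟩, hxs⟩ :=
    (IsLocalization.mem_map_algebraMap_iff 𝔫.primeCompl R).1 hy
  simp only at hxs
  obtain ⟨w, hw, hwx⟩ := exists_notMem_colon (P := 𝔫) (J := 𝔫 ^ t)
    (𝔞 := 𝔟.colon {x}) fun a ha => by
      have h1 := Ideal.mul_mem_right (algebraMap S R s) _ (ht a ha)
      rw [mul_assoc, hxs, ← map_mul] at h1
      obtain ⟨c, hc, hcx⟩ := (IsLocalization.algebraMap_mem_map_algebraMap_iff
        𝔫.primeCompl R 𝔟 (a * x)).1 h1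
      refine ⟨c, hc, Submodule.mem_colon_singleton.2 ?_⟩
      rw [smul_eq_mul, mul_assoc]
      exact hcx
  have hwx' : ∀ a ∈ 𝔫 ^ t, a * (w * x) ∈ 𝔟 := fun a ha => by
    have h1 := Submodule.mem_colon_singleton.1 (Submodule.mem_colon.1 hwx a ha)
    rw [smul_eq_mul, smul_eq_mul] at h1
    rwa [← mul_assoc, mul_comm a]
  -- The element w clears the denominators for all of 𝔫ᵗ at once, so wx is genuinely torsion modulo
  -- 𝔟. Inverting ws modulo 𝔫ᵗ turns the fraction wx / (ws) into u(wx).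
  obtain ⟨u, hu⟩ := exists_one_sub_mul_mem_irrelevant_pow 𝒜
    (h𝔫p.mul_notMem hw s.2) t
  refine ⟨u * (w * x), Ideal.mul_mem_left _ _ (Ideal.mul_mem_left _ _ hx), fun a ha => ?_, ?_⟩
  · rw [mul_left_comm]
    exact Ideal.mul_mem_left _ _ (hwx' a ha)
  · have hunit : IsUnit (algebraMap S R (w * s)) :=
      IsLocalization.map_units R (⟨w * s, h𝔫p.mul_notMem hw s.2⟩ : 𝔫.primeCompl)
    rw [← Ideal.mul_unit_mem_iff_mem _ hunit]
    have h1 : (y - algebraMap S R (u * (w * x))) * algebraMap S R (w * s) =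
        algebraMap S R ((1 - u * (w * s)) * (w * x)) := by
      simp only [map_mul, map_sub, map_one]
      linear_combination (algebraMap S R w) * hxs
    rw [h1]
    exact Ideal.mem_map_of_mem _ (hwx' _ hu)

end LocalTorsion

section LocalTorsionLength

variable {k S : Type*} [Field k] [CommRing S] [Algebra k S]
  (𝒜 : ℕ → Submodule k S) [GradedAlgebra 𝒜] [IsStandardGraded 𝒜]
  {R : Type*} [CommRing R] [IsLocalRing R] [Algebra S R] [Algebra k R] [IsScalarTower k S R]

theorem exists_sub_algebraMap_mem_maximalIdeal
    [IsLocalization.AtPrime R (HomogeneousIdeal.irrelevant 𝒜).toIdeal] (y : R) :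
    ∃ c : k, y - algebraMap k R c ∈ IsLocalRing.maximalIdeal R := by
  obtain ⟨⟨x, s⟩, hxs⟩ :=
    IsLocalization.surj (HomogeneousIdeal.irrelevant 𝒜).toIdeal.primeCompl y
  obtain ⟨u, hu⟩ := exists_one_sub_mul_mem_irrelevant_pow 𝒜 s.2 1
  obtain ⟨c, hc⟩ := exists_algebraMap_sub_mem_irrelevant 𝒜 (u * x)
  have hmap := IsLocalization.AtPrime.map_eq_maximalIdeal
    (HomogeneousIdeal.irrelevant 𝒜).toIdeal R
  refine ⟨c, ?_⟩
  rw [← hmap]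
  rw [pow_one] at hu
  have h1 : y - algebraMap k R c = algebraMap S R (1 - u * s) * y +
      algebraMap S R (u * x - algebraMap k S c) := by
    rw [IsScalarTower.algebraMap_apply k S R]
    simp only [map_mul, map_sub, map_one]
    linear_combination (algebraMap S R u) * hxs
  rw [h1]
  exact add_mem (Ideal.mul_mem_right _ _ (Ideal.mem_map_of_mem _ hu)) (Ideal.mem_map_of_mem _ hc)

/-- The length of the torsion of a localized quotient of homogeneous ideals. -/
theorem exists_length_zerothLocalCohomology [IsNoetherianRing S]
    [IsLocalization.AtPrime R (HomogeneousIdeal.irrelevant 𝒜).toIdeal] {𝔞 𝔟 Γ : Ideal S}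
    {A A' : Ideal R} (hA : A = 𝔞.map (algebraMap S R)) (hA' : A' = 𝔟.map (algebraMap S R))
    (h𝔟 : 𝔟 ≤ 𝔞) (hΓ : ∀ x, x ∈ Γ ↔ x ∈ 𝔞 ∧
      ∃ t, ∀ a ∈ (HomogeneousIdeal.irrelevant 𝒜).toIdeal ^ t, a * x ∈ 𝔟)
    (h𝔟h : 𝔟.IsHomogeneous 𝒜) (hΓh : Γ.IsHomogeneous 𝒜) {B : ℕ}
    (hB : ∀ e, B ≤ e → degreePart 𝒜 Γ e ≤ degreePart 𝒜 𝔟 e) :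
    ∃ a : ℕ, Module.length R (zerothLocalCohomology (IsLocalRing.maximalIdeal R)
        (A ⧸ A'.submoduleOf A)) = a ∧
      a + ∑ e ∈ Finset.range B, Module.finrank k (degreePart 𝒜 𝔟 e) =
        ∑ e ∈ Finset.range B, Module.finrank k (degreePart 𝒜 Γ e) := by
  set 𝔫 := (HomogeneousIdeal.irrelevant 𝒜).toIdeal with h𝔫
  have hmap : 𝔫.map (algebraMap S R) = IsLocalRing.maximalIdeal R :=
    IsLocalization.AtPrime.map_eq_maximalIdeal 𝔫 R
  have hΓA : ∀ x ∈ Γ, algebraMap S R x ∈ A := fun x hx => by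
    rw [hA]; exact Ideal.mem_map_of_mem _ ((hΓ x).1 hx).1
  have hpow : ∀ (t : ℕ) (y : R), (∀ a ∈ 𝔫 ^ t, algebraMap S R a * y ∈ A') →
      ∀ b ∈ IsLocalRing.maximalIdeal R ^ t, b * y ∈ A' := by
    intro t y h b hb
    rw [← hmap, ← Ideal.map_pow] at hb
    refine Submodule.span_induction ?_ ?_ ?_ ?_ hb
    · rintro _ ⟨a, ha, rfl⟩; exact h a ha
    · simp
    · intro b c _ _ hb hc
      rw [add_mul]; exact add_mem hb hc
    · intro c b _ hb
      rw [smul_eq_mul, mul_assoc]; exact Ideal.mul_mem_left _ _ hb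
  have hmk : ∀ (b : R) (z : A), b • (A'.submoduleOf A).mkQ z = 0 ↔ b * (z : R) ∈ A' := by
    intro b z
    rw [← map_smul, Submodule.mkQ_apply, Submodule.Quotient.mk_eq_zero]
    rfl
  have hmem : ∀ z : A, (A'.submoduleOf A).mkQ z ∈
      zerothLocalCohomology (IsLocalRing.maximalIdeal R) (A ⧸ A'.submoduleOf A) ↔
      ∃ t, ∀ a ∈ 𝔫 ^ t, algebraMap S R a * z ∈ A' := by
    intro z
    refine ⟨fun ⟨t, ht⟩ => ⟨t, fun a ha => (hmk _ _).1 (ht _ ?_)⟩, fun ⟨t, ht⟩ =>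
      ⟨t, fun b hb => (hmk b z).2 (hpow t z ht b hb)⟩⟩
    rw [← hmap, ← Ideal.map_pow]
    exact Ideal.mem_map_of_mem _ ha
  let emb : Γ.restrictScalars k →ₗ[k] A :=
    { toFun := fun x => ⟨algebraMap S R x, hΓA x x.2⟩
      map_add' := fun x y => Subtype.ext (map_add _ _ _)
      map_smul' := fun c x => Subtype.ext (by
        change algebraMap S R (c • (x : S)) = c • algebraMap S R x
        rw [Algebra.smul_def, map_mul, ← IsScalarTower.algebraMap_apply, Algebra.smul_def]) }
  let π : Γ.restrictScalars k →ₗ[k]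
      zerothLocalCohomology (IsLocalRing.maximalIdeal R) (A ⧸ A'.submoduleOf A) :=
    { toFun := fun x => ⟨(A'.submoduleOf A).mkQ (emb x), (hmem _).2 (by
        obtain ⟨-, t, ht⟩ := (hΓ x).1 x.2
        refine ⟨t, fun a ha => ?_⟩
        change algebraMap S R a * algebraMap S R x ∈ A'
        rw [← map_mul, hA']
        exact Ideal.mem_map_of_mem _ (ht a ha))⟩
      map_add' := fun x y => Subtype.ext (by
        change (A'.submoduleOf A).mkQ _ = _
        rw [map_add, map_add]; rfl)
      map_smul' := fun c x => Subtype.ext (by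
        change (A'.submoduleOf A).mkQ _ = c • (A'.submoduleOf A).mkQ _
        rw [map_smul]; rfl) }
  have hπ : Function.Surjective π := by
    rintro ⟨z, hz⟩
    obtain ⟨⟨y, hy⟩, rfl⟩ := Submodule.mkQ_surjective _ z
    obtain ⟨t, ht⟩ := (hmem _).1 hz
    rw [hA'] at ht
    obtain ⟨x, hx, hxt, hxy⟩ := exists_algebraMap_sub_mem_map 𝒜 R (hA ▸ hy) ht
    refine ⟨⟨x, (hΓ x).2 ⟨hx, t, hxt⟩⟩, Subtype.ext ?_⟩
    change (A'.submoduleOf A).mkQ _ = (A'.submoduleOf A).mkQ _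
    rw [eq_comm, ← sub_eq_zero, ← map_sub, Submodule.mkQ_apply, Submodule.Quotient.mk_eq_zero]
    change y - algebraMap S R x ∈ A'
    rwa [hA']
  have hker : ∀ x, π x = 0 ↔ (x : S) ∈ 𝔟 := by
    intro x
    have h1 : π x = 0 ↔ algebraMap S R x ∈ A' := by
      rw [← Submodule.coe_eq_zero]
      change (A'.submoduleOf A).mkQ _ = 0 ↔ _
      rw [Submodule.mkQ_apply, Submodule.Quotient.mk_eq_zero]
      rfl
    rw [h1, hA']
    obtain ⟨-, t, ht⟩ := (hΓ x).1 x.2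
    exact ⟨fun h => mem_of_algebraMap_mem_map 𝒜 R ht h, fun h => Ideal.mem_map_of_mem _ h⟩
  have h𝔟Γ : 𝔟 ≤ Γ := fun x hx => (hΓ x).2 ⟨h𝔟 hx, 0, fun a _ => Ideal.mul_mem_left _ _ hx⟩
  obtain ⟨hfin, hsum⟩ := finrank_add_sum_finrank_degreePart 𝒜 h𝔟h hΓh h𝔟Γ hB π hπ hker
  obtain ⟨T, hT⟩ := exists_pow_mul_le (𝔮 := 𝔫) (L := Γ) (𝔟 := 𝔟) fun z hz => ((hΓ z).1 hz).2
  refine ⟨_, ?_, hsum⟩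
  rw [length_eq_length_of_pow_smul_eq_zero (k := k) (𝔪 := IsLocalRing.maximalIdeal R)
    (exists_sub_algebraMap_mem_maximalIdeal 𝒜) T, Module.length_eq_finrank]
  intro b hb z
  obtain ⟨x, rfl⟩ := hπ z
  refine Subtype.ext ((hmk b (emb x)).2 (hpow T _ (fun a ha => ?_) b hb))
  change algebraMap S R a * algebraMap S R x ∈ A'
  rw [← map_mul, hA']
  exact Ideal.mem_map_of_mem _ (hT (Ideal.mul_mem_mul ha x.2))

end LocalTorsionLength

/-! ### The j-multiplicity -/

section JMultiplicity

variable {k S : Type*} [Field k] [CommRing S] [Algebra k S]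
  (𝒜 : ℕ → Submodule k S) [GradedAlgebra 𝒜] [IsStandardGraded 𝒜] {J : Ideal S} {r : ℕ}

theorem hasJMultiplicity_map [Infinite k] [IsNoetherianRing S] (hJ : GeneratedInDegree 𝒜 J r) {δ q m₁ : ℕ}
    (hd : ringKrullDim S = (δ + 1 : ℕ)) {c : ℕ → ℕ}
    (hc : ∀ m, Tendsto (fun n : ℕ =>
        (Module.finrank k (degreePart 𝒜 (J ^ (n + 1)) (r * (n + 1) + m)) : ℝ) / (n : ℝ) ^ δ) atTop
        (𝓝 (c m / (δ ! : ℝ))))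
    (hq : ∀ m, m₁ ≤ m → c m = q) :
    HasJMultiplicity (J.map (algebraMap S (LocalizationAtIrrelevant 𝒜)))
      ((r * q : ℕ) : ℝ≥0∞) := by
  refine ⟨δ + 1, δ.succ_pos, ?_, ?_⟩
  · rw [IsLocalization.AtPrime.ringKrullDim_eq_height
      (HomogeneousIdeal.irrelevant 𝒜).toIdeal, height_irrelevant 𝒜 hd]
    rfl
  obtain ⟨M, n₁, hM⟩ := exists_degreePart_saturatedPower_le 𝒜 hJ
  have hlen : ∀ n, ∃ a : ℕ, n₁ ≤ n → Module.length (LocalizationAtIrrelevant 𝒜)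
        (zerothLocalCohomology (IsLocalRing.maximalIdeal (LocalizationAtIrrelevant 𝒜))
          (↥(J.map (algebraMap S (LocalizationAtIrrelevant 𝒜)) ^ n) ⧸
            (J.map (algebraMap S (LocalizationAtIrrelevant 𝒜)) ^ (n + 1)).submoduleOf
              (J.map (algebraMap S (LocalizationAtIrrelevant 𝒜)) ^ n))) = a ∧
      a + ∑ e ∈ Finset.range (r * n + (max M m₁ + r)),
        Module.finrank k (degreePart 𝒜 (J ^ (n + 1)) e) =
      ∑ e ∈ Finset.range (r * n + (max M m₁ + r)), Module.finrank k (degreePart 𝒜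
        (saturatedPower (HomogeneousIdeal.irrelevant 𝒜).toIdeal J n) e) := by
    intro n
    by_cases hn : n₁ ≤ n
    · obtain ⟨a, ha⟩ := exists_length_zerothLocalCohomology 𝒜
        (R := LocalizationAtIrrelevant 𝒜) (𝔞 := J ^ n) (𝔟 := J ^ (n + 1))
        (Γ := saturatedPower (HomogeneousIdeal.irrelevant 𝒜).toIdeal J n)
        (Ideal.map_pow _ _ _).symm (Ideal.map_pow _ _ _).symm (Ideal.pow_le_pow_right n.le_succ)
        (fun x => mem_saturatedPower) (hJ.pow (n + 1)).isHomogeneous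
        (isHomogeneous_saturatedPower 𝒜 hJ n) (B := r * n + (max M m₁ + r)) fun e he =>
          hM n hn e (by have := le_max_left M m₁; omega)
      exact ⟨a, fun _ => ha⟩
    · exact ⟨0, fun h => absurd h hn⟩
  choose a ha using hlen
  have hlim := tendsto_factorial_div_pow_mul (tendsto_finrank_torsion 𝒜 hJ hc hq
    (le_max_right M m₁) (a := a) (by
      filter_upwards [eventually_ge_atTop n₁] with n hn
      exact (ha n hn).2))
  refine hlim.congr' ?_
  filter_upwards [eventually_ge_atTop n₁] with n hn
  rw [(ha n hn).1, Nat.add_sub_cancel]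
  rfl

end JMultiplicity

/-! ### Homogeneous equations of integral dependence -/

section IntegralEquations

/-- The determinant trick for multiplication by v on L. -/
theorem exists_monic_eval_mul_eq_zero {S : Type*} [CommRing S] [IsNoetherianRing S]
    {L 𝔣 : Ideal S} {v : S} (h : ∀ x ∈ L, v * x ∈ 𝔣 * L) :
    ∃ p : Polynomial S, p.Monic ∧ (∀ i, p.coeff i ∈ 𝔣 ^ (p.natDegree - i)) ∧
      ∀ x ∈ L, p.eval v * x = 0 := by
  have hrange : LinearMap.range (algebraMap S (Module.End S L) v) ≤
      𝔣 • (⊤ : Submodule S L) := by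
    rintro _ ⟨⟨x, hx⟩, rfl⟩
    have h1 : v * x ∈ (𝔣 • (⊤ : Submodule S L)).map L.subtype := by
      rw [Submodule.map_smul'', Submodule.map_top, Submodule.range_subtype]
      exact h x hx
    obtain ⟨y, hy, hyx⟩ := h1
    have h2 : algebraMap S (Module.End S L) v ⟨x, hx⟩ = y := Subtype.ext hyx.symm
    rw [h2]
    exact hy
  obtain ⟨p, hp, -, hcoeff, hzero⟩ :=
    LinearMap.exists_monic_and_natDegree_eq_and_coeff_mem_pow_and_aeval_eq_zero S _ 𝔣 hrange
  rw [Polynomial.aeval_algebraMap_apply] at hzero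
  refine ⟨p, hp, hcoeff, fun x hx => ?_⟩
  have := congrArg Subtype.val (LinearMap.congr_fun hzero ⟨x, hx⟩)
  rwa [Polynomial.coe_aeval_eq_eval] at this

variable {k S : Type*} [Field k] [CommRing S] [Algebra k S]
  (𝒜 : ℕ → Submodule k S) [GradedAlgebra 𝒜] [IsStandardGraded 𝒜] {J : Ideal S} {r : ℕ}

theorem exists_homogeneous_equation [IsNoetherianRing S] {𝔣 D : Ideal S}
    (h𝔣 : GeneratedInDegree 𝒜 𝔣 r) (hD : D.IsHomogeneous 𝒜) {v : S} (hv : v ∈ 𝒜 r) {e : ℕ}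
    (h : ∀ x ∈ degreePart 𝒜 D e, v * x ∈ 𝔣 * D) :
    ∃ d, ∃ b : ℕ → S, (∀ i < d, b i ∈ degreePart 𝒜 (𝔣 ^ (d - i)) (r * (d - i))) ∧
      ∀ x ∈ degreePart 𝒜 D e, (v ^ d + ∑ i ∈ Finset.range d, b i * v ^ i) * x = 0 := by
  obtain ⟨p, hp, hcoeff, hzero⟩ := exists_monic_eval_mul_eq_zero
    (L := Ideal.span (degreePart 𝒜 D e : Set S)) (𝔣 := 𝔣) (v := v) fun x hx => by
      refine Submodule.span_induction ?_ ?_ ?_ ?_ hx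
      · intro x hx
        have h1 : v * x ∈ degreePart 𝒜 (𝔣 * D) (r + e) :=
          ⟨h x hx, SetLike.mul_mem_graded hv hx.2⟩
        rw [h𝔣.degreePart_mul hD] at h1
        refine Submodule.mul_induction_on h1 (fun a ha b hb => ?_) fun a b ha hb => add_mem ha hb
        exact Ideal.mul_mem_mul ha.1 (Ideal.subset_span hb)
      · simp
      · intro a b _ _ ha hb
        rw [mul_add]; exact add_mem ha hb
      · intro s a _ ha
        rw [smul_eq_mul, mul_left_comm]; exact Ideal.mul_mem_left _ _ ha
  refine ⟨p.natDegree, fun i => DirectSum.decompose 𝒜 (p.coeff i) (r * (p.natDegree - i)),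
    fun i _ => decompose_mem_degreePart ((h𝔣.pow _).isHomogeneous) (hcoeff i) _, fun x hx => ?_⟩
  have h1 := hzero x (Ideal.subset_span hx)
  rw [Polynomial.eval_eq_sum_range, Finset.sum_mul] at h1
  -- Taking the component of this degree replaces each coefficient by its component of degree r(deg
  -- p - i), which makes the equation homogeneous.
  have h2 := congrArg (GradedAlgebra.proj 𝒜 (r * p.natDegree + e)) h1
  rw [map_sum, map_zero] at h2
  have h3 : ∀ i ∈ Finset.range (p.natDegree + 1),
      GradedAlgebra.proj 𝒜 (r * p.natDegree + e) (p.coeff i * v ^ i * x) =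
        DirectSum.decompose 𝒜 (p.coeff i) (r * (p.natDegree - i)) * v ^ i * x := by
    intro i hi
    have hi' : i ≤ p.natDegree := Nat.lt_succ_iff.1 (Finset.mem_range.1 hi)
    have hvx : v ^ i * x ∈ 𝒜 (r * i + e) := by
      have := SetLike.pow_mem_graded i hv
      rw [smul_eq_mul, mul_comm] at this
      exact SetLike.mul_mem_graded this hx.2
    rw [mul_assoc, mul_assoc, ← DirectSum.coe_decompose_mul_add_of_right_mem 𝒜 hvx,
      ← add_assoc, ← mul_add, Nat.sub_add_cancel hi', GradedAlgebra.proj_apply]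
  rw [Finset.sum_congr rfl h3, Finset.sum_range_succ, hp.coeff_natDegree, Nat.sub_self, mul_zero,
    coe_decompose_of_mem (SetLike.GradedOne.one_mem), one_mul] at h2
  rw [add_mul, Finset.sum_mul, add_comm]
  exact h2

theorem exists_equation_of_reductionHilbert_eq_zero [IsNoetherianRing S]
    (hJ : GeneratedInDegree 𝒜 J r) {𝔣 : Ideal S} (h𝔣 : GeneratedInDegree 𝒜 𝔣 r) (h𝔣J : 𝔣 ≤ J)
    {m n : ℕ} (h : reductionHilbert 𝒜 J r 𝔣 m n = 0) (hr : 0 < r) {v : S}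
    (hv : v ∈ degreePart 𝒜 J r) :
    ∃ d M, ∃ b : ℕ → S, (∀ i < d, b i ∈ degreePart 𝒜 (𝔣 ^ (d - i)) (r * (d - i))) ∧
      v ^ (d + M) + ∑ i ∈ Finset.range d, b i * v ^ (i + M) = 0 := by
  have h1 := reductionHilbert_add 𝒜 (r := r) h𝔣J m n
  rw [h, zero_add] at h1
  have h2 := Submodule.eq_of_le_of_finrank_eq
    (degreePart_mono (𝒜 := 𝒜) (mul_pow_le_pow_succ h𝔣J n) (r * (n + 1) + m)) h1
  -- The offset m is raised to rm, possible as r > 0, so that the power n + m of v has exactly the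
  -- degree rn + rm in which the equation holds and can serve as x.
  obtain ⟨u, hu⟩ := Nat.exists_eq_add_of_le (Nat.le_mul_of_pos_left m hr)
  have h3 : degreePart 𝒜 (J ^ (n + 1)) (r * (n + 1) + r * m) ≤
      (𝔣 * J ^ n).restrictScalars k := by
    rw [hu, (hJ.pow (n + 1)).degreePart_add, degree_add 𝒜, ← mul_assoc,
      ← (hJ.pow (n + 1)).degreePart_add, ← h2]
    exact Submodule.mul_le.2 fun a ha b _ => Ideal.mul_mem_right _ _ ha.1
  have hpow : ∀ i, v ^ i ∈ 𝒜 (r * i) := fun i => by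
    have := SetLike.pow_mem_graded i hv.2
    rwa [smul_eq_mul, mul_comm] at this
  obtain ⟨d, b, hb, hzero⟩ := exists_homogeneous_equation 𝒜 (D := J ^ n) (e := r * n + r * m) h𝔣
    (hJ.pow n).isHomogeneous hv.2 fun x hx => h3 ⟨by
      rw [pow_succ']; exact Ideal.mul_mem_mul hv.1 hx.1, by
      rw [show r * (n + 1) + r * m = r + (r * n + r * m) by ring]
      exact SetLike.mul_mem_graded hv.2 hx.2⟩
  refine ⟨d, n + m, b, hb, ?_⟩
  have h4 := hzero (v ^ (n + m)) ⟨by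
    rw [pow_add]; exact Ideal.mul_mem_right _ _ (Ideal.pow_mem_pow hv.1 n), by
    rw [← mul_add]; exact hpow _⟩
  rw [add_mul, ← pow_add, Finset.sum_mul] at h4
  rw [← h4]
  congr 1
  exact Finset.sum_congr rfl fun i _ => by rw [pow_add]; ring

end IntegralEquations

/-! ### Analytic spread of an ideal generated in one degree -/

section FiberDimension

variable {k B : Type*} [Field k] [CommRing B] [Algebra k B]

theorem ringKrullDim_le_of_isIntegral_adjoin {T : Set B} (hT : Algebra.adjoin k T = ⊤) {s : ℕ}
    (y : Fin s → B) (h : ∀ t ∈ T, IsIntegral (Algebra.adjoin k (Set.range y)) t) :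
    ringKrullDim B ≤ s := by
  have hint : Algebra.IsIntegral (Algebra.adjoin k (Set.range y)) B := ⟨fun b => by
    have hb : b ∈ Algebra.adjoin k T := hT ▸ trivial
    refine Algebra.adjoin_induction (fun t ht => h t ht) (fun c => ?_)
      (fun _ _ _ _ => IsIntegral.add) (fun _ _ _ _ => IsIntegral.mul) hb
    exact isIntegral_algebraMap (x := algebraMap k (Algebra.adjoin k (Set.range y)) c)⟩
  refine (ringKrullDim_le_of_algebra_isIntegral (Algebra.adjoin k (Set.range y)) B).trans ?_
  rw [Algebra.adjoin_range_eq_range_aeval]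
  refine (ringKrullDim_le_of_surjective _
    (MvPolynomial.aeval (R := k) y).toRingHom.rangeRestrict_surjective).trans ?_
  rw [MvPolynomial.ringKrullDim_of_isNoetherianRing, ringKrullDim_eq_zero_of_field]
  simp

theorem isIntegral_of_pow_add_sum_eq_zero {A : Type*} [CommRing A] [Algebra A B] {t : B}
    {d M : ℕ} {b : ℕ → B} (hb : ∀ i < d, b i ∈ (algebraMap A B).range)
    (h : t ^ (d + M) + ∑ i ∈ Finset.range d, b i * t ^ (i + M) = 0) : IsIntegral A t := by
  have hex : ∀ i, ∃ a : A, i < d → algebraMap A B a = b i := fun i => by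
    by_cases hi : i < d
    · obtain ⟨a, ha⟩ := hb i hi
      exact ⟨a, fun _ => ha⟩
    · exact ⟨0, fun h => absurd h hi⟩
  choose a ha using hex
  refine ⟨Polynomial.X ^ (d + M) + ∑ i ∈ Finset.range d,
    Polynomial.C (a i) * Polynomial.X ^ (i + M), Polynomial.monic_X_pow_add ?_, ?_⟩
  · refine lt_of_le_of_lt (Polynomial.degree_sum_le _ _) ?_
    rw [Finset.sup_lt_iff (WithBot.bot_lt_coe _)]
    intro i hi
    refine lt_of_le_of_lt (Polynomial.degree_C_mul_X_pow_le _ _) ?_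
    exact_mod_cast Nat.add_lt_add_right (Finset.mem_range.1 hi) M
  · rw [Polynomial.eval₂_add, Polynomial.eval₂_finsetSum, Polynomial.eval₂_X_pow, ← h]
    congr 1
    refine Finset.sum_congr rfl fun i hi => ?_
    rw [Polynomial.eval₂_mul, Polynomial.eval₂_C, Polynomial.eval₂_X_pow,
      ha i (Finset.mem_range.1 hi)]

end FiberDimension

section AnalyticSpread

variable {k S : Type*} [Field k] [CommRing S] [Algebra k S]
  (𝒜 : ℕ → Submodule k S) [GradedAlgebra 𝒜] [IsStandardGraded 𝒜] {J : Ideal S} {r : ℕ}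
  {R : Type*} [CommRing R] [Algebra S R] [Algebra k R] [IsScalarTower k S R]

theorem adjoin_image_eq_top_of_surjective {I 𝔪 : Ideal R} {E : Set R} (hE : Ideal.span E = I)
    (h𝔪 : ∀ a : R, ∃ c : k, a - algebraMap k R c ∈ 𝔪) {W : Type*} [CommRing W] [Algebra k W]
    (ψ : reesAlgebra I →ₐ[k] W) (hψ : Function.Surjective ψ)
    (hψ𝔪 : ∀ a ∈ 𝔪, ψ (algebraMap R _ a) = 0) :
    Algebra.adjoin k (ψ '' {z | ∃ v ∈ E, (z : Polynomial R) = Polynomial.monomial 1 v}) = ⊤ := by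
  set C := Algebra.adjoin k (ψ '' {z | ∃ v ∈ E, (z : Polynomial R) = Polynomial.monomial 1 v})
    with hC
  -- The preimage of C is an R-subalgebra, not just a k-subalgebra, because ψ kills 𝔪 and R = k + 𝔪.
  -- It contains It, hence is everything.
  let D : Subalgebra R (reesAlgebra I) :=
    { C.toSubsemiring.comap (ψ : reesAlgebra I →+* W) with
      algebraMap_mem' := fun a => by
        obtain ⟨c, hc⟩ := h𝔪 a
        change ψ (algebraMap R _ a) ∈ C
        have h1 : algebraMap R (reesAlgebra I) a = algebraMap R (reesAlgebra I)
            (a - algebraMap k R c) + algebraMap k (reesAlgebra I) c := by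
          rw [IsScalarTower.algebraMap_apply k R (reesAlgebra I), ← map_add, sub_add_cancel]
        rw [h1, map_add, hψ𝔪 _ hc, zero_add, AlgHom.commutes]
        exact C.algebraMap_mem c }
  have hmon : ∀ x ∈ I, Polynomial.monomial 1 x ∈ D.map (reesAlgebra I).val := by
    intro x hx
    rw [← hE] at hx
    refine Submodule.span_induction ?_ ?_ ?_ ?_ hx
    · intro v hv
      refine ⟨⟨Polynomial.monomial 1 v, reesAlgebra.monomial_mem.2 ?_⟩, ?_, rfl⟩
      · rw [pow_one, ← hE]; exact Ideal.subset_span hv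
      · exact Algebra.subset_adjoin ⟨_, ⟨v, hv, rfl⟩, rfl⟩
    · rw [map_zero]; exact zero_mem _
    · intro x y _ _ hx hy
      rw [map_add]; exact add_mem hx hy
    · intro a x _ hx
      rw [← Polynomial.smul_monomial]
      exact Subalgebra.smul_mem _ hx a
  have hD : reesAlgebra I ≤ D.map (reesAlgebra I).val := by
    refine (adjoin_monomial_eq_reesAlgebra I).ge.trans (Algebra.adjoin_le ?_)
    rintro _ ⟨x, hx, rfl⟩
    exact hmon x hx
  rw [eq_top_iff]
  rintro w -
  obtain ⟨p, rfl⟩ := hψ w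
  obtain ⟨p', hp', hpp'⟩ := hD p.2
  have : p' = p := Subtype.ext hpp'
  rw [← this]
  exact hp'

/-- In the lowest degree re, an element of the e-th power is a k-combination of products of e
generators; no coefficients of positive degree occur. This puts the coefficients of the integral
equations into the subalgebra generated by the chosen δ elements. -/
theorem exists_mem_adjoin_monomial {I : Ideal R} {W : Type*} [CommRing W] [Algebra k W]
    (ψ : reesAlgebra I →ₐ[k] W) {X : Set S} (hX : X ⊆ (𝒜 r : Set S))
    (hXI : ∀ x ∈ X, algebraMap S R x ∈ I) {Y : Subalgebra k W}
    (hY : ∀ x ∈ X, ∀ z : reesAlgebra I,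
      (z : Polynomial R) = Polynomial.monomial 1 (algebraMap S R x) → ψ z ∈ Y)
    (e : ℕ) {b : S} (hb : b ∈ degreePart 𝒜 (Ideal.span X ^ e) (r * e)) :
    ∃ p : reesAlgebra I, (p : Polynomial R) = Polynomial.monomial e (algebraMap S R b) ∧
      ψ p ∈ Y := by
  have hgen : GeneratedInDegree 𝒜 (Ideal.span X) r := ⟨X, hX, rfl⟩
  induction e generalizing b with
  | zero =>
    obtain ⟨c, rfl⟩ := exists_algebraMap_eq_of_mem_degree_zero 𝒜 hb.2
    refine ⟨algebraMap k _ c, ?_, ?_⟩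
    · rw [← IsScalarTower.algebraMap_apply]; rfl
    · rw [AlgHom.commutes]; exact Y.algebraMap_mem c
  | succ e ih =>
    have hadd : ∀ (n : ℕ) (a b : S), (∃ p : reesAlgebra I,
        (p : Polynomial R) = Polynomial.monomial n (algebraMap S R a) ∧ ψ p ∈ Y) →
        (∃ p : reesAlgebra I,
          (p : Polynomial R) = Polynomial.monomial n (algebraMap S R b) ∧ ψ p ∈ Y) →
        ∃ p : reesAlgebra I,
          (p : Polynomial R) = Polynomial.monomial n (algebraMap S R (a + b)) ∧ ψ p ∈ Y := by
      rintro n a b ⟨p, hp, hpY⟩ ⟨p', hp', hpY'⟩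
      refine ⟨p + p', ?_, ?_⟩
      · rw [map_add, map_add, ← hp, ← hp']; rfl
      · rw [map_add]; exact add_mem hpY hpY'
    rw [mul_add, mul_one, pow_succ, ((hgen.pow e).degreePart_mul hgen.isHomogeneous)] at hb
    refine Submodule.mul_induction_on hb (fun u hu v hv => ?_) fun a b ha hb => hadd _ a b ha hb
    obtain ⟨p, hp, hpY⟩ := ih hu
    have hv' : ∃ p : reesAlgebra I,
        (p : Polynomial R) = Polynomial.monomial 1 (algebraMap S R v) ∧ ψ p ∈ Y := by
      rw [degreePart_span_eq 𝒜 hX] at hv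
      refine Submodule.span_induction ?_ ?_ ?_ ?_ hv
      · intro x hx
        have hxm : Polynomial.monomial 1 (algebraMap S R x) ∈ reesAlgebra I :=
          reesAlgebra.monomial_mem.2 (by rw [pow_one]; exact hXI x hx)
        exact ⟨⟨_, hxm⟩, rfl, hY x hx _ rfl⟩
      · exact ⟨0, by simp, by rw [map_zero]; exact zero_mem _⟩
      · exact fun a b _ _ ha hb => hadd _ a b ha hb
      · rintro c a _ ⟨p, hp, hpY⟩
        refine ⟨c • p, ?_, ?_⟩
        · change c • (p : Polynomial R) = _
          rw [hp, Polynomial.smul_monomial]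
          congr 1
          rw [Algebra.smul_def, Algebra.smul_def, map_mul, ← IsScalarTower.algebraMap_apply]
        · rw [map_smul]; exact Subalgebra.smul_mem _ hpY c
    obtain ⟨p', hp', hpY'⟩ := hv'
    refine ⟨p * p', ?_, ?_⟩
    · change (p : Polynomial R) * p' = _
      rw [hp, hp', Polynomial.monomial_mul_monomial, map_mul (algebraMap S R)]
    · rw [map_mul]; exact mul_mem hpY hpY'

/-- Every degree-r element of J satisfies a homogeneous integral equation over F₀, …, F_{δ-1}, up to
a power of itself. Placing the coefficient of index i in t-degree d - i turns it into an equation in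
the Rees algebra, so W is integral over a k-algebra with δ generators. -/
theorem ringKrullDim_le_of_reductionHilbert_eq_zero [IsNoetherianRing S]
    (hJ : GeneratedInDegree 𝒜 J r) (hr : 0 < r) {F : ℕ → S} (hF : ∀ i, F i ∈ degreePart 𝒜 J r)
    {δ m n : ℕ} (h : reductionHilbert 𝒜 J r (initialIdeal F δ) m n = 0) {𝔪 : Ideal R}
    (h𝔪 : ∀ a : R, ∃ c : k, a - algebraMap k R c ∈ 𝔪) {W : Type*} [CommRing W]
    (ψ : reesAlgebra (J.map (algebraMap S R)) →+* W) (hψ : Function.Surjective ψ)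
    (hψ𝔪 : ∀ a ∈ 𝔪, ψ (algebraMap R _ a) = 0) : ringKrullDim W ≤ δ := by
  let _ : Algebra k W := (ψ.comp (algebraMap k _)).toAlgebra
  let ψ' : reesAlgebra (J.map (algebraMap S R)) →ₐ[k] W := { ψ with commutes' := fun _ => rfl }
  have hmem : ∀ v ∈ degreePart 𝒜 J r,
      Polynomial.monomial 1 (algebraMap S R v) ∈ reesAlgebra (J.map (algebraMap S R)) :=
    fun v hv => reesAlgebra.monomial_mem.2 (by
      rw [pow_one]; exact Ideal.mem_map_of_mem _ hv.1)
  refine ringKrullDim_le_of_isIntegral_adjoin (k := k)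
    (adjoin_image_eq_top_of_surjective (E := algebraMap S R '' (degreePart 𝒜 J r : Set S))
      (by rw [← Ideal.map_span, hJ.span_degreePart]) h𝔪 ψ' hψ hψ𝔪)
    (fun j : Fin δ => ψ' ⟨_, hmem (F j) (hF j)⟩) ?_
  rintro _ ⟨z, ⟨_, ⟨v, hv, rfl⟩, hz⟩, rfl⟩
  obtain ⟨d, M, b, hb, hzero⟩ := exists_equation_of_reductionHilbert_eq_zero 𝒜 hJ
    (generatedInDegree_initialIdeal (fun i => (hF i).2) δ)
    (initialIdeal_le (fun i => (hF i).1) δ) h hr hv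
  have hex : ∀ i, ∃ p : reesAlgebra (J.map (algebraMap S R)), i < d →
      (p : Polynomial R) = Polynomial.monomial (d - i) (algebraMap S R (b i)) ∧
      ψ' p ∈ Algebra.adjoin k (Set.range fun j : Fin δ => ψ' ⟨_, hmem (F j) (hF j)⟩) := by
    intro i
    by_cases hi : i < d
    · obtain ⟨p, hp⟩ := exists_mem_adjoin_monomial 𝒜 ψ' (X := F '' Set.Iio δ)
        (by rintro _ ⟨j, -, rfl⟩; exact (hF j).2)
        (by rintro _ ⟨j, -, rfl⟩; exact Ideal.mem_map_of_mem _ (hF j).1)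
        (Y := Algebra.adjoin k (Set.range fun j : Fin δ => ψ' ⟨_, hmem (F j) (hF j)⟩))
        (by
          rintro _ ⟨j, hj, rfl⟩ z hz
          exact Algebra.subset_adjoin ⟨⟨j, hj⟩, congrArg ψ' (Subtype.ext hz.symm)⟩)
        (d - i) (hb i hi)
      exact ⟨p, fun _ => hp⟩
    · exact ⟨0, fun h => absurd h hi⟩
  choose p hp using hex
  refine isIntegral_of_pow_add_sum_eq_zero (d := d) (M := M) (b := fun i => ψ' (p i))
    (fun i hi => ⟨⟨_, (hp i hi).2⟩, rfl⟩) ?_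
  have hrel : z ^ (d + M) + ∑ i ∈ Finset.range d, p i * z ^ (i + M) = 0 := by
    refine Subtype.ext ?_
    push_cast
    rw [hz, Polynomial.monomial_pow, one_mul]
    have h1 : ∀ i ∈ Finset.range d, (p i : Polynomial R) *
        Polynomial.monomial 1 (algebraMap S R v) ^ (i + M) =
        Polynomial.monomial (d + M) (algebraMap S R (b i * v ^ (i + M))) := fun i hi => by
      have hi := Finset.mem_range.1 hi
      rw [(hp i hi).1, Polynomial.monomial_pow, one_mul, Polynomial.monomial_mul_monomial,
        map_mul (algebraMap S R), map_pow (algebraMap S R), ← add_assoc, Nat.sub_add_cancel hi.le]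
    rw [Finset.sum_congr rfl h1, ← map_pow, ← map_sum, ← map_sum, ← map_add, ← map_add, hzero,
      map_zero, map_zero]
  have := congrArg ψ' hrel
  simpa using this

end AnalyticSpread

theorem analyticSpread_le_of_reductionHilbert_eq_zero {k S : Type*} [Field k] [CommRing S]
    [Algebra k S] (𝒜 : ℕ → Submodule k S) [GradedAlgebra 𝒜] [IsStandardGraded 𝒜]
    [IsNoetherianRing S] {J : Ideal S} {r : ℕ} (hJ : GeneratedInDegree 𝒜 J r) (hr : 0 < r)
    {F : ℕ → S} (hF : ∀ i, F i ∈ degreePart 𝒜 J r) {δ m n : ℕ}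
    (h : reductionHilbert 𝒜 J r (initialIdeal F δ) m n = 0) :
    analyticSpread (J.map (algebraMap S (LocalizationAtIrrelevant 𝒜))) ≤ δ := by
  set I := J.map (algebraMap S (LocalizationAtIrrelevant 𝒜)) with hI
  let gr : reesAlgebra I →+* AssociatedGradedRing I :=
    Ideal.Quotient.mk (I.map (algebraMap _ (reesAlgebra I)))
  have hgr : Function.Surjective gr := Ideal.Quotient.mk_surjective
  refine ringKrullDim_le_of_reductionHilbert_eq_zero (k := k) 𝒜 hJ hr hF h
    (𝔪 := IsLocalRing.maximalIdeal (LocalizationAtIrrelevant 𝒜))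
    (exists_sub_algebraMap_mem_maximalIdeal 𝒜)
    ((Ideal.Quotient.mk ((IsLocalRing.maximalIdeal (LocalizationAtIrrelevant 𝒜)).map
      (algebraMap _ (AssociatedGradedRing I)))).comp gr)
    (Ideal.Quotient.mk_surjective.comp hgr) fun a ha => ?_
  exact Ideal.Quotient.eq_zero_iff_mem.2 (Ideal.mem_map_of_mem _ ha)

theorem mainTheorem5 {k S : Type*} [Field k] [Infinite k] [CommRing S] [Algebra k S]
    (𝒜 : ℕ → Submodule k S) [GradedAlgebra 𝒜] [IsStandardGraded 𝒜]
    (d : ℕ) (hd : 0 < d) (hdim : ringKrullDim S = d)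
    (r : ℕ) (hr : 0 < r)
    (J : Ideal S) (hJ : ∃ X : Set S, X ⊆ (𝒜 r : Set S) ∧ J = Ideal.span X)
    (I : Ideal (LocalizationAtIrrelevant 𝒜))
    (hI : I = J.map (algebraMap S (LocalizationAtIrrelevant 𝒜)))
    (hl : analyticSpread I = d) (hG : SatisfiesG J d) :
    HoldsForGeneral k (fun f : Fin (d - 1) → degreePart 𝒜 J r =>
      ∃ e : ℕ,
        HasMultiplicity (HomogeneousIdeal.irrelevant 𝒜).toIdeal
          (S ⧸ (Ideal.span (Set.range fun i => (f i : S))).colon (J : Set S)) (e : ℝ≥0∞) ∧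
        HasJMultiplicity I ((r : ℝ≥0∞) * (e : ℝ≥0∞))) := by
  obtain ⟨δ, rfl⟩ : ∃ δ, d = δ + 1 := ⟨d - 1, by omega⟩
  have hfin : Algebra.FiniteType k S := finiteType_of_isStandardGraded 𝒜
  have hnoeth : IsNoetherianRing S := Algebra.FiniteType.isNoetherianRing k S
  have hJ' : GeneratedInDegree 𝒜 J r := hJ
  obtain ⟨c, q, x, -, hc, ⟨m₁, hcq⟩, ⟨F, hF, m, n, hmn⟩, hgen⟩ :=
    exists_holdsForGeneral_finrank_colon 𝒜 hJ' hdim hG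
  -- Here the analytic spread enters: q is a value of `reductionHilbert` for δ elements, and its
  -- vanishing would give ℓ(I) ≤ δ.
  have hq : 0 < q := by
    rw [Nat.pos_iff_ne_zero]
    rintro rfl
    have h1 := analyticSpread_le_of_reductionHilbert_eq_zero 𝒜 hJ' hr hF hmn
    rw [← hI, hl] at h1
    exact absurd h1 (by exact_mod_cast Nat.not_succ_le_self δ)
  obtain ⟨U, hU, hne, h⟩ := hgen
  refine ⟨U, hU, hne, fun f hf => ⟨q, ?_, ?_⟩⟩
  · obtain ⟨M, hM⟩ := h f hf
    exact hasMultiplicity_quotient 𝒜 (isHomogeneous_colon (Ideal.homogeneous_span 𝒜 _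
      (by rintro _ ⟨i, rfl⟩; exact ⟨r, (f i).2.2⟩)) hJ') hq hM
  · rw [hI]
    exact_mod_cast hasJMultiplicity_map 𝒜 hJ' hdim hc hcq
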